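/- All graphs are finite and simple. For an edge $e=xy$ of a graph $G$, let $G/e$ be the simple graph obtained by contracting $e$: the vertices $x,y$ are replaced by one vertex $v_e$ adjacent to every other vertex that is adjacent to $x$ or $y$ (no loops or multiple edges arise). Let $H$ be a *minor* of $G$ if it is obtained by zero or more edge contractions from a subgraph of $G$, and let $h(G)$ be the Hadwiger number, the largest $t$ such that $K^t$ is a minor of $G$. A *solid graph* is one of the following. A *pyramid*: a cycle together with one further vertex joined to at least three vertices of the cycle. A *trihedron*: the union of three internally disjoint paths, each of length at least $2$, with the same two distinct ends. A *stamp*: the union of a triangle and three paths of length at least $1$ that start at the three vertices of the triangle, end at a common vertex $x$, and are disjoint apart from $x$. A *prism*: the union of two vertex-disjoint triangles $x_1x_2x_3$, $y_1y_2y_3$ and three pairwise vertex-disjoint paths joining $x_i$ to $y_i$ ($i=1,2,3$). Let $S(G)$ be the set of *solids* in $G$, i.e. induced subgraphs of $G$ isomorphic to a solid graph, let $C(G)$ be the set of induced cycles of $G$ (of length at least $3$), and put $$\beth^3(G)=|S(G)|-|C(G)|+|E(G)|-|V(G)|.$$ **Theorem.** Let $G$ be a graph. 1. For every edge $e=xy$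 of $G$ there is an injection $\Psi:S(G/e)\to S(G)$ such that for every $S\in S(G/e)$ the vertex set of $S$ is the image of the vertex set of $\Psi(S)$ under the map $V(G)\to V(G/e)$ that sends $x,y$ to $v_e$ and fixes all other vertices; moreover $$\beth^3(G/e)\le\beth^3(G).$$ 2. If $G$ is connected and $h=h(G)$, then $\beth^3(K^{h})\le\beth^3(G)$, and $$\binom{h}{4}-\binom{h}{3}+\binom{h}{2}-h\le\beth^3(G).$$ -/

import Mathlib

namespace GraphChar

/-- The vertex set of `G / xy`: the vertices `x, y` are removed and one new vertex `none`
(the contracted vertex) is added. -/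
abbrev ContractVert {V : Type*} (x y : V) : Type _ := Option {w : V // w ≠ x ∧ w ≠ y}

/-- The simple graph `G / xy` obtained by contracting `xy` to the single vertex `none`;
no loops or multiple edges are created. -/
def contract {V : Type*} (G : SimpleGraph V) (x y : V) : SimpleGraph (ContractVert x y) where
  Adj
    | some a, some b => G.Adj a b
    | some a, none => G.Adj x a ∨ G.Adj y a
    | none, some b => G.Adj x b ∨ G.Adj y b
    | none, none => False
  symm := ⟨by
    rintro (_ | a) (_ | b) h
    · exact h
    · exact h
    · exact h
    · exact G.adj_symm h⟩
  loopless := ⟨by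
    rintro (_ | a) h
    · exact h
    · exact G.irrefl h⟩

open Classical in
/-- The contraction map on vertices: `x` and `y` go to the new vertex, all others stay. -/
noncomputable def contractMap {V : Type*} (x y : V) (v : V) : ContractVert x y :=
  if h : v ≠ x ∧ v ≠ y then some ⟨v, h⟩ else none

universe u v

/-- `ContractsTo H G`: a graph isomorphic to `H` is obtained from `G` by zero or more edge
contractions. -/
inductive ContractsTo {W : Type v} (H : SimpleGraph W) : {V : Type u} → SimpleGraph V → Prop
  | iso {V : Type u} {G : SimpleGraph V} (φ : G ≃g H) : ContractsTo H G
  | step {V : Type u} {G : SimpleGraph V} {x y : V} (hxy : G.Adj x y)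
      (h : ContractsTo H (contract G x y)) : ContractsTo H G

/-- `H` is a minor of `G`: it is obtained by zero or more edge contractions from a subgraph
of `G`. -/
def IsMinor {W V : Type*} (H : SimpleGraph W) (G : SimpleGraph V) : Prop :=
  ∃ G' : G.Subgraph, ContractsTo H G'.coe

/-- The Hadwiger number: the largest `t` such that the complete graph on `t` vertices is a
minor of `G` (for finite `G` this set of numbers contains `0` and is bounded by the number of
vertices). -/
noncomputable def hadwigerNumber {V : Type*} (G : SimpleGraph V) : ℕ :=
  sSup {t : ℕ | IsMinor (⊤ : SimpleGraph (Fin t)) G}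

/-- `G` is a cycle (of length at least three). -/
def IsCycleGraph {V : Type*} (G : SimpleGraph V) : Prop :=
  ∃ n : ℕ, 3 ≤ n ∧ Nonempty (G ≃g SimpleGraph.cycleGraph n)

/-- A pyramid: a cycle together with one further vertex `w` that is joined to at least three
vertices of the cycle. -/
def IsPyramid {V : Type*} (G : SimpleGraph V) : Prop :=
  ∃ w : V, IsCycleGraph (G.induce {v | v ≠ w}) ∧ 3 ≤ (G.neighborSet w).ncard

/-- A trihedron: the union of three internally disjoint paths of length at least two with the
same two (distinct) ends. -/
def IsTrihedron {V : Type*} (G : SimpleGraph V) : Prop :=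
  ∃ (x y : V) (P : Fin 3 → G.Walk x y), x ≠ y ∧
    (∀ i, (P i).IsPath ∧ 2 ≤ (P i).length) ∧
    (∀ i j, i ≠ j → ∀ v, v ∈ (P i).support → v ∈ (P j).support → v = x ∨ v = y) ∧
    (∀ v, ∃ i, v ∈ (P i).support) ∧
    (∀ e ∈ G.edgeSet, ∃ i, e ∈ (P i).edges)

/-- A stamp: the union of a triangle and three paths of length at least one that start at the
three vertices of the triangle, end at the same vertex `x` and are otherwise disjoint. -/
def IsStamp {V : Type*} (G : SimpleGraph V) : Prop :=
  ∃ (t : Fin 3 → V) (x : V) (P : ∀ i, G.Walk (t i) x),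
    (∀ i j, i ≠ j → G.Adj (t i) (t j)) ∧
    (∀ i, (P i).IsPath ∧ 1 ≤ (P i).length) ∧
    (∀ i j, i ≠ j → ∀ v, v ∈ (P i).support → v ∈ (P j).support → v = x) ∧
    (∀ v, ∃ i, v ∈ (P i).support) ∧
    (∀ e ∈ G.edgeSet, (∃ i j, e = s(t i, t j)) ∨ ∃ i, e ∈ (P i).edges)

/-- A prism: the union of two disjoint triangles and three disjoint paths that join the
vertices of the first to the vertices of the second. -/
def IsPrism {V : Type*} (G : SimpleGraph V) : Prop :=
  ∃ (t t' : Fin 3 → V) (P : ∀ i, G.Walk (t i) (t' i)),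
    (∀ i j, i ≠ j → G.Adj (t i) (t j)) ∧
    (∀ i j, i ≠ j → G.Adj (t' i) (t' j)) ∧
    (∀ i j, t i ≠ t' j) ∧
    (∀ i, (P i).IsPath) ∧
    (∀ i j, i ≠ j → ∀ v, v ∈ (P i).support → v ∉ (P j).support) ∧
    (∀ v, ∃ i, v ∈ (P i).support) ∧
    (∀ e ∈ G.edgeSet, (∃ i j, e = s(t i, t j)) ∨ (∃ i j, e = s(t' i, t' j)) ∨
      ∃ i, e ∈ (P i).edges)

/-- Solid graphs: pyramids, trihedra, stamps and prisms. -/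
def IsSolidGraph {V : Type*} (G : SimpleGraph V) : Prop :=
  IsPyramid G ∨ IsTrihedron G ∨ IsStamp G ∨ IsPrism G

/-- The induced cycles of `G`. An induced subgraph is recorded by its vertex set, which
determines it. -/
def inducedCycles {V : Type*} (G : SimpleGraph V) : Set (Set V) :=
  {s | IsCycleGraph (G.induce s)}

/-- The solids in `G`, i.e. the induced subgraphs that are solid graphs, recorded by their
vertex sets. -/
def solids {V : Type*} (G : SimpleGraph V) : Set (Set V) :=
  {s | IsSolidGraph (G.induce s)}

/-- The third graph characteristic `|S(G)| - |C(G)| + |E(G)| - |V(G)|`. -/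
noncomputable def beth3 {V : Type*} (G : SimpleGraph V) : ℤ :=
  ((solids G).ncard : ℤ) - (inducedCycles G).ncard + G.edgeSet.ncard - Nat.card V

end GraphChar

/-! ### Induced paths, recorded by their ends and vertex sets. -/

namespace GraphChar

/-! Solids and induced cycles are handled as vertex sets. For a set `Z` of vertices of `G/e`, the
fibre of `Z` consists of the vertex sets of `G` that are mapped onto `Z`. If `Z` contains `v_e` and
`A` is the rest of `Z`, these are `A + x`, `A + y` and `A + x + y`; otherwise the fibre has one
member, with the same induced graph. Both `G` and `G/e` are induced subgraphs of one `jointGraph`,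
in which `v_e` is a vertex whose neighbourhood merges those of `x` and `y`.

The injection needs a solid in the fibre of every solid `Z` (`Merges.exists_solid`). The tool is a
uniform description of solids: apart from `K⁴`, they are the sets `C ∪ Q` where `C` is an induced
cycle and `Q` is a minimal connected set disjoint from `C` with neighbours at two nonadjacent
vertices of `C` (`MinSpread`). That such a union is always a solid is `MinSpread.isSolid`.
Conversely, the decomposition of a solid can be chosen so that a given vertex `v` lies in `Q`, or
lies on `C` and interacts with `Q` in a controlled way (`Clean`). When `v` is split into `x` and
`y`, one passes to a new cycle or a new connected set, takes a minimal spreading subset, and shows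
that it still uses everything except possibly one of `x`, `y`.

The inequality for `beth3` comes from a count in each fibre (`fibre_count`): the cycles in the fibre
of `Z`, plus 1 if `Z` is a solid, number at most the solids in the fibre, plus 1 if `Z` is a cycle,
plus 1 if `Z` is an edge coming from a triangle on `xy`. The key facts are that a solid minus a
vertex is never a path (`not_isSolid_insert`), and that a second way of closing a path to a cycle
creates a solid. Summed over `Z`, the triangle terms are compensated by the edges lost in the
contraction (`edge_count`), and the loss of `xy` by the loss of a vertex.

For the second part, a complete minor of a connected graph is reached by contractions alone, each of
which does not increase `beth3`; in a complete graph the solids include all 4-sets and the induced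
cycles are 3-sets. -/

/-- `IndPath G a b S`: the set `S` induces a path in `G` with ends `a` and `b`. -/
inductive IndPath {V : Type*} (G : SimpleGraph V) : V → V → Set V → Prop
  | single (a : V) : IndPath G a a {a}
  | cons {a b c : V} {S : Set V} (h : G.Adj a b) (ha : a ∉ S)
      (hS : ∀ u ∈ S, G.Adj a u → u = b) (p : IndPath G b c S) : IndPath G a c (insert a S)

namespace IndPath

variable {V W : Type*} {G : SimpleGraph V} {a b c d : V} {S T : Set V}

theorem left_mem (p : IndPath G a b S) : a ∈ S := by
  cases p <;> simp

theorem right_mem (p : IndPath G a b S) : b ∈ S := by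
  induction p with
  | single a => simp
  | cons _ _ _ _ ih => exact Set.mem_insert_of_mem _ ih

theorem concat (p : IndPath G a b S) (h : G.Adj b c) (hc : c ∉ S)
    (hS : ∀ u ∈ S, G.Adj u c → u = b) : IndPath G a c (insert c S) := by
  induction p with
  | single a =>
    rw [Set.pair_comm]
    exact .cons h (by simpa using fun e => hc (by simp [e])) (by simp) (.single c)
  | @cons a a' b S hab ha hS' p ih =>
    rw [Set.insert_comm]
    have hc' : c ≠ a ∧ c ∉ S := by simpa using hc
    refine .cons hab ?_ ?_ (ih h hc'.2 fun u hu => hS u (Set.mem_insert_of_mem _ hu))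
    · simpa [ha] using hc'.1.symm
    · rintro u (rfl | hu) hau
      · have := hS a (Set.mem_insert _ _) hau
        exact absurd (this ▸ p.right_mem) ha
      · exact hS' u hu hau

theorem reverse (p : IndPath G a b S) : IndPath G b a S := by
  induction p with
  | single a => exact .single a
  | cons h ha hS p ih => exact ih.concat h.symm ha fun u hu hua => hS u hu hua.symm

theorem append (p : IndPath G a b S) (q : IndPath G c d T) (h : G.Adj b c) (hd : Disjoint S T)
    (hST : ∀ u ∈ S, ∀ w ∈ T, G.Adj u w → u = b ∧ w = c) : IndPath G a d (S ∪ T) := by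
  induction p with
  | single a =>
    rw [Set.singleton_union]
    exact .cons h (by simpa using hd) (fun u hu hau => (hST a rfl u hu hau).2) q
  | @cons a a' b S hab ha hS p ih =>
    rw [Set.insert_union]
    rw [Set.disjoint_insert_left] at hd
    refine .cons hab ?_ ?_ (ih h hd.2 fun u hu => hST u (Set.mem_insert_of_mem _ hu))
    · simp [ha, hd.1]
    · rintro u (hu | hu) hau
      · exact hS u hu hau
      · have := (hST a (Set.mem_insert _ _) u hu hau).1
        exact absurd (this ▸ p.right_mem) ha

theorem relabel {G' : SimpleGraph W} {f : V → W} (p : IndPath G a b S) (hf : Set.InjOn f S)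
    (h : ∀ u ∈ S, ∀ w ∈ S, G.Adj u w ↔ G'.Adj (f u) (f w)) :
    IndPath G' (f a) (f b) (f '' S) := by
  induction p with
  | single a => rw [Set.image_singleton]; exact .single _
  | @cons a a' b S hab ha hS p ih =>
    rw [Set.image_insert_eq]
    have hm := p.left_mem
    refine .cons ((h _ (by simp) _ (by simp [hm])).1 hab) ?_ ?_
      (ih (hf.mono (Set.subset_insert _ _)) fun u hu w hw => h u (by simp [hu]) w (by simp [hw]))
    · rintro ⟨u, hu, he⟩
      exact ha (hf (Set.mem_insert_of_mem _ hu) (Set.mem_insert _ _) he ▸ hu)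
    · rintro _ ⟨u, hu, rfl⟩ hau
      rw [hS u hu ((h _ (by simp) _ (by simp [hu])).2 hau)]

theorem eq_singleton (p : IndPath G a a S) : S = {a} := by
  cases p with
  | single => rfl
  | cons h ha hS p => exact absurd p.right_mem ha

theorem trim_left (p : IndPath G a b S) (hab : a ≠ b) :
    ∃ c, IndPath G c b (S \ {a}) ∧ G.Adj a c ∧ ∀ u ∈ S, G.Adj a u → u = c := by
  cases p with
  | single => exact absurd rfl hab
  | @cons _ c _ S h ha hS p =>
    refine ⟨c, ?_, h, ?_⟩
    · rwa [Set.insert_sdiff_self_of_notMem ha]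
    · rintro u (rfl | hu) hau
      · exact absurd hau G.irrefl
      · exact hS u hu hau

theorem trim_right (p : IndPath G a b S) (hab : a ≠ b) :
    ∃ c, IndPath G a c (S \ {b}) ∧ G.Adj b c ∧ ∀ u ∈ S, G.Adj b u → u = c := by
  obtain ⟨c, hc, h⟩ := p.reverse.trim_left hab.symm
  exact ⟨c, hc.reverse, h⟩

theorem left_unique (p : IndPath G a b S) {u w : V} (hu : u ∈ S) (hw : w ∈ S) (hau : G.Adj a u)
    (haw : G.Adj a w) : u = w := by
  by_cases hab : a = b
  · subst hab
    rw [p.eq_singleton] at hu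
    obtain rfl : u = a := hu
    exact absurd hau G.irrefl
  · obtain ⟨c, -, -, h⟩ := p.trim_left hab
    rw [h u hu hau, h w hw haw]

/-- The part of an induced path behind the last vertex with a given property. -/
theorem exists_suffix (p : IndPath G a b S) (P : V → Prop) (h : ∃ u ∈ S, P u) :
    ∃ u T, T ⊆ S ∧ IndPath G u b T ∧ P u ∧ ∀ w ∈ T, P w → w = u := by
  induction p with
  | single a =>
    obtain ⟨u, rfl, hu⟩ := h
    exact ⟨u, _, subset_rfl, .single u, hu, by simp⟩
  | @cons a a' b S hab ha hS p ih =>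
    by_cases h' : ∃ u ∈ S, P u
    · obtain ⟨u, T, hT, h1⟩ := ih h'
      exact ⟨u, T, hT.trans (Set.subset_insert _ _), h1⟩
    · push Not at h'
      obtain ⟨u, rfl | hu, hPu⟩ := h
      · refine ⟨u, _, subset_rfl, .cons hab ha hS p, hPu, ?_⟩
        rintro w (rfl | hw) hPw
        · rfl
        · exact absurd hPw (h' w hw)
      · exact absurd hPu (h' u hu)

/-- Splitting an induced path in front of a vertex other than its first one. -/
theorem split (p : IndPath G a b S) {v : V} (hv : v ∈ S) (hva : v ≠ a) :
    ∃ u S₁ S₂, S = S₁ ∪ S₂ ∧ Disjoint S₁ S₂ ∧ IndPath G a u S₁ ∧ IndPath G v b S₂ ∧ G.Adj u v ∧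
      ∀ x ∈ S₁, ∀ y ∈ S₂, G.Adj x y → x = u ∧ y = v := by
  induction p with
  | single a => exact absurd hv hva
  | @cons a a' b S hab ha hS p ih =>
    have hv' : v ∈ S := by simpa [hva] using hv
    by_cases hva' : v = a'
    · subst hva'
      refine ⟨a, {a}, S, rfl, by simpa using ha, .single a, p, hab, ?_⟩
      rintro x rfl y hy hxy
      exact ⟨rfl, hS y hy hxy⟩
    · obtain ⟨u, S₁, S₂, rfl, hd, p₁, p₂, huv, he⟩ := ih hv' hva'
      have ha1 : a ∉ S₁ := fun h => ha (Or.inl h)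
      have ha2 : a ∉ S₂ := fun h => ha (Or.inr h)
      refine ⟨u, insert a S₁, S₂, (Set.insert_union ..).symm, ?_,
        .cons hab ha1 (fun u hu => hS u (Or.inl hu)) p₁, p₂, huv, ?_⟩
      · rw [Set.disjoint_insert_left]; exact ⟨ha2, hd⟩
      · rintro x (rfl | hx) y hy hxy
        · obtain rfl := hS y (Or.inr hy) hxy
          exact absurd hy (Set.disjoint_left.1 hd p₁.left_mem)
        · exact he x hx y hy hxy

theorem exists_two_neighbors (p : IndPath G a b S) {v : V} (hv : v ∈ S) (hva : v ≠ a)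
    (hvb : v ≠ b) : ∃ u ∈ S, ∃ w ∈ S, u ≠ w ∧ G.Adj v u ∧ G.Adj v w := by
  obtain ⟨u, S₁, S₂, rfl, hd, p₁, p₂, huv, he⟩ := p.split hv hva
  obtain ⟨c, pc, hc, -⟩ := p₂.trim_left hvb
  refine ⟨u, Or.inl p₁.right_mem, c, Or.inr pc.left_mem.1, ?_, huv.symm, hc⟩
  rintro rfl
  exact Set.disjoint_left.1 hd p₁.right_mem pc.left_mem.1

theorem no_three_neighbors (p : IndPath G a b S) {v x y z : V} (hv : v ∈ S) (hx : x ∈ S)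
    (hy : y ∈ S) (hz : z ∈ S) (hxy : x ≠ y) (hxz : x ≠ z) (hyz : y ≠ z) (hvx : G.Adj v x)
    (hvy : G.Adj v y) (hvz : G.Adj v z) : False := by
  induction p with
  | single a =>
    obtain rfl : v = a := hv
    obtain rfl : x = v := hx
    exact G.irrefl hvx
  | @cons a a' b S hab ha hS p ih =>
    have q := IndPath.cons hab ha hS p
    by_cases hva : v = a
    · subst hva
      exact hxy (q.left_unique hx hy hvx hvy)
    · have key : ∀ t ∈ insert a S, G.Adj v t → t = a → v = a' := fun t _ hvt e =>
        hS v (by simpa [hva] using hv) (e ▸ hvt.symm)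
      have hv' : v ∈ S := by simpa [hva] using hv
      by_cases hxa : x = a
      · have := key x hx hvx hxa
        subst this
        exact hyz (p.left_unique (by simpa [← hxa, hxy.symm] using hy)
          (by simpa [← hxa, hxz.symm] using hz) hvy hvz)
      by_cases hya : y = a
      · have := key y hy hvy hya
        subst this
        exact hxz (p.left_unique (by simpa [hxa] using hx)
          (by simpa [← hya, hyz.symm] using hz) hvx hvz)
      by_cases hza : z = a
      · have := key z hz hvz hza
        subst this
        exact hxy (p.left_unique (by simpa [hxa] using hx) (by simpa [hya] using hy) hvx hvy)
      exact ih hv' (by simpa [hxa] using hx) (by simpa [hya] using hy) (by simpa [hza] using hz)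

/-- An induced path has no nonempty set of vertices that induces minimum degree two. -/
theorem no_core (p : IndPath G a b S) (hT : T ⊆ S) (hne : T.Nonempty)
    (h : ∀ v ∈ T, ∃ u ∈ T, ∃ w ∈ T, u ≠ w ∧ G.Adj v u ∧ G.Adj v w) : False := by
  induction p with
  | single a =>
    obtain ⟨v, hv⟩ := hne
    obtain ⟨u, hu, w, hw, huw, -⟩ := h v hv
    exact huw ((hT hu).trans (hT hw).symm)
  | @cons a a' b S hab ha hS p ih =>
    have q := IndPath.cons hab ha hS p
    -- An end of the path has only one neighbour on it, so it is not in `T` and can be dropped.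
    by_cases haT : a ∈ T
    · obtain ⟨u, hu, w, hw, huw, h1, h2⟩ := h a haT
      exact huw (q.left_unique (hT hu) (hT hw) h1 h2)
    · exact ih fun t ht => (hT ht).resolve_left fun e => haT (e ▸ ht)

/-- The second vertex of the inner path is a neighbour of `a` in `S`, hence also the second vertex
of the outer path; so the two paths agree vertex by vertex. -/
theorem eq_of_subset (p : IndPath G a b S) (q : IndPath G a b T) (h : T ⊆ S) : T = S := by
  induction p generalizing T with
  | single a => exact q.eq_singleton
  | @cons a a' b S hab ha hS p ih =>
    cases q with
    | single => exact absurd p.right_mem ha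
    | @cons _ a'' _ T hab' ha' hS' q =>
      have hTS : T ⊆ S := fun t ht =>
        (h (Set.mem_insert_of_mem _ ht)).resolve_left fun e => ha' (e ▸ ht)
      obtain rfl := hS _ (hTS q.left_mem) hab'
      rw [ih q hTS]

theorem finite (p : IndPath G a b S) : S.Finite := by
  induction p with
  | single a => exact Set.finite_singleton a
  | cons _ _ _ _ ih => exact ih.insert _

end IndPath

/-! ### Connected vertex sets. -/

/-- Reachability within a set of vertices. -/
def Reach {V : Type*} (G : SimpleGraph V) (T : Set V) : V → V → Prop :=
  Relation.ReflTransGen fun a b => a ∈ T ∧ b ∈ T ∧ G.Adj a b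

/-- The set `T` induces a connected (possibly empty) subgraph. -/
def Conn {V : Type*} (G : SimpleGraph V) (T : Set V) : Prop :=
  ∀ a ∈ T, ∀ b ∈ T, Reach G T a b

section Conn

variable {V W : Type*} {G : SimpleGraph V} {H : SimpleGraph W} {a b c : V} {S T : Set V}

theorem Reach.symm (h : Reach G T a b) : Reach G T b a := by
  induction h with
  | refl => exact .refl
  | tail _ h ih => exact .head ⟨h.2.1, h.1, h.2.2.symm⟩ ih

theorem Reach.mono (h : Reach G S a b) (hST : S ⊆ T) : Reach G T a b := by
  induction h with
  | refl => exact .refl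
  | tail _ h ih => exact .tail ih ⟨hST h.1, hST h.2.1, h.2.2⟩

theorem Reach.of_adj (ha : a ∈ T) (hb : b ∈ T) (h : G.Adj a b) : Reach G T a b :=
  .single ⟨ha, hb, h⟩

theorem Reach.trans (h : Reach G T a b) (h' : Reach G T b c) : Reach G T a c :=
  Relation.ReflTransGen.trans h h'

theorem Reach.map {f : V → W} {T' : Set W} (h : Reach G T a b) (hT : Set.MapsTo f T T')
    (hf : ∀ u ∈ T, ∀ w ∈ T, G.Adj u w → f u = f w ∨ H.Adj (f u) (f w)) :
    Reach H T' (f a) (f b) := by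
  induction h with
  | refl => exact .refl
  | @tail b c _ hbc ih =>
    rcases hf _ hbc.1 _ hbc.2.1 hbc.2.2 with e | e
    · rwa [← e]
    · exact ih.trans (.of_adj (hT hbc.1) (hT hbc.2.1) e)

theorem Conn.image {f : V → W} (h : Conn G T)
    (hf : ∀ u ∈ T, ∀ w ∈ T, G.Adj u w → f u = f w ∨ H.Adj (f u) (f w)) : Conn H (f '' T) := by
  rintro _ ⟨u, hu, rfl⟩ _ ⟨w, hw, rfl⟩
  exact (h u hu w hw).map (Set.mapsTo_image f T) hf

/-- Connectedness lifts along maps whose fibres are connected. -/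
theorem Conn.lift {f : V → W} {T' : Set W} (h : Conn H T') (hT : Set.MapsTo f T T')
    (hadj : ∀ u ∈ T', ∀ w ∈ T', H.Adj u w → ∃ u' ∈ T, ∃ w' ∈ T, f u' = u ∧ f w' = w ∧ G.Adj u' w')
    (hfib : ∀ u ∈ T, ∀ w ∈ T, f u = f w → Reach G T u w) : Conn G T := by
  intro a ha b hb
  have key : ∀ c, Reach H T' (f a) c → ∀ b ∈ T, f b = c → Reach G T a b := by
    intro c hc
    induction hc with
    | refl => exact fun b hb e => hfib a ha b hb e.symm
    | @tail c d _ hcd ih =>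
      intro b hb e
      obtain ⟨u, hu, w, hw, h1, h2, h3⟩ := hadj c hcd.1 d hcd.2.1 hcd.2.2
      exact ((ih u hu h1).trans (.of_adj hu hw h3)).trans (hfib w hw b hb (h2.trans e.symm))
  exact key _ (h _ (hT ha) _ (hT hb)) b hb rfl

theorem conn_singleton (a : V) : Conn G {a} := by
  rintro _ rfl _ rfl; exact .refl

theorem Conn.insert_adj (h : Conn G T) (hb : b ∈ T) (hab : G.Adj a b) :
    Conn G (insert a T) := by
  have h1 : ∀ u ∈ insert a T, Reach G (insert a T) u b := by
    rintro u (rfl | hu)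
    · exact .of_adj (Set.mem_insert _ _) (Set.mem_insert_of_mem _ hb) hab
    · exact (h u hu b hb).mono (Set.subset_insert _ _)
  exact fun u hu w hw => (h1 u hu).trans (h1 w hw).symm

theorem IndPath.conn (p : IndPath G a b S) : Conn G S := by
  induction p with
  | single a => exact conn_singleton a
  | cons h _ _ p ih => exact ih.insert_adj p.left_mem h

/-- A new first vertex is put in front of the part of the path that starts at its last neighbour
there, which keeps the path induced; if it already lies on the path, the path is cut at it. -/
theorem Reach.exists_indPath (h : Reach G T a b) (hb : b ∈ T) :
    ∃ S ⊆ T, IndPath G a b S := by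
  induction h using Relation.ReflTransGen.head_induction_on with
  | refl => exact ⟨{b}, by simpa using hb, .single b⟩
  | @head a c hac _ ih =>
    obtain ⟨S, hS, p⟩ := ih
    by_cases haS : a ∈ S
    · obtain ⟨u, S', hS', p', rfl, -⟩ := p.exists_suffix (· = a) ⟨a, haS, rfl⟩
      exact ⟨S', hS'.trans hS, p'⟩
    · obtain ⟨u, S', hS', p', h1, h2⟩ := p.exists_suffix (G.Adj a) ⟨c, p.left_mem, hac.2.2⟩
      exact ⟨_, Set.insert_subset hac.1 (hS'.trans hS), .cons h1 (fun h => haS (hS' h)) h2 p'⟩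

theorem Conn.exists_indPath (h : Conn G T) (ha : a ∈ T) (hb : b ∈ T) :
    ∃ S ⊆ T, IndPath G a b S := (h a ha b hb).exists_indPath hb

/-- An induced path inside `T` between the two ends is already all of `S`. Thus a proper connected
subset of a path misses an end, which is the source of minimality in `Tri.minSpread`. -/
theorem IndPath.eq_of_conn (p : IndPath G a b S) (hT : T ⊆ S) (hc : Conn G T) (ha : a ∈ T)
    (hb : b ∈ T) : T = S := by
  obtain ⟨S', hS', p'⟩ := hc.exists_indPath ha hb
  exact hT.antisymm (p.eq_of_subset p' (hS'.trans hT) ▸ hS')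

/-- A connected set with at least two vertices has no isolated vertex. -/
theorem Conn.exists_adj (h : Conn G T) (ha : a ∈ T) (hb : b ∈ T) (hab : a ≠ b) :
    ∃ c ∈ T, G.Adj a c := by
  obtain ⟨S, hS, p⟩ := h.exists_indPath ha hb
  obtain ⟨c, q, hc, -⟩ := p.trim_left hab
  exact ⟨c, hS q.left_mem.1, hc⟩

end Conn

end GraphChar

/-! ### Induced cycles, as a path closed by one vertex. -/

namespace GraphChar

/-- The path `S` with ends `a`, `b` is closed to an induced cycle by the vertex `v`. -/
structure CycAt {V : Type*} (G : SimpleGraph V) (v a b : V) (S : Set V) : Prop where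
  path : IndPath G a b S
  ne : a ≠ b
  notMem : v ∉ S
  left : G.Adj v a
  right : G.Adj v b
  adj : ∀ u ∈ S, G.Adj v u → u = a ∨ u = b

/-- The set `C` induces a cycle. -/
def IsCyc {V : Type*} (G : SimpleGraph V) (C : Set V) : Prop :=
  ∃ v a b S, C = insert v S ∧ CycAt G v a b S

section Cyc

variable {V W : Type*} {G : SimpleGraph V} {H : SimpleGraph W} {a b c d u v w : V}
  {A B C S T : Set V}

theorem CycAt.symm (h : CycAt G v a b S) : CycAt G v b a S :=
  ⟨h.path.reverse, h.ne.symm, h.notMem, h.right, h.left, fun u hu hvu => (h.adj u hu hvu).symm⟩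

theorem CycAt.isCyc (h : CycAt G v a b S) : IsCyc G (insert v S) := ⟨v, a, b, S, rfl, h⟩

/-- The vertex `a` closes the path that runs through the rest of `A` and back along `B`. So `A`
needs two vertices, while `B` may be a single one. -/
theorem cycAt_of_paths (p : IndPath G a b A) (q : IndPath G c d B) (hd : Disjoint A B)
    (hab : a ≠ b) (hac : G.Adj a c) (hbd : G.Adj b d)
    (h : ∀ u ∈ A, ∀ w ∈ B, G.Adj u w → u = a ∧ w = c ∨ u = b ∧ w = d) :
    ∃ e f, CycAt G a e f (A \ {a} ∪ B) := by
  obtain ⟨e, pe, hae, he⟩ := p.trim_left hab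
  refine ⟨e, c, pe.append q.reverse hbd (hd.mono_left Set.sdiff_subset) ?_, ?_, ?_, hae, hac, ?_⟩
  · rintro u ⟨hu, hua⟩ w hw huw
    rcases h u hu w hw huw with ⟨rfl, -⟩ | h
    · exact absurd rfl hua
    · exact h
  · rintro rfl
    exact Set.disjoint_left.1 hd pe.left_mem.1 q.left_mem
  · rintro (h1 | h1)
    · exact h1.2 rfl
    · exact Set.disjoint_left.1 hd p.left_mem h1
  · rintro u (hu | hu) hau
    · exact Or.inl (he u hu.1 hau)
    · rcases h a p.left_mem u hu hau with ⟨-, h⟩ | ⟨h, -⟩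
      · exact Or.inr h
      · exact absurd h hab

theorem isCyc_of_paths (p : IndPath G a b A) (q : IndPath G c d B) (hd : Disjoint A B)
    (hab : a ≠ b) (hac : G.Adj a c) (hbd : G.Adj b d)
    (h : ∀ u ∈ A, ∀ w ∈ B, G.Adj u w → u = a ∧ w = c ∨ u = b ∧ w = d) :
    IsCyc G (A ∪ B) := by
  obtain ⟨e, f, h⟩ := cycAt_of_paths p q hd hab hac hbd h
  have := h.isCyc
  rwa [← Set.insert_union, Set.insert_sdiff_singleton, Set.insert_eq_of_mem p.left_mem] at this

theorem CycAt.rotate_left (h : CycAt G v a b S) : ∃ e f, CycAt G a e f (insert v S \ {a}) := by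
  obtain ⟨e, f, h'⟩ := cycAt_of_paths h.path (.single v)
    (by simpa using h.notMem) h.ne h.left.symm h.right.symm (by
      rintro u hu w rfl huw
      simpa using h.adj u hu huw.symm)
  refine ⟨e, f, ?_⟩
  rwa [Set.union_singleton, ← Set.insert_sdiff_of_notMem] at h'
  simpa using h.left.ne

/-- `IsCyc` singles out a closing vertex `v₀`, but every vertex can play its role: split the path in
front of `v` and prolong the first piece, read backwards, by `v₀`. -/
theorem IsCyc.cycAt (h : IsCyc G C) (hv : v ∈ C) : ∃ a b, CycAt G v a b (C \ {v}) := by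
  obtain ⟨v₀, a, b, S, rfl, h⟩ := h
  by_cases hv0 : v = v₀
  · subst hv0
    rw [Set.insert_sdiff_self_of_notMem h.notMem]
    exact ⟨a, b, h⟩
  by_cases hva : v = a
  · subst hva; exact h.rotate_left
  by_cases hvb : v = b
  · subst hvb; exact h.symm.rotate_left
  have hvS : v ∈ S := by simpa [hv0] using hv
  obtain ⟨u, S₁, S₂, rfl, hd, p₁, p₂, huv, he⟩ := h.path.split hvS hva
  have h0 : v₀ ∉ S₁ ∧ v₀ ∉ S₂ := by simpa using h.notMem
  have q : IndPath G u v₀ (insert v₀ S₁) := by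
    refine p₁.reverse.concat h.left.symm h0.1 ?_
    intro x hx hxv
    refine (h.adj x (Or.inl hx) hxv.symm).resolve_right ?_
    rintro rfl
    exact Set.disjoint_left.1 hd hx p₂.right_mem
  obtain ⟨e, f, h'⟩ := cycAt_of_paths p₂ q (by simp [h0.2, hd.symm]) hvb huv.symm h.right.symm (by
      rintro x hx y (rfl | hy) hxy
      · rcases h.adj x (Or.inr hx) hxy.symm with rfl | rfl
        · exact absurd hx (Set.disjoint_left.1 hd p₁.left_mem)
        · exact Or.inr ⟨rfl, rfl⟩
      · exact Or.inl (he y hy x hx hxy.symm).symm)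
  refine ⟨e, f, ?_⟩
  convert h' using 1
  ext x
  have : v ∉ S₁ := fun h => Set.disjoint_left.1 hd h p₂.left_mem
  simp only [Set.mem_sdiff, Set.mem_insert_iff, Set.mem_union, Set.mem_singleton_iff]
  grind

theorem IsCyc.exists_two_neighbors (h : IsCyc G C) (hv : v ∈ C) :
    ∃ u ∈ C, ∃ w ∈ C, u ≠ w ∧ G.Adj v u ∧ G.Adj v w := by
  obtain ⟨a, b, h⟩ := h.cycAt hv
  exact ⟨a, h.path.left_mem.1, b, h.path.right_mem.1, h.ne, h.left, h.right⟩

theorem IsCyc.no_three_neighbors (h : IsCyc G C) (hv : v ∈ C) {x y z : V} (hx : x ∈ C)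
    (hy : y ∈ C) (hz : z ∈ C) (hxy : x ≠ y) (hxz : x ≠ z) (hyz : y ≠ z) (hvx : G.Adj v x)
    (hvy : G.Adj v y) (hvz : G.Adj v z) : False := by
  obtain ⟨a, b, h⟩ := h.cycAt hv
  have h1 := h.adj x ⟨hx, hvx.ne'⟩ hvx
  have h2 := h.adj y ⟨hy, hvy.ne'⟩ hvy
  have h3 := h.adj z ⟨hz, hvz.ne'⟩ hvz
  grind

theorem IsCyc.not_subset_path (h : IsCyc G C) (p : IndPath G a b S) (hCS : C ⊆ S) : False := by
  refine p.no_core hCS ?_ fun v hv => h.exists_two_neighbors hv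
  obtain ⟨v, -, -, S, rfl, -⟩ := h
  exact ⟨v, by simp⟩

theorem IndPath.eq_pair (p : IndPath G a b S) (h : G.Adj a b) : S = {a, b} := by
  obtain ⟨c, q, hc, huniq⟩ := p.trim_left h.ne
  obtain rfl := huniq b p.right_mem h
  rw [← Set.insert_sdiff_self_of_mem p.left_mem, q.eq_singleton]

theorem IsCyc.eq_triangle (h : IsCyc G C) (ha : a ∈ C) (hb : b ∈ C) (hc : c ∈ C)
    (hab : G.Adj a b) (hac : G.Adj a c) (hbc : G.Adj b c) : C = {a, b, c} := by
  obtain ⟨x, y, h⟩ := h.cycAt ha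
  have h1 := h.adj b ⟨hb, hab.ne'⟩ hab
  have h2 := h.adj c ⟨hc, hac.ne'⟩ hac
  have hne := hbc.ne
  rw [← Set.insert_sdiff_self_of_mem ha]
  rcases h1 with rfl | rfl <;> rcases h2 with rfl | rfl
  · exact absurd rfl hne
  · rw [h.path.eq_pair hbc]
  · rw [h.path.reverse.eq_pair hbc]
  · exact absurd rfl hne

theorem isCyc_triangle (hab : G.Adj a b) (hac : G.Adj a c) (hbc : G.Adj b c) :
    IsCyc G {a, b, c} := by
  refine ⟨a, b, c, {b, c}, rfl, .cons hbc (by simpa using hbc.ne) (by simp) (.single c), hbc.ne,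
    by simp [hab.ne, hac.ne], hab, hac, by simp⟩

/-- Both arcs contain `u` and `w`. They are induced because an edge `uw`, the only possible chord,
is excluded. -/
theorem IsCyc.arcs (h : IsCyc G C) (hu : u ∈ C) (hw : w ∈ C) (hne : u ≠ w) (huw : ¬ G.Adj u w) :
    ∃ A B, IndPath G u w A ∧ IndPath G u w B ∧ C = A ∪ B ∧ (∀ x ∈ A, x ∈ B → x = u ∨ x = w) ∧
      ∀ x ∈ A, ∀ y ∈ B, G.Adj x y → x = u ∨ x = w ∨ y = u ∨ y = w := by
  obtain ⟨a, b, h⟩ := h.cycAt hu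
  have hwa : w ≠ a := fun e => huw (e ▸ h.left)
  have hwb : w ≠ b := fun e => huw (e ▸ h.right)
  obtain ⟨x, S₁, S₂, hS, hd, p₁, p₂, hxw, he⟩ := h.path.split (v := w) ⟨hw, hne.symm⟩ hwa
  have hu' : u ∉ S₁ ∪ S₂ := hS ▸ h.notMem
  have hadj := h.adj
  rw [hS] at hadj
  have hb1 : b ∉ S₁ := fun h' => Set.disjoint_left.1 hd h' p₂.right_mem
  have ha2 : a ∉ S₂ := fun h' => Set.disjoint_left.1 hd p₁.left_mem h'
  have hw1 : w ∉ S₁ := fun h' => Set.disjoint_left.1 hd h' p₂.left_mem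
  have p₁' := p₁.concat hxw hw1 fun y hy hyw => (he y hy w p₂.left_mem hyw).1
  refine ⟨insert u (insert w S₁), insert u S₂, .cons h.left ?_ ?_ p₁', .cons h.right ?_ ?_ p₂.reverse,
    ?_, ?_, ?_⟩
  · simp only [Set.mem_insert_iff, not_or]
    exact ⟨hne, fun h => hu' (Or.inl h)⟩
  · rintro y (rfl | hy) huy
    · exact absurd huy huw
    · refine (hadj y (Or.inl hy) huy).resolve_right ?_
      rintro rfl; exact hb1 hy
  · exact fun h => hu' (Or.inr h)
  · intro y hy huy
    refine (hadj y (Or.inr hy) huy).resolve_left ?_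
    rintro rfl; exact ha2 hy
  · rw [← Set.insert_sdiff_self_of_mem hu, hS]
    have := p₂.left_mem
    ext y; simp only [Set.mem_insert_iff, Set.mem_union]; grind
  · rintro y (rfl | rfl | hy) hy2
    · exact Or.inl rfl
    · exact Or.inr rfl
    · rcases hy2 with rfl | hy2
      · exact Or.inl rfl
      · exact absurd hy2 (Set.disjoint_left.1 hd hy)
  · rintro y (rfl | rfl | hy) z (rfl | hz) hyz
    · exact Or.inl rfl
    · exact Or.inl rfl
    · exact Or.inr (Or.inl rfl)
    · exact Or.inr (Or.inl rfl)
    · exact Or.inr (Or.inr (Or.inl rfl))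
    · exact Or.inr (Or.inr (Or.inr (he y hy z hz hyz).2))

theorem CycAt.relabel {f : V → W} (h : CycAt G v a b S) (hf : Set.InjOn f (insert v S))
    (hG : ∀ u ∈ insert v S, ∀ w ∈ insert v S, G.Adj u w ↔ H.Adj (f u) (f w)) :
    CycAt H (f v) (f a) (f b) (f '' S) where
  path := h.path.relabel (hf.mono (Set.subset_insert _ _))
    fun u hu w hw => hG u (Or.inr hu) w (Or.inr hw)
  ne e := h.ne (hf (Or.inr h.path.left_mem) (Or.inr h.path.right_mem) e)
  notMem := by
    rintro ⟨u, hu, e⟩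
    exact h.notMem (hf (Or.inr hu) (Or.inl rfl) e ▸ hu)
  left := (hG _ (Or.inl rfl) _ (Or.inr h.path.left_mem)).1 h.left
  right := (hG _ (Or.inl rfl) _ (Or.inr h.path.right_mem)).1 h.right
  adj := by
    rintro _ ⟨u, hu, rfl⟩ hvu
    rcases h.adj u hu ((hG _ (Or.inl rfl) _ (Or.inr hu)).2 hvu) with rfl | rfl
    · exact Or.inl rfl
    · exact Or.inr rfl

theorem IsCyc.relabel {f : V → W} (h : IsCyc G C) (hf : Set.InjOn f C)
    (hG : ∀ u ∈ C, ∀ w ∈ C, G.Adj u w ↔ H.Adj (f u) (f w)) : IsCyc H (f '' C) := by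
  obtain ⟨v, a, b, S, rfl, h⟩ := h
  rw [Set.image_insert_eq]
  exact (h.relabel hf hG).isCyc

/-- Numbering the vertices of a path connects the inductive predicate with `cycleGraph`, whose
adjacency is arithmetic. -/
theorem IndPath.exists_enum (p : IndPath G a b S) : ∃ (n : ℕ) (g : ℕ → V), g 0 = a ∧ g n = b ∧
    S = g '' Set.Iic n ∧ Set.InjOn g (Set.Iic n) ∧
    ∀ i ≤ n, ∀ j ≤ n, G.Adj (g i) (g j) ↔ i + 1 = j ∨ j + 1 = i := by
  induction p with
  | single a =>
    refine ⟨0, fun _ => a, rfl, rfl, ?_, ?_, ?_⟩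
    · ext; simp [eq_comm]
    · intro i hi j hj _
      simp only [Set.mem_Iic] at hi hj; omega
    · intro i hi j hj
      simp only [SimpleGraph.irrefl, false_iff]; omega
  | @cons a a' b S hab ha hS p ih =>
    obtain ⟨n, g, h0, hn, rfl, hinj, hadj⟩ := ih
    have hmem : ∀ i ≤ n, g i ∈ g '' Set.Iic n := fun i hi => ⟨i, hi, rfl⟩
    have key : ∀ j ≤ n, G.Adj a (g j) ↔ j = 0 := by
      intro j hj
      constructor
      · intro h
        exact hinj hj (Nat.zero_le n) ((hS _ (hmem j hj) h).trans h0.symm)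
      · rintro rfl; rwa [h0]
    refine ⟨n + 1, fun i => Nat.casesOn i a g, rfl, hn, ?_, ?_, ?_⟩
    · ext x
      constructor
      · rintro (rfl | ⟨i, hi, rfl⟩)
        · exact ⟨0, Nat.zero_le _, rfl⟩
        · exact ⟨i + 1, Nat.succ_le_succ hi, rfl⟩
      · rintro ⟨_ | i, hi, rfl⟩
        · exact Or.inl rfl
        · exact Or.inr (hmem i (Nat.le_of_succ_le_succ hi))
    · rintro (_ | i) hi (_ | j) hj e
      · rfl
      · exact absurd ((hmem j (Nat.le_of_succ_le_succ hj)) : g j ∈ _) (by rwa [← show a = g j from e])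
      · exact absurd ((hmem i (Nat.le_of_succ_le_succ hi)) : g i ∈ _) (by rwa [show g i = a from e])
      · exact congrArg _ (hinj (Nat.le_of_succ_le_succ hi) (Nat.le_of_succ_le_succ hj) e)
    · rintro (_ | i) hi (_ | j) hj
      · simp
      · simpa [eq_comm] using key j (Nat.le_of_succ_le_succ hj)
      · rw [G.adj_comm]
        simpa [eq_comm] using key i (Nat.le_of_succ_le_succ hi)
      · simpa using hadj i (Nat.le_of_succ_le_succ hi) j (Nat.le_of_succ_le_succ hj)

theorem cycleGraph_adj_iff {n : ℕ} (hn : 3 ≤ n) (i j : Fin n) :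
    (SimpleGraph.cycleGraph n).Adj i j ↔
      (i : ℕ) + 1 = j ∨ (j : ℕ) + 1 = i ∨ (i : ℕ) = 0 ∧ (j : ℕ) + 1 = n ∨
        (j : ℕ) = 0 ∧ (i : ℕ) + 1 = n := by
  rw [SimpleGraph.cycleGraph_adj', Fin.sub_def, Fin.sub_def]
  have hi := i.2
  have hj := j.2
  simp only
  rcases le_or_gt (i : ℕ) j with h | h
  · rcases h.eq_or_lt with h | h
    · rw [h, Nat.sub_add_cancel hj.le, Nat.mod_self]; omega
    · rw [Nat.mod_eq_of_lt (a := n - j + i) (by omega), show n - (i : ℕ) + j = n + (j - i) by omega,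
        Nat.add_mod_left, Nat.mod_eq_of_lt (by omega)]
      omega
  · rw [Nat.mod_eq_of_lt (a := n - i + j) (by omega), show n - (j : ℕ) + i = n + (i - j) by omega,
      Nat.add_mod_left, Nat.mod_eq_of_lt (by omega)]
    omega

theorem IsCyc.isCycleGraph {s : Set V} (h : IsCyc G s) : IsCycleGraph (G.induce s) := by
  obtain ⟨v, a, b, S, rfl, h⟩ := h
  obtain ⟨n, g, rfl, rfl, rfl, hinj, hadj⟩ := h.path.exists_enum
  have hn : n ≠ 0 := by rintro rfl; exact h.ne rfl
  have hmem : ∀ i ≤ n, g i ∈ g '' Set.Iic n := fun i hi => ⟨i, hi, rfl⟩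
  have hv : ∀ i ≤ n, v ≠ g i := fun i hi e => h.notMem (e ▸ hmem i hi)
  have key : ∀ j ≤ n, G.Adj v (g j) ↔ j = 0 ∨ j = n := by
    intro j hj
    constructor
    · intro h'
      exact (h.adj _ (hmem j hj) h').imp (hinj hj (Nat.zero_le n)) (hinj hj (Set.mem_Iic.2 le_rfl))
    · rintro (rfl | rfl)
      exacts [h.left, h.right]
  -- The closing vertex gets number 0 and the path vertices are shifted by one. The cycle has `n +
  -- 2` vertices, at least three because `n ≠ 0`.
  let f : ℕ → V := fun i => Nat.casesOn i v g
  have hf : ∀ i ≤ n + 1, f i ∈ insert v (g '' Set.Iic n) := by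
    rintro (_ | i) hi
    · exact Or.inl rfl
    · exact Or.inr (hmem i (Nat.le_of_succ_le_succ hi))
  let F : Fin (n + 2) → ↥(insert v (g '' Set.Iic n)) :=
    fun i => ⟨f i, hf i (Nat.le_of_lt_succ i.2)⟩
  have hF : Function.Bijective F := by
    constructor
    · rintro ⟨_ | i, hi⟩ ⟨_ | j, hj⟩ e
      · rfl
      · exact absurd (congrArg Subtype.val e) (hv j (by omega))
      · exact absurd (congrArg Subtype.val e).symm (hv i (by omega))
      · have := hinj (show i ≤ n by omega) (show j ≤ n by omega) (congrArg Subtype.val e)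
        simpa using this
    · rintro ⟨x, rfl | ⟨i, hi, rfl⟩⟩
      · exact ⟨0, rfl⟩
      · exact ⟨⟨i + 1, Nat.lt_succ_of_le (Nat.succ_le_succ hi)⟩, rfl⟩
  refine ⟨n + 2, by omega, ⟨(RelIso.symm ⟨Equiv.ofBijective F hF, ?_⟩)⟩⟩
  rintro ⟨i, hi⟩ ⟨j, hj⟩
  rw [cycleGraph_adj_iff (by omega)]
  change G.Adj (f i) (f j) ↔ _
  rcases i with _ | i <;> rcases j with _ | j
  · simp [f]
  · refine (key j (by omega)).trans ?_
    simp only [true_and]; omega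
  · rw [G.adj_comm]
    refine (key i (by omega)).trans ?_
    simp only [true_and]; omega
  · refine (hadj i (by omega) j (by omega)).trans ?_
    simp only; omega

theorem indPath_of_enum {n : ℕ} (g : ℕ → V) (hinj : Set.InjOn g (Set.Iic n))
    (hadj : ∀ i ≤ n, ∀ j ≤ n, G.Adj (g i) (g j) ↔ i + 1 = j ∨ j + 1 = i) :
    IndPath G (g 0) (g n) (g '' Set.Iic n) := by
  induction n with
  | zero =>
    have : g '' Set.Iic 0 = {g 0} := by ext; simp [eq_comm]
    rw [this]; exact .single _
  | succ n ih =>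
    have h1 : Set.Iic (n + 1) = insert (n + 1) (Set.Iic n) := by
      ext; simp only [Set.mem_Iic, Set.mem_insert_iff]; omega
    have hsub : Set.Iic n ⊆ Set.Iic (n + 1) := by rw [h1]; exact Set.subset_insert _ _
    rw [h1, Set.image_insert_eq]
    refine (ih (hinj.mono hsub) fun i hi j hj => hadj i (by omega) j (by omega)).concat
      ((hadj n (by omega) (n + 1) le_rfl).2 (Or.inl rfl)) ?_ ?_
    · rintro ⟨i, hi, e⟩
      have := hinj (hsub hi) (Set.mem_Iic.2 le_rfl) e
      simp only [Set.mem_Iic] at hi; omega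
    · rintro _ ⟨i, hi, rfl⟩ h
      simp only [Set.mem_Iic] at hi
      have := (hadj i (by omega) (n + 1) le_rfl).1 h
      congr 1; omega

theorem isCyc_of_isCycleGraph {s : Set V} (h : IsCycleGraph (G.induce s)) : IsCyc G s := by
  obtain ⟨n, hn, ⟨φ⟩⟩ := h
  obtain ⟨m, rfl⟩ : ∃ m, n = m + 3 := ⟨n - 3, by omega⟩
  let f : ℕ → V := fun i => φ.symm (Fin.ofNat (m + 3) i)
  have hval : ∀ i < m + 3, ((Fin.ofNat (m + 3) i : Fin (m + 3)) : ℕ) = i := fun i hi =>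
    Nat.mod_eq_of_lt hi
  have hadj : ∀ i < m + 3, ∀ j < m + 3, G.Adj (f i) (f j) ↔
      i + 1 = j ∨ j + 1 = i ∨ i = 0 ∧ j + 1 = m + 3 ∨ j = 0 ∧ i + 1 = m + 3 := by
    intro i hi j hj
    have := cycleGraph_adj_iff (by omega) (Fin.ofNat (m + 3) i) (Fin.ofNat (m + 3) j)
    rw [hval i hi, hval j hj] at this
    rw [← this, ← φ.symm.map_adj_iff]
    rfl
  have hinj : Set.InjOn f (Set.Iio (m + 3)) := by
    intro i hi j hj e
    have := φ.symm.injective (Subtype.val_injective e)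
    rw [← hval i hi, ← hval j hj, this]
  -- Vertex 0 will close the cycle; the vertices 1 to `m + 2` form the path.
  have p := indPath_of_enum (G := G) (n := m + 1) (fun i => f (i + 1))
    (fun i hi j hj e => by
      simp only [Set.mem_Iic] at hi hj
      have := hinj (show i + 1 < m + 3 by omega) (show j + 1 < m + 3 by omega) e
      omega)
    (fun i hi j hj => by
      rw [hadj _ (by omega) _ (by omega)]; omega)
  refine ⟨f 0, _, _, _, ?_, p, ?_, ?_, ?_, ?_, ?_⟩
  · ext x
    constructor
    · intro hx
      obtain ⟨⟨i, hi⟩, h⟩ := φ.symm.surjective ⟨x, hx⟩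
      have hfi : f i = x := by
        have : Fin.ofNat (m + 3) i = ⟨i, hi⟩ := Fin.ext (hval i hi)
        simp only [f, this, h]
      rcases i with _ | i
      · exact Or.inl hfi.symm
      · exact Or.inr ⟨i, by simp only [Set.mem_Iic]; omega, hfi⟩
    · rintro (rfl | ⟨i, -, rfl⟩)
      · exact Subtype.coe_prop _
      · exact Subtype.coe_prop _
  · intro e
    have := hinj (show 0 + 1 < m + 3 by omega) (show m + 1 + 1 < m + 3 by omega) e
    omega
  · rintro ⟨i, hi, e⟩
    simp only [Set.mem_Iic] at hi
    have := hinj (show i + 1 < m + 3 by omega) (show 0 < m + 3 by omega) e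
    omega
  · exact (hadj _ (by omega) _ (by omega)).2 (by omega)
  · exact (hadj _ (by omega) _ (by omega)).2 (by omega)
  · rintro _ ⟨i, hi, rfl⟩ h
    simp only [Set.mem_Iic] at hi
    have := (hadj _ (by omega) _ (by omega)).1 h
    have h' : i = 0 ∨ i = m + 1 := by omega
    rcases h' with rfl | rfl
    · exact Or.inl rfl
    · exact Or.inr rfl

theorem isCycleGraph_induce_iff {s : Set V} : IsCycleGraph (G.induce s) ↔ IsCyc G s :=
  ⟨isCyc_of_isCycleGraph, IsCyc.isCycleGraph⟩

end Cyc

end GraphChar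

/-! ### Solids as vertex sets: pyramids and systems of three paths. -/

namespace GraphChar

/-- The set `s` induces a pyramid. -/
def IsWheel {V : Type*} (G : SimpleGraph V) (s : Set V) : Prop :=
  ∃ C w, IsCyc G C ∧ w ∉ C ∧ s = insert w C ∧ ∃ x ∈ C, ∃ y ∈ C, ∃ z ∈ C,
    x ≠ y ∧ x ≠ z ∧ y ≠ z ∧ G.Adj w x ∧ G.Adj w y ∧ G.Adj w z

/-- Three disjoint induced paths `A`, `B`, `Q` that form a trihedron, a stamp or a prism.
The ends `c, e` of `B, Q` are joined to the end `a` of `A`, and are joined to each other iff `l`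
holds; likewise for the ends `d, f`, `b` and `r`. -/
structure Tri {V : Type*} (G : SimpleGraph V) (l r : Prop) (a b : V) (A : Set V) (c d : V)
    (B : Set V) (e f : V) (Q : Set V) : Prop where
  pA : IndPath G a b A
  pB : IndPath G c d B
  pQ : IndPath G e f Q
  dAB : Disjoint A B
  dAQ : Disjoint A Q
  dBQ : Disjoint B Q
  ne : a ≠ b
  ac : G.Adj a c
  bd : G.Adj b d
  ae : G.Adj a e
  bf : G.Adj b f
  AB : ∀ u ∈ A, ∀ w ∈ B, G.Adj u w → u = a ∧ w = c ∨ u = b ∧ w = d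
  AQ : ∀ u ∈ A, ∀ w ∈ Q, G.Adj u w → u = a ∧ w = e ∨ u = b ∧ w = f
  BQ : ∀ u ∈ B, ∀ w ∈ Q, G.Adj u w ↔ l ∧ u = c ∧ w = e ∨ r ∧ u = d ∧ w = f
  -- Trihedron, stamp and prism in turn. In a trihedron only `A` could still be a single edge, since
  -- `B` and `Q` have lost the common ends; in a prism, `ne` and the last two inequalities make the
  -- triangles disjoint.
  shape : ¬l ∧ ¬r ∧ ¬G.Adj a b ∨ l ∧ ¬r ∨ l ∧ r ∧ c ≠ d ∧ e ≠ f

section Forms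

variable {V W : Type*} {G : SimpleGraph V} {H : SimpleGraph W} {l r : Prop}
  {a b c d e f v : V} {A B Q s : Set V}

/-- For trihedra only, where the apex of interest may be the left one; `shape` keeps the triangle of
a stamp on the left. -/
theorem Tri.reverse (h : Tri G l r a b A c d B e f Q) (hl : ¬l) (hr : ¬r) :
    Tri G r l b a A d c B f e Q where
  pA := h.pA.reverse
  pB := h.pB.reverse
  pQ := h.pQ.reverse
  dAB := h.dAB
  dAQ := h.dAQ
  dBQ := h.dBQ
  ne := h.ne.symm
  ac := h.bd
  bd := h.ac
  ae := h.bf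
  bf := h.ae
  AB u hu w hw huw := (h.AB u hu w hw huw).symm
  AQ u hu w hw huw := (h.AQ u hu w hw huw).symm
  BQ u hu w hw := by rw [h.BQ u hu w hw, or_comm]
  shape := Or.inl ⟨hr, hl, fun e => (h.shape.resolve_right (by simp [hl])).2.2 e.symm⟩

theorem IsWheel.relabel {g : V → W} (h : IsWheel G s) (hg : Set.InjOn g s)
    (hG : ∀ u ∈ s, ∀ w ∈ s, G.Adj u w ↔ H.Adj (g u) (g w)) : IsWheel H (g '' s) := by
  obtain ⟨C, w, hC, hw, rfl, x, hx, y, hy, z, hz, hxy, hxz, hyz, h1, h2, h3⟩ := h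
  have i1 : ∀ u ∈ C, u ∈ insert w C := fun u hu => Or.inr hu
  have iw : w ∈ insert w C := Or.inl rfl
  refine ⟨g '' C, g w, hC.relabel (hg.mono i1) fun u hu w hw => hG u (i1 u hu) w (i1 w hw), ?_,
    Set.image_insert_eq, g x, ⟨x, hx, rfl⟩, g y, ⟨y, hy, rfl⟩, g z, ⟨z, hz, rfl⟩,
    fun e => hxy (hg (i1 x hx) (i1 y hy) e), fun e => hxz (hg (i1 x hx) (i1 z hz) e),
    fun e => hyz (hg (i1 y hy) (i1 z hz) e), (hG _ iw _ (i1 x hx)).1 h1,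
    (hG _ iw _ (i1 y hy)).1 h2, (hG _ iw _ (i1 z hz)).1 h3⟩
  rintro ⟨u, hu, e⟩
  exact hw (hg (i1 u hu) iw e ▸ hu)

theorem Tri.relabel {g : V → W} (h : Tri G l r a b A c d B e f Q) (hs : s = A ∪ B ∪ Q)
    (hg : Set.InjOn g s)
    (hG : ∀ u ∈ s, ∀ w ∈ s, G.Adj u w ↔ H.Adj (g u) (g w)) :
    Tri H l r (g a) (g b) (g '' A) (g c) (g d) (g '' B) (g e) (g f) (g '' Q) := by
  have hA : A ⊆ s := by rw [hs]; intro u hu; simp [hu]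
  have hB : B ⊆ s := by rw [hs]; intro u hu; simp [hu]
  have hQ : Q ⊆ s := by rw [hs]; intro u hu; simp [hu]
  have ha := hA h.pA.left_mem
  have hb := hA h.pA.right_mem
  have hc := hB h.pB.left_mem
  have hd := hB h.pB.right_mem
  have he := hQ h.pQ.left_mem
  have hf := hQ h.pQ.right_mem
  have hdis : ∀ {S T : Set V}, S ⊆ s → T ⊆ s → Disjoint S T → Disjoint (g '' S) (g '' T) := by
    intro S T hS hT hd
    rw [Set.disjoint_left]
    rintro _ ⟨u, hu, rfl⟩ ⟨w, hw, e⟩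
    exact Set.disjoint_left.1 hd hu (hg (hT hw) (hS hu) e ▸ hw)
  have hp : ∀ {x y : V} {S : Set V}, S ⊆ s → IndPath G x y S → IndPath H (g x) (g y) (g '' S) :=
    fun hS p => p.relabel (hg.mono hS) fun u hu w hw => hG u (hS hu) w (hS hw)
  refine ⟨hp hA h.pA, hp hB h.pB, hp hQ h.pQ, hdis hA hB h.dAB, hdis hA hQ h.dAQ, hdis hB hQ h.dBQ,
    fun e => h.ne (hg ha hb e), (hG _ ha _ hc).1 h.ac, (hG _ hb _ hd).1 h.bd, (hG _ ha _ he).1 h.ae,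
    (hG _ hb _ hf).1 h.bf, ?_, ?_, ?_, ?_⟩
  · rintro _ ⟨u, hu, rfl⟩ _ ⟨w, hw, rfl⟩ huw
    rcases h.AB u hu w hw ((hG _ (hA hu) _ (hB hw)).2 huw) with ⟨rfl, rfl⟩ | ⟨rfl, rfl⟩ <;> simp
  · rintro _ ⟨u, hu, rfl⟩ _ ⟨w, hw, rfl⟩ huw
    rcases h.AQ u hu w hw ((hG _ (hA hu) _ (hQ hw)).2 huw) with ⟨rfl, rfl⟩ | ⟨rfl, rfl⟩ <;> simp
  · rintro _ ⟨u, hu, rfl⟩ _ ⟨w, hw, rfl⟩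
    rw [← hG _ (hB hu) _ (hQ hw), h.BQ u hu w hw, hg.eq_iff (hB hu) hc, hg.eq_iff (hQ hw) he,
      hg.eq_iff (hB hu) hd, hg.eq_iff (hQ hw) hf]
  · rw [← hG _ ha _ hb, Ne, hg.eq_iff hc hd, Ne, hg.eq_iff he hf]
    exact h.shape

/-- The sets that induce solid graphs, in terms of induced paths and cycles. -/
def IsSolid {V : Type*} (G : SimpleGraph V) (s : Set V) : Prop :=
  IsWheel G s ∨ ∃ l r a b A c d B e f Q, s = A ∪ B ∪ Q ∧ Tri G l r a b A c d B e f Q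

theorem IsSolid.relabel {g : V → W} (h : IsSolid G s) (hg : Set.InjOn g s)
    (hG : ∀ u ∈ s, ∀ w ∈ s, G.Adj u w ↔ H.Adj (g u) (g w)) : IsSolid H (g '' s) := by
  rcases h with h | ⟨l, r, a, b, A, c, d, B, e, f, Q, hs, h⟩
  · exact Or.inl (h.relabel hg hG)
  · refine Or.inr ⟨l, r, _, _, _, _, _, _, _, _, _, ?_, h.relabel hs hg hG⟩
    rw [hs, Set.image_union, Set.image_union]

/-- With this map, arbitrary outside `s`, the `relabel` lemmas carry a structure from `G` to
`G.induce s`. -/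
theorem exists_section {s : Set V} (hs : s.Nonempty) :
    ∃ g : V → s, Set.InjOn g s ∧ (∀ u ∈ s, (g u : V) = u) ∧ g '' s = Set.univ := by
  classical
  obtain ⟨x, hx⟩ := hs
  let g : V → s := fun u => if h : u ∈ s then ⟨u, h⟩ else ⟨x, hx⟩
  have hg : ∀ u ∈ s, (g u : V) = u := fun u hu => by simp [g, hu]
  refine ⟨g, fun u hu w hw e => ?_, hg, ?_⟩
  · rw [← hg u hu, ← hg w hw, e]
  · ext ⟨u, hu⟩
    simp only [Set.mem_univ, iff_true]
    exact ⟨u, hu, Subtype.ext (hg u hu)⟩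

theorem IsPyramid.isWheel (h : IsPyramid G) : IsWheel G Set.univ := by
  obtain ⟨w, hC, h3⟩ := h
  refine ⟨_, w, isCyc_of_isCycleGraph hC, by simp, by ext u; simp [em], ?_⟩
  -- `ncard` is 0 on infinite sets, so a positive value gives finiteness.
  have hfin : (G.neighborSet w).Finite := Set.finite_of_ncard_pos (by omega)
  obtain ⟨x, y, z, hx, hy, hz, hxy, hxz, hyz⟩ := (Set.two_lt_ncard_iff hfin).1 h3
  exact ⟨x, hx.ne', y, hy.ne', z, hz.ne', hxy, hxz, hyz, hx, hy, hz⟩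

theorem IsWheel.isPyramid (h : IsWheel G Set.univ) : IsPyramid G := by
  obtain ⟨C, w, hC, hw, hs, x, hx, y, hy, z, hz, hxy, hxz, hyz, h1, h2, h3⟩ := h
  have hCw : C = {v | v ≠ w} := by
    ext u
    constructor
    · rintro hu rfl; exact hw hu
    · intro hu
      exact (hs ▸ Set.mem_univ u : u ∈ insert w C).resolve_left hu
  refine ⟨w, hCw ▸ hC.isCycleGraph, ?_⟩
  obtain ⟨v, a, b, S, rfl, hS⟩ := hC
  -- The cycle is finite and, together with `w`, covers the graph.
  have hfin : (G.neighborSet w).Finite :=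
    ((hS.path.finite.insert v).insert w).subset (hs ▸ Set.subset_univ _)
  exact (Set.two_lt_ncard_iff hfin).2 ⟨x, y, z, h1, h2, h3, hxy, hxz, hyz⟩

theorem indPath_of_walk {u v : V} (p : G.Walk u v) (hp : p.IsPath)
    (h : ∀ x ∈ p.support, ∀ y ∈ p.support, G.Adj x y → s(x, y) ∈ p.edges) :
    IndPath G u v {x | x ∈ p.support} := by
  induction p with
  | nil =>
    convert IndPath.single (G := G) _ using 1
    ext; simp
  | @cons u v' w huv p ih =>
    rw [SimpleGraph.Walk.cons_isPath_iff] at hp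
    simp only [SimpleGraph.Walk.support_cons, SimpleGraph.Walk.edges_cons, List.mem_cons] at h
    have hset : {x | x ∈ (SimpleGraph.Walk.cons huv p).support} = insert u {x | x ∈ p.support} := by
      ext; simp
    rw [hset]
    refine .cons huv hp.2 ?_ (ih hp.1 ?_)
    · intro x hx hux
      rcases h u (Or.inl rfl) x (Or.inr hx) hux with e | e
      · rcases Sym2.eq_iff.1 e with ⟨-, e⟩ | ⟨e, -⟩
        · exact e
        · exact absurd e huv.ne
      · exact absurd (p.fst_mem_support_of_mem_edges e) hp.2
    · intro x hx y hy hxy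
      rcases h x (Or.inr hx) y (Or.inr hy) hxy with e | e
      · rcases Sym2.eq_iff.1 e with ⟨rfl, -⟩ | ⟨-, rfl⟩
        · exact absurd hx hp.2
        · exact absurd hy hp.2
      · exact e

theorem IndPath.exists_walk {S : Set V} (p : IndPath G a b S) : ∃ q : G.Walk a b, q.IsPath ∧
    (∀ x, x ∈ q.support ↔ x ∈ S) ∧ ∀ x ∈ S, ∀ y ∈ S, G.Adj x y → s(x, y) ∈ q.edges := by
  induction p with
  | single a =>
    refine ⟨.nil, by simp, by simp, ?_⟩
    rintro x rfl y rfl h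
    exact absurd h G.irrefl
  | @cons a a' b S hab ha hS p ih =>
    obtain ⟨q, h1, h2, h3⟩ := ih
    refine ⟨.cons hab q, ?_, ?_, ?_⟩
    · rw [SimpleGraph.Walk.cons_isPath_iff, h2]; exact ⟨h1, ha⟩
    · intro x; simp [h2]
    · simp only [SimpleGraph.Walk.edges_cons, List.mem_cons]
      rintro x (rfl | hx) y (rfl | hy) h
      · exact absurd h G.irrefl
      · left; rw [hS y hy h]
      · left; rw [hS x hx h.symm, Sym2.eq_swap]
      · exact Or.inr (h3 x hx y hy h)

theorem length_eq_one_of_mem_edges {u v : V} (p : G.Walk u v) (hp : p.IsPath)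
    (h : s(u, v) ∈ p.edges) : p.length = 1 := by
  cases p with
  | nil => simp at h
  | @cons _ v' _ huv p =>
    rw [SimpleGraph.Walk.cons_isPath_iff] at hp
    rw [SimpleGraph.Walk.edges_cons, List.mem_cons] at h
    rcases h with e | e
    · rcases Sym2.eq_iff.1 e with ⟨-, rfl⟩ | ⟨e, -⟩
      · rw [SimpleGraph.Walk.length_cons,
          SimpleGraph.Walk.length_eq_zero_iff.2 (SimpleGraph.Walk.isPath_iff_nil.1 hp.1)]
      · exact absurd e huv.ne
    · exact absurd (p.fst_mem_support_of_mem_edges e) hp.2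

/-- Three induced paths `A i` from `a i` to `b i` that form a trihedron, a stamp or a prism;
the ends `a i` form a triangle if `l` holds and coincide otherwise, likewise `b i` and `r`. -/
structure ThreePaths {V : Type*} (G : SimpleGraph V) (l r : Prop) (a b : Fin 3 → V)
    (A : Fin 3 → Set V) : Prop where
  path : ∀ i, IndPath G (a i) (b i) (A i)
  left : l → ∀ i j, i ≠ j → G.Adj (a i) (a j)
  left_eq : ¬l → ∀ i j, a i = a j
  right : r → ∀ i j, i ≠ j → G.Adj (b i) (b j)
  right_eq : ¬r → ∀ i j, b i = b j
  inter : ∀ i j, i ≠ j → ∀ u ∈ A i, u ∈ A j → ¬l ∧ u = a i ∨ ¬r ∧ u = b i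
  edges : ∀ u w, G.Adj u w → (∃ i, u ∈ A i ∧ w ∈ A i) ∨ (l ∧ ∃ i j, u = a i ∧ w = a j) ∨
    (r ∧ ∃ i j, u = b i ∧ w = b j)
  ne : ∀ i j, a i ≠ b j
  cover : ∀ u, ∃ i, u ∈ A i
  not_adj : ¬l → ¬r → ∀ i, ¬G.Adj (a i) (b i)
  shape : l ∨ ¬r

/-- The paths are induced: an edge with both ends on `P i` that is not an edge of `P i` lies on
another path or in an end triangle. In the first case it joins the two apexes, contrary to the
length bound; in the second its ends lie on different paths. -/
theorem threePaths_of_walks {a b : Fin 3 → V} (P : ∀ i, G.Walk (a i) (b i))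
    (hP : ∀ i, (P i).IsPath) (left : l → ∀ i j, i ≠ j → G.Adj (a i) (a j))
    (left_eq : ¬l → ∀ i j, a i = a j) (right : r → ∀ i j, i ≠ j → G.Adj (b i) (b j))
    (right_eq : ¬r → ∀ i j, b i = b j)
    (inter : ∀ i j, i ≠ j → ∀ u, u ∈ (P i).support → u ∈ (P j).support →
      ¬l ∧ u = a i ∨ ¬r ∧ u = b i)
    (edges : ∀ u w, G.Adj u w → (∃ i, s(u, w) ∈ (P i).edges) ∨
      (l ∧ ∃ i j, s(u, w) = s(a i, a j)) ∨ (r ∧ ∃ i j, s(u, w) = s(b i, b j)))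
    (ne : ∀ i j, a i ≠ b j) (cover : ∀ u, ∃ i, u ∈ (P i).support)
    (len : ¬l → ¬r → ∀ i, 2 ≤ (P i).length) (shape : l ∨ ¬r) :
    ThreePaths G l r a b fun i => {x | x ∈ (P i).support} := by
  have hl : ∀ i j, l → a i ∈ (P j).support → i = j := by
    intro i j hl h
    by_contra hij
    rcases inter i j hij _ (P i).start_mem_support h with h | h
    · exact h.1 hl
    · exact ne _ _ h.2
  have hr : ∀ i j, r → b i ∈ (P j).support → i = j := by
    intro i j hr h
    by_contra hij
    rcases inter i j hij _ (P i).end_mem_support h with h | h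
    · exact ne _ _ h.2.symm
    · exact h.1 hr
  have hlong : ¬l → ¬r → ∀ i j, s(a i, b i) ∉ (P j).edges := by
    intro hl hr i j h
    have e : s(a i, b i) = s(a j, b j) := by rw [left_eq hl i j, right_eq hr i j]
    rw [e] at h
    have := length_eq_one_of_mem_edges _ (hP j) h
    have := len hl hr j
    omega
  refine ⟨fun i => indPath_of_walk _ (hP i) ?_, left, left_eq, right, right_eq, inter, ?_, ne,
    cover, ?_, shape⟩
  · intro x hx y hy hxy
    rcases edges x y hxy with ⟨j, h⟩ | ⟨hl', j, k, h⟩ | ⟨hr', j, k, h⟩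
    · by_cases hij : i = j
      · rwa [hij]
      have h1 := inter i j hij x hx ((P j).fst_mem_support_of_mem_edges h)
      have h2 := inter i j hij y hy ((P j).snd_mem_support_of_mem_edges h)
      exfalso
      have hne := hxy.ne
      rcases h1 with ⟨n1, rfl⟩ | ⟨n1, rfl⟩ <;> rcases h2 with ⟨n2, rfl⟩ | ⟨n2, rfl⟩
      · exact hne rfl
      · exact hlong n1 n2 i j h
      · exact hlong n2 n1 i j (Sym2.eq_swap ▸ h)
      · exact hne rfl
    · exfalso
      rcases Sym2.eq_iff.1 h with ⟨rfl, rfl⟩ | ⟨rfl, rfl⟩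
      · exact hxy.ne (by rw [hl _ _ hl' hx, hl _ _ hl' hy])
      · exact hxy.ne (by rw [hl _ _ hl' hx, hl _ _ hl' hy])
    · exfalso
      rcases Sym2.eq_iff.1 h with ⟨rfl, rfl⟩ | ⟨rfl, rfl⟩
      · exact hxy.ne (by rw [hr _ _ hr' hx, hr _ _ hr' hy])
      · exact hxy.ne (by rw [hr _ _ hr' hx, hr _ _ hr' hy])
  · intro u w huw
    rcases edges u w huw with ⟨j, h⟩ | ⟨hl', j, k, h⟩ | ⟨hr', j, k, h⟩
    · exact Or.inl ⟨j, (P j).fst_mem_support_of_mem_edges h, (P j).snd_mem_support_of_mem_edges h⟩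
    · refine Or.inr (Or.inl ⟨hl', ?_⟩)
      rcases Sym2.eq_iff.1 h with ⟨rfl, rfl⟩ | ⟨rfl, rfl⟩
      exacts [⟨_, _, rfl, rfl⟩, ⟨_, _, rfl, rfl⟩]
    · refine Or.inr (Or.inr ⟨hr', ?_⟩)
      rcases Sym2.eq_iff.1 h with ⟨rfl, rfl⟩ | ⟨rfl, rfl⟩
      exacts [⟨_, _, rfl, rfl⟩, ⟨_, _, rfl, rfl⟩]
  · intro n1 n2 i h
    rcases edges _ _ h with ⟨j, h⟩ | ⟨hl', -⟩ | ⟨hr', -⟩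
    · exact hlong n1 n2 i j h
    · exact n1 hl'
    · exact n2 hr'

theorem IsTrihedron.threePaths (h : IsTrihedron G) :
    ∃ a b A, ThreePaths G False False a b A := by
  obtain ⟨x, y, P, hxy, hP, hint, hcov, hedge⟩ := h
  refine ⟨fun _ => x, fun _ => y, _, threePaths_of_walks P (fun i => (hP i).1) (fun h => h.elim)
    (fun _ _ _ => rfl) (fun h => h.elim) (fun _ _ _ => rfl) ?_ ?_ (fun _ _ => hxy) hcov
    (fun _ _ i => (hP i).2) (Or.inr id)⟩
  · intro i j hij u hi hj
    simpa using hint i j hij u hi hj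
  · intro u w huw
    exact Or.inl (hedge s(u, w) huw)

theorem IsStamp.threePaths (h : IsStamp G) :
    ∃ a b A, ThreePaths G True False a b A := by
  obtain ⟨t, x, P, ht, hP, hint, hcov, hedge⟩ := h
  refine ⟨t, fun _ => x, _, threePaths_of_walks P (fun i => (hP i).1) (fun _ => ht)
    (fun h => absurd trivial h) (fun h => h.elim) (fun _ _ _ => rfl) ?_ ?_ ?_ hcov
    (fun h => absurd trivial h) (Or.inr id)⟩
  · intro i j hij u hi hj
    simpa using hint i j hij u hi hj
  · intro u w huw
    rcases hedge s(u, w) huw with h | h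
    · exact Or.inr (Or.inl ⟨trivial, h⟩)
    · exact Or.inl h
  · intro i j e
    have h1 := (hP i).2
    have := (hP i).1
    have hnil : ∀ {y : V} (p : G.Walk y x), p.IsPath → y = x → p.length = 0 := by
      rintro y p hp rfl
      exact SimpleGraph.Walk.length_eq_zero_iff.2 (SimpleGraph.Walk.isPath_iff_nil.1 hp)
    have := hnil (P i) this e
    omega

theorem IsPrism.threePaths (h : IsPrism G) :
    ∃ a b A, ThreePaths G True True a b A := by
  obtain ⟨t, t', P, ht, ht', hne, hP, hint, hcov, hedge⟩ := h
  refine ⟨t, t', _, threePaths_of_walks P hP (fun _ => ht)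
    (fun h => absurd trivial h) (fun _ => ht') (fun h => absurd trivial h) ?_ ?_ hne hcov
    (fun h => absurd trivial h) (Or.inl trivial)⟩
  · intro i j hij u hi hj
    exact absurd hj (hint i j hij u hi)
  · intro u w huw
    rcases hedge s(u, w) huw with h | h | h
    · exact Or.inr (Or.inl ⟨trivial, h⟩)
    · exact Or.inr (Or.inr ⟨trivial, h⟩)
    · exact Or.inl h

end Forms

end GraphChar

/-! ### Decompositions at a given vertex, and the way back to solid graphs. -/

namespace GraphChar

section Forms

variable {V W : Type*} {G : SimpleGraph V} {H : SimpleGraph W} {l r : Prop}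
  {a b c d e f v x y : V} {A B Q s : Set V}

/-- An apex is common to all three paths, so it is kept on one of them and cut off from the other
two, while triangle vertices stay. The nonadjacency hypothesis ensures that something remains when
both ends are cut off. -/
theorem IndPath.trim_ends (p : IndPath G a b A) (l r : Prop) (hab : a ≠ b)
    (h : ¬l → ¬r → ¬G.Adj a b) :
    ∃ c d, IndPath G c d {u | u ∈ A ∧ (¬l → u ≠ a) ∧ (¬r → u ≠ b)} ∧ (l → c = a) ∧
      (¬l → G.Adj a c ∧ ∀ u ∈ A, G.Adj a u → u = c) ∧ (r → d = b) ∧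
      (¬r → G.Adj b d ∧ ∀ u ∈ A, G.Adj b u → u = d) := by
  by_cases hl : l
  · by_cases hr : r
    · refine ⟨a, b, ?_, fun _ => rfl, fun h => absurd hl h, fun _ => rfl, fun h => absurd hr h⟩
      simpa [hl, hr] using p
    · obtain ⟨d, q, h1, h2⟩ := p.trim_right hab
      refine ⟨a, d, ?_, fun _ => rfl, fun h => absurd hl h, fun h => absurd h hr,
        fun _ => ⟨h1, h2⟩⟩
      convert q using 1
      ext u; simp [hl, hr]
  · obtain ⟨c, q, h1, h2⟩ := p.trim_left hab
    by_cases hr : r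
    · refine ⟨c, b, ?_, fun h => absurd h hl, fun _ => ⟨h1, h2⟩, fun _ => rfl,
        fun h => absurd hr h⟩
      convert q using 1
      ext u; simp [hl, hr]
    · have hcb : c ≠ b := fun e => h hl hr (e ▸ h1)
      obtain ⟨d, q', h3, h4⟩ := q.trim_right hcb
      refine ⟨c, d, ?_, fun h => absurd h hl, fun _ => ⟨h1, h2⟩, fun h => absurd h hr,
        fun _ => ⟨h3, fun u hu hbu => h4 u ⟨hu, ?_⟩ hbu⟩⟩
      · convert q' using 1
        ext u; simp only [Set.mem_ofPred_eq, Set.mem_sdiff, Set.mem_singleton_iff]; tauto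
      · rintro rfl
        exact h hl hr hbu.symm

theorem ThreePaths.exists_tri {a b : Fin 3 → V} {A : Fin 3 → Set V} (h : ThreePaths G l r a b A)
    {i j k : Fin 3} (hij : i ≠ j) (hik : i ≠ k) (hjk : j ≠ k) (hall : ∀ m, m = i ∨ m = j ∨ m = k) :
    ∃ B c d Q e f, Q = {u | u ∈ A k ∧ (¬l → u ≠ a k) ∧ (¬r → u ≠ b k)} ∧
      Set.univ = A i ∪ B ∪ Q ∧ Tri G l r (a i) (b i) (A i) c d B e f Q := by
  obtain ⟨c, d, pB, hcl, hcl', hdr, hdr'⟩ := (h.path j).trim_ends l r (h.ne j j)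
    (fun h1 h2 => h.not_adj h1 h2 j)
  obtain ⟨e, f, pQ, hel, hel', hfr, hfr'⟩ := (h.path k).trim_ends l r (h.ne k k)
    (fun h1 h2 => h.not_adj h1 h2 k)
  have hal : ∀ m n, l → a m ∈ A n → m = n := by
    intro m n hl hm
    by_contra hmn
    rcases h.inter m n hmn _ (h.path m).left_mem hm with h' | h'
    · exact h'.1 hl
    · exact h.ne _ _ h'.2
  have hbr : ∀ m n, r → b m ∈ A n → m = n := by
    intro m n hr hm
    by_contra hmn
    rcases h.inter m n hmn _ (h.path m).right_mem hm with h' | h'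
    · exact h.ne _ _ h'.2.symm
    · exact h'.1 hr
  have huniq : ∀ {m n u}, u ∈ A m → (¬l → u ≠ a m) → (¬r → u ≠ b m) → u ∈ A n → m = n := by
    intro m n u hu h1 h2 hn
    by_contra hmn
    rcases h.inter m n hmn u hu hn with h' | h'
    · exact h1 h'.1 h'.2
    · exact h2 h'.1 h'.2
  -- edges between a full path and a trimmed path
  have hmix : ∀ {n c d}, i ≠ n → (l → c = a n) →
      (¬l → G.Adj (a n) c ∧ ∀ u ∈ A n, G.Adj (a n) u → u = c) → (r → d = b n) →
      (¬r → G.Adj (b n) d ∧ ∀ u ∈ A n, G.Adj (b n) u → u = d) → ∀ u ∈ A i, ∀ w ∈ A n,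
      (¬l → w ≠ a n) → (¬r → w ≠ b n) → G.Adj u w → u = a i ∧ w = c ∨ u = b i ∧ w = d := by
    intro n c d hin h1 h2 h3 h4 u hu w hw hwa hwb huw
    rcases h.edges u w huw with ⟨m, hum, hwm⟩ | ⟨hl, m, m', rfl, rfl⟩ | ⟨hr, m, m', rfl, rfl⟩
    · obtain rfl := huniq hw hwa hwb hwm
      rcases h.inter _ _ hin u hu hum with ⟨hl, rfl⟩ | ⟨hr, rfl⟩
      · refine Or.inl ⟨rfl, (h2 hl).2 w hw ?_⟩
        rwa [h.left_eq hl n i]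
      · refine Or.inr ⟨rfl, (h4 hr).2 w hw ?_⟩
        rwa [h.right_eq hr n i]
    · rw [h1 hl, hal _ _ hl hu, hal _ _ hl hw]; simp
    · rw [h3 hr, hbr _ _ hr hu, hbr _ _ hr hw]; simp
  have hleft : ∀ {n c}, i ≠ n → (l → c = a n) →
      (¬l → G.Adj (a n) c ∧ ∀ u ∈ A n, G.Adj (a n) u → u = c) → G.Adj (a i) c := by
    intro n c hin h1 h2
    by_cases hl : l
    · rw [h1 hl]; exact h.left hl _ _ hin
    · rw [h.left_eq hl i n]; exact (h2 hl).1
  have hright : ∀ {n d}, i ≠ n → (r → d = b n) →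
      (¬r → G.Adj (b n) d ∧ ∀ u ∈ A n, G.Adj (b n) u → u = d) → G.Adj (b i) d := by
    intro n c hin h1 h2
    by_cases hl : r
    · rw [h1 hl]; exact h.right hl _ _ hin
    · rw [h.right_eq hl i n]; exact (h2 hl).1
  refine ⟨_, c, d, _, e, f, rfl, ?_, h.path i, pB, pQ, ?_, ?_, ?_, h.ne i i, hleft hij hcl hcl',
    hright hij hdr hdr', hleft hik hel hel', hright hik hfr hfr', ?_, ?_, ?_, ?_⟩
  · ext u
    simp only [Set.mem_univ, Set.mem_union, Set.mem_ofPred_eq, true_iff]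
    obtain ⟨m, hm⟩ := h.cover u
    have hA : ∀ m, u ∈ A m → u ∉ A i → (¬l → u ≠ a m) ∧ (¬r → u ≠ b m) := by
      intro m _ hi
      constructor
      · rintro hl rfl
        exact hi (h.left_eq hl m i ▸ (h.path i).left_mem)
      · rintro hr rfl
        exact hi (h.right_eq hr m i ▸ (h.path i).right_mem)
    by_cases hi : u ∈ A i
    · exact Or.inl (Or.inl hi)
    · rcases hall m with rfl | rfl | rfl
      · exact absurd hm hi
      · exact Or.inl (Or.inr ⟨hm, hA _ hm hi⟩)
      · exact Or.inr ⟨hm, hA _ hm hi⟩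
  · rw [Set.disjoint_left]
    rintro u hu ⟨hu', h1, h2⟩
    exact hij (huniq hu' h1 h2 hu).symm
  · rw [Set.disjoint_left]
    rintro u hu ⟨hu', h1, h2⟩
    exact hik (huniq hu' h1 h2 hu).symm
  · rw [Set.disjoint_left]
    rintro u ⟨hu, -⟩ ⟨hu', h1, h2⟩
    exact hjk (huniq hu' h1 h2 hu).symm
  · rintro u hu w ⟨hw, h1, h2⟩ huw
    exact hmix hij hcl hcl' hdr hdr' u hu w hw h1 h2 huw
  · rintro u hu w ⟨hw, h1, h2⟩ huw
    exact hmix hik hel hel' hfr hfr' u hu w hw h1 h2 huw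
  · rintro u ⟨hu, h1, h2⟩ w ⟨hw, h3, h4⟩
    constructor
    · intro huw
      rcases h.edges u w huw with ⟨m, hum, hwm⟩ | ⟨hl, m, m', rfl, rfl⟩ | ⟨hr, m, m', rfl, rfl⟩
      · exact absurd ((huniq hu h1 h2 hum).trans (huniq hw h3 h4 hwm).symm) hjk
      · left
        rw [hcl hl, hel hl, hal _ _ hl hu, hal _ _ hl hw]; exact ⟨hl, rfl, rfl⟩
      · right
        rw [hdr hr, hfr hr, hbr _ _ hr hu, hbr _ _ hr hw]; exact ⟨hr, rfl, rfl⟩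
    · rintro (⟨hl, rfl, rfl⟩ | ⟨hr, rfl, rfl⟩)
      · rw [hcl hl, hel hl]; exact h.left hl _ _ hjk
      · rw [hdr hr, hfr hr]; exact h.right hr _ _ hjk
  · by_cases hl : l
    · by_cases hr : r
      · refine Or.inr (Or.inr ⟨hl, hr, ?_, ?_⟩)
        · rw [hcl hl, hdr hr]; exact h.ne _ _
        · rw [hel hl, hfr hr]; exact h.ne _ _
      · exact Or.inr (Or.inl ⟨hl, hr⟩)
    · have hr := h.shape.resolve_left hl
      exact Or.inl ⟨hl, hr, h.not_adj hl hr i⟩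

theorem exists_others (k : Fin 3) :
    ∃ i j, i ≠ j ∧ i ≠ k ∧ j ≠ k ∧ ∀ m, m = i ∨ m = j ∨ m = k := by
  revert k; decide

/-- A path through `v` is chosen as the trimmed path `Q`, so `v` is lost from `Q` only if it is an
apex. A left apex occurs only in a trihedron, which can be turned round. -/
theorem ThreePaths.exists_tri_at {a b : Fin 3 → V} {A : Fin 3 → Set V}
    (h : ThreePaths G l r a b A) (v : V) :
    ∃ l r a b A c d B e f Q, Set.univ = A ∪ B ∪ Q ∧ Tri G l r a b A c d B e f Q ∧
      (v ∈ Q ∨ ¬r ∧ v = b) := by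
  obtain ⟨k, hk⟩ := h.cover v
  obtain ⟨i, j, hij, hik, hjk, hall⟩ := exists_others k
  obtain ⟨B, c, d, Q, e, f, hQ, hcov, ht⟩ := h.exists_tri hij hik hjk hall
  by_cases hr : ¬r ∧ v = b k
  · exact ⟨_, _, _, _, _, _, _, _, _, _, _, hcov, ht, Or.inr ⟨hr.1, hr.2.trans (h.right_eq hr.1 _ _)⟩⟩
  by_cases hl : ¬l ∧ v = a k
  · have hr := h.shape.resolve_left hl.1
    exact ⟨_, _, _, _, _, _, _, _, _, _, _, hcov, ht.reverse hl.1 hr,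
      Or.inr ⟨hl.1, hl.2.trans (h.left_eq hl.1 _ _)⟩⟩
  · refine ⟨_, _, _, _, _, _, _, _, _, _, _, hcov, ht, Or.inl ?_⟩
    rw [hQ]
    exact ⟨hk, fun h1 h2 => hl ⟨h1, h2⟩, fun h1 h2 => hr ⟨h1, h2⟩⟩

/-- Every vertex of a solid graph is contained in the path `Q` of a suitable decomposition, or is
an apex of it, unless the graph is a pyramid. -/
theorem IsSolidGraph.exists_form (h : IsSolidGraph (G.induce s)) (hv : v ∈ s) :
    IsWheel G s ∨ ∃ l r a b A c d B e f Q, s = A ∪ B ∪ Q ∧ Tri G l r a b A c d B e f Q ∧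
      (v ∈ Q ∨ ¬r ∧ v = b) := by
  have hval : Set.InjOn (Subtype.val : s → V) Set.univ := Subtype.val_injective.injOn
  have himg : (Subtype.val : s → V) '' Set.univ = s := by simp
  have hG : ∀ u ∈ (Set.univ : Set s), ∀ w ∈ (Set.univ : Set s),
    (G.induce s).Adj u w ↔ G.Adj u.1 w.1 := fun _ _ _ _ => Iff.rfl
  have key : (∃ l r a b A, ThreePaths (G.induce s) l r a b A) →
      ∃ l r a b A c d B e f Q, s = A ∪ B ∪ Q ∧ Tri G l r a b A c d B e f Q ∧
      (v ∈ Q ∨ ¬r ∧ v = b) := by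
    rintro ⟨l, r, a, b, A, h⟩
    obtain ⟨l, r, a, b, A, c, d, B, e, f, Q, hs, ht, hQ⟩ := h.exists_tri_at ⟨v, hv⟩
    refine ⟨l, r, _, _, _, _, _, _, _, _, _, ?_, ht.relabel hs hval hG, ?_⟩
    · rw [← Set.image_union, ← Set.image_union, ← hs, himg]
    · rcases hQ with hQ | ⟨hr, rfl⟩
      · exact Or.inl ⟨_, hQ, rfl⟩
      · exact Or.inr ⟨hr, rfl⟩
  rcases h with h | h | h | h
  · left
    rw [← himg]
    exact h.isWheel.relabel hval hG
  · exact Or.inr (key ⟨_, _, h.threePaths⟩)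
  · exact Or.inr (key ⟨_, _, h.threePaths⟩)
  · exact Or.inr (key ⟨_, _, h.threePaths⟩)

theorem exists_three {α : Fin 3 → Sort*} (p : ∀ i, α i → Prop) (h0 : ∃ x, p 0 x)
    (h1 : ∃ x, p 1 x) (h2 : ∃ x, p 2 x) : ∃ f : ∀ i, α i, ∀ i, p i (f i) :=
  Classical.skolem.1 fun i => by fin_cases i <;> assumption

/-- Properties of a walk along an induced path. -/
def Follows {x y : V} (q : G.Walk x y) (S : Set V) : Prop :=
  q.IsPath ∧ (∀ u, u ∈ q.support ↔ u ∈ S) ∧ ∀ u ∈ S, ∀ w ∈ S, G.Adj u w → s(u, w) ∈ q.edges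

theorem Follows.one_le_length {q : G.Walk x y} (_ : Follows q A) (hxy : x ≠ y) :
    1 ≤ q.length := by
  by_contra h
  exact hxy (SimpleGraph.Walk.eq_of_length_eq_zero (p := q) (by omega))

theorem Follows.two_le_length {q : G.Walk x y} (hq : Follows q A) (hxy : x ≠ y)
    (h : ¬G.Adj x y) : 2 ≤ q.length := by
  by_contra h'
  have := hq.one_le_length hxy
  exact h (SimpleGraph.Walk.adj_of_length_eq_one (p := q) (by omega))

theorem isTrihedron_of_paths {A B C : Set V} (pA : IndPath G x y A) (pB : IndPath G x y B)
    (pC : IndPath G x y C) (hxy : x ≠ y) (hadj : ¬G.Adj x y)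
    (hAB : ∀ u ∈ A, u ∈ B → u = x ∨ u = y) (hAC : ∀ u ∈ A, u ∈ C → u = x ∨ u = y)
    (hBC : ∀ u ∈ B, u ∈ C → u = x ∨ u = y) (hcov : ∀ u, u ∈ A ∨ u ∈ B ∨ u ∈ C)
    (hedge : ∀ u w, G.Adj u w → u ∈ A ∧ w ∈ A ∨ u ∈ B ∧ w ∈ B ∨ u ∈ C ∧ w ∈ C) :
    IsTrihedron G := by
  obtain ⟨P, hP⟩ := exists_three (α := fun _ => G.Walk x y)
    (fun i q => Follows q (![A, B, C] i)) pA.exists_walk pB.exists_walk pC.exists_walk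
  refine ⟨x, y, P, hxy, fun i => ⟨(hP i).1, (hP i).two_le_length hxy hadj⟩, ?_, ?_, ?_⟩
  · intro i j hij u
    rw [(hP i).2.1, (hP j).2.1]
    intro h1 h2
    fin_cases i <;> fin_cases j <;> first
      | exact absurd rfl hij
      | exact hAB u h1 h2
      | exact hAB u h2 h1
      | exact hAC u h1 h2
      | exact hAC u h2 h1
      | exact hBC u h1 h2
      | exact hBC u h2 h1
  · intro u
    rcases hcov u with h | h | h
    · exact ⟨0, ((hP 0).2.1 u).2 h⟩
    · exact ⟨1, ((hP 1).2.1 u).2 h⟩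
    · exact ⟨2, ((hP 2).2.1 u).2 h⟩
  · intro e
    induction e using Sym2.ind with
    | _ u w =>
      intro h
      rcases hedge u w h with h' | h' | h'
      · exact ⟨0, (hP 0).2.2 u h'.1 w h'.2 h⟩
      · exact ⟨1, (hP 1).2.2 u h'.1 w h'.2 h⟩
      · exact ⟨2, (hP 2).2.2 u h'.1 w h'.2 h⟩

theorem triangle_adj {a b c : V} (hab : G.Adj a b) (hac : G.Adj a c) (hbc : G.Adj b c)
    (i j : Fin 3) (hij : i ≠ j) : G.Adj (![a, b, c] i) (![a, b, c] j) := by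
  fin_cases i <;> fin_cases j <;> first
    | exact absurd rfl hij
    | exact hab
    | exact hab.symm
    | exact hac
    | exact hac.symm
    | exact hbc
    | exact hbc.symm

theorem isStamp_of_paths {A B C : Set V} (pA : IndPath G a x A) (pB : IndPath G b x B)
    (pC : IndPath G c x C) (hab : G.Adj a b) (hac : G.Adj a c) (hbc : G.Adj b c)
    (ha : a ≠ x) (hb : b ≠ x) (hc : c ≠ x)
    (hAB : ∀ u ∈ A, u ∈ B → u = x) (hAC : ∀ u ∈ A, u ∈ C → u = x)
    (hBC : ∀ u ∈ B, u ∈ C → u = x) (hcov : ∀ u, u ∈ A ∨ u ∈ B ∨ u ∈ C)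
    (hedge : ∀ u w, G.Adj u w → (u ∈ A ∧ w ∈ A ∨ u ∈ B ∧ w ∈ B ∨ u ∈ C ∧ w ∈ C) ∨
      (∃ i j, s(u, w) = s(![a, b, c] i, ![a, b, c] j))) :
    IsStamp G := by
  obtain ⟨P, hP⟩ := exists_three (α := fun i => G.Walk (![a, b, c] i) x)
    (fun i q => Follows q (![A, B, C] i)) pA.exists_walk pB.exists_walk pC.exists_walk
  refine ⟨![a, b, c], x, P, triangle_adj hab hac hbc,
    fun i => ⟨(hP i).1, (hP i).one_le_length ?_⟩, ?_, ?_, ?_⟩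
  · fin_cases i <;> assumption
  · intro i j hij u
    rw [(hP i).2.1, (hP j).2.1]
    intro h1 h2
    fin_cases i <;> fin_cases j <;> first
      | exact absurd rfl hij
      | exact hAB u h1 h2
      | exact hAB u h2 h1
      | exact hAC u h1 h2
      | exact hAC u h2 h1
      | exact hBC u h1 h2
      | exact hBC u h2 h1
  · intro u
    rcases hcov u with h | h | h
    · exact ⟨0, ((hP 0).2.1 u).2 h⟩
    · exact ⟨1, ((hP 1).2.1 u).2 h⟩
    · exact ⟨2, ((hP 2).2.1 u).2 h⟩
  · intro e
    induction e using Sym2.ind with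
    | _ u w =>
      intro h
      rcases hedge u w h with (h' | h' | h') | h'
      · exact Or.inr ⟨0, (hP 0).2.2 u h'.1 w h'.2 h⟩
      · exact Or.inr ⟨1, (hP 1).2.2 u h'.1 w h'.2 h⟩
      · exact Or.inr ⟨2, (hP 2).2.2 u h'.1 w h'.2 h⟩
      · exact Or.inl h'

theorem isPrism_of_paths {A B C : Set V} {a' b' c' : V} (pA : IndPath G a a' A)
    (pB : IndPath G b b' B) (pC : IndPath G c c' C) (hab : G.Adj a b) (hac : G.Adj a c)
    (hbc : G.Adj b c) (hab' : G.Adj a' b') (hac' : G.Adj a' c') (hbc' : G.Adj b' c')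
    (ha : a ≠ a') (hb : b ≠ b') (hc : c ≠ c')
    (hAB : Disjoint A B) (hAC : Disjoint A C) (hBC : Disjoint B C)
    (hcov : ∀ u, u ∈ A ∨ u ∈ B ∨ u ∈ C)
    (hedge : ∀ u w, G.Adj u w → (u ∈ A ∧ w ∈ A ∨ u ∈ B ∧ w ∈ B ∨ u ∈ C ∧ w ∈ C) ∨
      (∃ i j, s(u, w) = s(![a, b, c] i, ![a, b, c] j)) ∨
      (∃ i j, s(u, w) = s(![a', b', c'] i, ![a', b', c'] j))) :
    IsPrism G := by
  obtain ⟨P, hP⟩ := exists_three (α := fun i => G.Walk (![a, b, c] i) (![a', b', c'] i))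
    (fun i q => Follows q (![A, B, C] i)) pA.exists_walk pB.exists_walk pC.exists_walk
  refine ⟨![a, b, c], ![a', b', c'], P, triangle_adj hab hac hbc, triangle_adj hab' hac' hbc', ?_,
    fun i => (hP i).1, ?_, ?_, ?_⟩
  · intro i j
    fin_cases i <;> fin_cases j <;> first
      | assumption
      | exact (hAB.ne_of_mem pA.left_mem pB.right_mem)
      | exact (hAC.ne_of_mem pA.left_mem pC.right_mem)
      | exact (hBC.ne_of_mem pB.left_mem pC.right_mem)
      | exact (hAB.symm.ne_of_mem pB.left_mem pA.right_mem)
      | exact (hAC.symm.ne_of_mem pC.left_mem pA.right_mem)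
      | exact (hBC.symm.ne_of_mem pC.left_mem pB.right_mem)
  · intro i j hij u
    rw [(hP i).2.1, (hP j).2.1]
    intro h1 h2
    fin_cases i <;> fin_cases j <;> first
      | exact absurd rfl hij
      | exact Set.disjoint_left.1 hAB h1 h2
      | exact Set.disjoint_left.1 hAB h2 h1
      | exact Set.disjoint_left.1 hAC h1 h2
      | exact Set.disjoint_left.1 hAC h2 h1
      | exact Set.disjoint_left.1 hBC h1 h2
      | exact Set.disjoint_left.1 hBC h2 h1
  · intro u
    rcases hcov u with h | h | h
    · exact ⟨0, ((hP 0).2.1 u).2 h⟩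
    · exact ⟨1, ((hP 1).2.1 u).2 h⟩
    · exact ⟨2, ((hP 2).2.1 u).2 h⟩
  · intro e
    induction e using Sym2.ind with
    | _ u w =>
      intro h
      rcases hedge u w h with (h' | h' | h') | h' | h'
      · exact Or.inr (Or.inr ⟨0, (hP 0).2.2 u h'.1 w h'.2 h⟩)
      · exact Or.inr (Or.inr ⟨1, (hP 1).2.2 u h'.1 w h'.2 h⟩)
      · exact Or.inr (Or.inr ⟨2, (hP 2).2.2 u h'.1 w h'.2 h⟩)
      · exact Or.inl h'
      · exact Or.inr (Or.inl h')

theorem Tri.isSolidGraph (h : Tri G l r a b A c d B e f Q) (hs : Set.univ = A ∪ B ∪ Q) :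
    IsSolidGraph G := by
  have hcov : ∀ u, u ∈ A ∨ u ∈ B ∨ u ∈ Q := fun u => by
    have : u ∈ A ∪ B ∪ Q := hs ▸ Set.mem_univ u
    simpa [or_assoc] using this
  have dAB : ∀ u ∈ A, u ∉ B := fun _ hu => Set.disjoint_left.1 h.dAB hu
  have dAQ : ∀ u ∈ A, u ∉ Q := fun _ hu => Set.disjoint_left.1 h.dAQ hu
  have dBQ : ∀ u ∈ B, u ∉ Q := fun _ hu => Set.disjoint_left.1 h.dBQ hu
  have haA := h.pA.left_mem
  have hbA := h.pA.right_mem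
  have hcB := h.pB.left_mem
  have hdB := h.pB.right_mem
  have heQ := h.pQ.left_mem
  have hfQ := h.pQ.right_mem
  -- classification of the edges
  have hedge : ∀ u w, G.Adj u w → (u ∈ A ∧ w ∈ A ∨ u ∈ B ∧ w ∈ B ∨ u ∈ Q ∧ w ∈ Q) ∨
      s(u, w) = s(a, c) ∨ s(u, w) = s(a, e) ∨ s(u, w) = s(b, d) ∨ s(u, w) = s(b, f) ∨
      (l ∧ s(u, w) = s(c, e)) ∨ (r ∧ s(u, w) = s(d, f)) := by
    intro u w huw
    simp only [Sym2.eq_iff]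
    have h1 := h.AB u
    have h2 := h.AQ u
    have h3 := h.BQ u
    have h4 := h.AB w
    have h5 := h.AQ w
    have h6 := h.BQ w
    have hwu := huw.symm
    rcases hcov u with hu | hu | hu <;> rcases hcov w with hw | hw | hw
    · simp [hu, hw]
    · rcases h1 hu w hw huw with ⟨rfl, rfl⟩ | ⟨rfl, rfl⟩ <;> simp
    · rcases h2 hu w hw huw with ⟨rfl, rfl⟩ | ⟨rfl, rfl⟩ <;> simp
    · rcases h4 hw u hu hwu with ⟨rfl, rfl⟩ | ⟨rfl, rfl⟩ <;> simp
    · simp [hu, hw]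
    · rcases (h3 hu w hw).1 huw with ⟨hl, rfl, rfl⟩ | ⟨hr, rfl, rfl⟩
      · simp [hl]
      · simp [hr]
    · rcases h5 hw u hu hwu with ⟨rfl, rfl⟩ | ⟨rfl, rfl⟩ <;> simp
    · rcases (h6 hw u hu).1 hwu with ⟨hl, rfl, rfl⟩ | ⟨hr, rfl, rfl⟩
      · simp [hl]
      · simp [hr]
    · simp [hu, hw]
  -- `extR` puts the right apex back on a trimmed path, and `extL` puts back both.
  have extR : ∀ {c d : V} {B : Set V}, IndPath G c d B → G.Adj b d → Disjoint A B →
      (∀ u ∈ A, ∀ w ∈ B, G.Adj u w → u = a ∧ w = c ∨ u = b ∧ w = d) →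
      IndPath G c b (insert b B) := by
    intro c d B pB hbd hd hAB
    refine pB.concat hbd.symm (Set.disjoint_left.1 hd hbA) fun u hu hub => ?_
    rcases hAB b hbA u hu hub.symm with ⟨e, -⟩ | ⟨-, e⟩
    · exact absurd e.symm h.ne
    · exact e
  have extL : ∀ {c d : V} {B : Set V}, IndPath G c d B → G.Adj a c → G.Adj b d → Disjoint A B →
      (∀ u ∈ A, ∀ w ∈ B, G.Adj u w → u = a ∧ w = c ∨ u = b ∧ w = d) → ¬G.Adj a b →
      IndPath G a b (insert a (insert b B)) := by
    intro c d B pB hac hbd hd hAB hab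
    refine .cons hac ?_ ?_ (extR pB hbd hd hAB)
    · rintro (e | h')
      · exact h.ne e
      · exact Set.disjoint_left.1 hd haA h'
    · rintro u (rfl | hu) hau
      · exact absurd hau hab
      · rcases hAB a haA u hu hau with ⟨-, e⟩ | ⟨e, -⟩
        · exact e
        · exact absurd e h.ne
  rcases h.shape with ⟨hl, hr, hab⟩ | ⟨hl, hr⟩ | ⟨hl, hr, hcd, hef⟩
  · refine Or.inr (Or.inl (isTrihedron_of_paths h.pA (extL h.pB h.ac h.bd h.dAB h.AB hab)
      (extL h.pQ h.ae h.bf h.dAQ h.AQ hab) h.ne hab ?_ ?_ ?_ ?_ ?_))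
    · rintro u hu (rfl | rfl | h')
      exacts [Or.inl rfl, Or.inr rfl, absurd h' (dAB u hu)]
    · rintro u hu (rfl | rfl | h')
      exacts [Or.inl rfl, Or.inr rfl, absurd h' (dAQ u hu)]
    · rintro u (rfl | rfl | h1) (e | e | h2)
      all_goals first
        | exact Or.inl rfl
        | exact Or.inr rfl
        | exact Or.inl e
        | exact Or.inr e
        | exact absurd h2 (dBQ _ h1)
    · intro u
      rcases hcov u with h' | h' | h' <;> simp [h']
    · intro u w huw
      rcases hedge u w huw with (h' | h' | h') | h' | h' | h' | h' | h' | h'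
      · exact Or.inl h'
      · simp [h'.1, h'.2]
      · simp [h'.1, h'.2]
      · rcases Sym2.eq_iff.1 h' with ⟨rfl, rfl⟩ | ⟨rfl, rfl⟩ <;> simp [hcB]
      · rcases Sym2.eq_iff.1 h' with ⟨rfl, rfl⟩ | ⟨rfl, rfl⟩ <;> simp [heQ]
      · rcases Sym2.eq_iff.1 h' with ⟨rfl, rfl⟩ | ⟨rfl, rfl⟩ <;> simp [hdB]
      · rcases Sym2.eq_iff.1 h' with ⟨rfl, rfl⟩ | ⟨rfl, rfl⟩ <;> simp [hfQ]
      · exact absurd h'.1 hl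
      · exact absurd h'.1 hr
  · refine Or.inr (Or.inr (Or.inl (isStamp_of_paths h.pA (extR h.pB h.bd h.dAB h.AB)
      (extR h.pQ h.bf h.dAQ h.AQ) h.ac h.ae ((h.BQ c hcB e heQ).2 (Or.inl ⟨hl, rfl, rfl⟩)) h.ne
      (h.dAB.ne_of_mem hbA hcB).symm (h.dAQ.ne_of_mem hbA heQ).symm ?_ ?_ ?_ ?_ ?_)))
    · rintro u hu (rfl | h')
      exacts [rfl, absurd h' (dAB u hu)]
    · rintro u hu (rfl | h')
      exacts [rfl, absurd h' (dAQ u hu)]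
    · rintro u (rfl | h1) (e | h2)
      exacts [rfl, rfl, e, absurd h2 (dBQ _ h1)]
    · intro u
      rcases hcov u with h' | h' | h' <;> simp [h']
    · intro u w huw
      rcases hedge u w huw with (h' | h' | h') | h' | h' | h' | h' | h' | h'
      · exact Or.inl (Or.inl h')
      · simp [h'.1, h'.2]
      · simp [h'.1, h'.2]
      · exact Or.inr ⟨0, 1, h'⟩
      · exact Or.inr ⟨0, 2, h'⟩
      · left
        rcases Sym2.eq_iff.1 h' with ⟨rfl, rfl⟩ | ⟨rfl, rfl⟩ <;> simp [hdB]
      · left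
        rcases Sym2.eq_iff.1 h' with ⟨rfl, rfl⟩ | ⟨rfl, rfl⟩ <;> simp [hfQ]
      · exact Or.inr ⟨1, 2, h'.2⟩
      · exact absurd h'.1 hr
  · refine Or.inr (Or.inr (Or.inr (isPrism_of_paths h.pA h.pB h.pQ h.ac h.ae
      ((h.BQ c hcB e heQ).2 (Or.inl ⟨hl, rfl, rfl⟩)) h.bd h.bf
      ((h.BQ d hdB f hfQ).2 (Or.inr ⟨hr, rfl, rfl⟩)) h.ne hcd hef h.dAB h.dAQ h.dBQ hcov ?_)))
    intro u w huw
    rcases hedge u w huw with h' | h' | h' | h' | h' | h' | h'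
    · exact Or.inl h'
    · exact Or.inr (Or.inl ⟨0, 1, h'⟩)
    · exact Or.inr (Or.inl ⟨0, 2, h'⟩)
    · exact Or.inr (Or.inr ⟨0, 1, h'⟩)
    · exact Or.inr (Or.inr ⟨0, 2, h'⟩)
    · exact Or.inr (Or.inl ⟨1, 2, h'.2⟩)
    · exact Or.inr (Or.inr ⟨1, 2, h'.2⟩)

theorem IsSolid.nonempty (h : IsSolid G s) : s.Nonempty := by
  rcases h with ⟨C, w, -, -, rfl, -⟩ | ⟨l, r, a, b, A, c, d, B, e, f, Q, rfl, h⟩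
  · exact ⟨w, Or.inl rfl⟩
  · exact ⟨a, Or.inl (Or.inl h.pA.left_mem)⟩

theorem IsSolid.isSolidGraph (h : IsSolid G s) : IsSolidGraph (G.induce s) := by
  obtain ⟨g, hg, hval, himg⟩ := exists_section h.nonempty
  have h' : IsSolid (G.induce s) Set.univ := by
    rw [← himg]
    refine h.relabel hg fun u hu w hw => ?_
    rw [SimpleGraph.comap_adj, ← hval u hu, ← hval w hw]
    simp [hval u hu, hval w hw]
  rcases h' with h' | ⟨l, r, a, b, A, c, d, B, e, f, Q, hs, h'⟩
  · exact Or.inl h'.isPyramid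
  · exact h'.isSolidGraph hs

theorem isSolidGraph_induce_iff : IsSolidGraph (G.induce s) ↔ IsSolid G s := by
  refine ⟨fun h => ?_, IsSolid.isSolidGraph⟩
  by_cases hs : s.Nonempty
  · obtain ⟨v, hv⟩ := hs
    rcases h.exists_form hv with h | ⟨l, r, a, b, A, c, d, B, e, f, Q, hs, h, -⟩
    · exact Or.inl h
    · exact Or.inr ⟨l, r, a, b, A, c, d, B, e, f, Q, hs, h⟩
  · exfalso
    have : IsEmpty s := by simpa [Set.not_nonempty_iff_eq_empty, Set.isEmpty_coe_sort] using hs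
    rcases h with ⟨w, -⟩ | ⟨w, -⟩ | ⟨t, -⟩ | ⟨t, -⟩
    exacts [this.elim w, this.elim w, this.elim (t 0), this.elim (t 0)]

end Forms

end GraphChar

/-! ### Solids as a cycle with a minimal spreading set. -/

namespace GraphChar

/-- The vertex `u` has a neighbour in `Q`. -/
def Att {V : Type*} (G : SimpleGraph V) (Q : Set V) (u : V) : Prop := ∃ q ∈ Q, G.Adj q u

/-- Two distinct nonadjacent vertices of `C` have neighbours in `Q`. -/
def Spread {V : Type*} (G : SimpleGraph V) (C Q : Set V) : Prop :=
  ∃ u ∈ C, ∃ w ∈ C, u ≠ w ∧ ¬G.Adj u w ∧ Att G Q u ∧ Att G Q w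

/-- An induced cycle `C` and a minimal connected set `Q` that attaches to two nonadjacent
vertices of `C`. -/
structure MinSpread {V : Type*} (G : SimpleGraph V) (C Q : Set V) : Prop where
  cyc : IsCyc G C
  disj : Disjoint C Q
  conn : Conn G Q
  spread : Spread G C Q
  min : ∀ Q₀ ⊆ Q, Conn G Q₀ → Spread G C Q₀ → Q₀ = Q

/-- The vertex `v` of `C` has at most one neighbour in `Q`, and a proper connected subset of `Q`
that contains it attaches to `C` in `v` only. -/
structure Clean {V : Type*} (G : SimpleGraph V) (C Q : Set V) (v : V) : Prop where
  mem : v ∈ C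
  unique : ∀ c ∈ Q, ∀ c' ∈ Q, G.Adj v c → G.Adj v c' → c = c'
  att : ∀ Q₀ ⊆ Q, Q₀ ≠ Q → Conn G Q₀ → Att G Q₀ v → ∀ u ∈ C, Att G Q₀ u → u = v

section Spread

variable {V : Type*} {G : SimpleGraph V} {l r : Prop}
  {a b c d e f u w v u' w' x y q q' : V} {A B C Q s : Set V}

theorem Att.mono {Q' : Set V} (h : Att G Q u) (hQ : Q ⊆ Q') : Att G Q' u := by
  obtain ⟨q, hq, h⟩ := h
  exact ⟨q, hQ hq, h⟩

theorem Spread.exists_min [Finite V] (hC : IsCyc G C) (hd : Disjoint C Q) (hQ : Conn G Q)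
    (h : Spread G C Q) : ∃ Q' ⊆ Q, MinSpread G C Q' := by
  obtain ⟨Q', hle, hmin⟩ := exists_minimal_le_of_wellFoundedLT
    (fun T : Set V => Conn G T ∧ Spread G C T) Q ⟨hQ, h⟩
  exact ⟨Q', hle, hC, hd.mono_right hle, hmin.1.1, hmin.1.2, fun Q₀ h0 h1 h2 =>
    h0.antisymm (hmin.2 ⟨h1, h2⟩ h0)⟩

theorem subset_singleton_eq {Q₀ : Set V} (h : Q₀ ⊆ {q}) (hne : Q₀.Nonempty) : Q₀ = {q} :=
  (Set.subset_singleton_iff_eq.1 h).resolve_left hne.ne_empty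

theorem Spread.nonempty (h : Spread G C Q) : Q.Nonempty := by
  obtain ⟨u, -, w, -, -, -, ⟨q, hq, -⟩, -⟩ := h
  exact ⟨q, hq⟩

theorem minSpread_singleton (hC : IsCyc G C) (hq : q ∉ C) (h : Spread G C {q}) :
    MinSpread G C {q} :=
  ⟨hC, by simpa using hq, conn_singleton q, h, fun _ h1 _ h2 =>
    subset_singleton_eq h1 h2.nonempty⟩

/-- The only proper subset of a singleton is empty and attaches to nothing. -/
theorem clean_singleton (hv : v ∈ C) : Clean G C {q} v := by
  refine ⟨hv, by simp +contextual, fun Q₀ h1 h2 _ h3 => absurd (subset_singleton_eq h1 ?_) h2⟩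
  obtain ⟨q, hq, -⟩ := h3
  exact ⟨q, hq⟩

/-- A pyramid that is not a `K⁴` is a cycle with a spreading vertex. -/
theorem IsWheel.minSpread (h : IsWheel G s) (hv : v ∈ s) :
    (∃ x y z w, s = {w, x, y, z} ∧ G.Adj w x ∧ G.Adj w y ∧ G.Adj w z ∧ G.Adj x y ∧ G.Adj x z ∧
      G.Adj y z) ∨
    ∃ C Q, s = C ∪ Q ∧ MinSpread G C Q ∧ (v ∈ Q ∨ Clean G C Q v) := by
  obtain ⟨C, w, hC, hw, rfl, x, hx, y, hy, z, hz, hxy, hxz, hyz, h1, h2, h3⟩ := h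
  by_cases hsp : Spread G C {w}
  · refine Or.inr ⟨C, {w}, by simp, minSpread_singleton hC hw hsp, ?_⟩
    rcases hv with rfl | hv
    · exact Or.inl rfl
    · exact Or.inr (clean_singleton hv)
  · left
    -- If the hub does not spread, its neighbours on the rim are pairwise adjacent; three of them
    -- then make up the whole rim, and the pyramid is a `K⁴`.
    have key : ∀ u ∈ C, ∀ u' ∈ C, u ≠ u' → G.Adj w u → G.Adj w u' → G.Adj u u' := by
      intro u hu u' hu' hne hw1 hw2
      by_contra hadj
      exact hsp ⟨u, hu, u', hu', hne, hadj, ⟨w, rfl, hw1⟩, ⟨w, rfl, hw2⟩⟩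
    have k1 := key x hx y hy hxy h1 h2
    have k2 := key x hx z hz hxz h1 h3
    have k3 := key y hy z hz hyz h2 h3
    exact ⟨x, y, z, w, by rw [hC.eq_triangle hx hy hz k1 k2 k3], h1, h2, h3, k1, k2, k3⟩

theorem Tri.isCyc (h : Tri G l r a b A c d B e f Q) : IsCyc G (A ∪ B) :=
  isCyc_of_paths h.pA h.pB h.dAB h.ne h.ac h.bd h.AB

theorem Tri.att (h : Tri G l r a b A c d B e f Q) (hu : u ∈ A ∪ B) (hq : q ∈ Q)
    (hqu : G.Adj q u) : q = e ∧ (u = a ∨ l ∧ u = c) ∨ q = f ∧ (u = b ∨ r ∧ u = d) := by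
  rcases hu with hu | hu
  · rcases h.AQ u hu q hq hqu.symm with ⟨rfl, rfl⟩ | ⟨rfl, rfl⟩ <;> simp
  · rcases (h.BQ u hu q hq).1 hqu.symm with ⟨hl, rfl, rfl⟩ | ⟨hr, rfl, rfl⟩
    · simp [hl]
    · simp [hr]

/-- A proper connected subset of `Q` misses `e` or `f`, so it attaches at one side only, where the
attachments are pairwise equal or adjacent. The nonadjacent pair supplied by `hlong` is `a, b` or
`b, c`. -/
theorem Tri.minSpread (h : Tri G l r a b A c d B e f Q) (hlong : ¬G.Adj a b ∨ l ∧ c ≠ d) :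
    MinSpread G (A ∪ B) Q := by
  refine ⟨h.isCyc, Set.disjoint_union_left.2 ⟨h.dAQ, h.dBQ⟩, h.pQ.conn, ?_, ?_⟩
  · rcases hlong with hab | ⟨hl, hcd⟩
    · exact ⟨a, Or.inl h.pA.left_mem, b, Or.inl h.pA.right_mem, h.ne, hab,
        ⟨e, h.pQ.left_mem, h.ae.symm⟩, ⟨f, h.pQ.right_mem, h.bf.symm⟩⟩
    · refine ⟨b, Or.inl h.pA.right_mem, c, Or.inr h.pB.left_mem,
        h.dAB.ne_of_mem h.pA.right_mem h.pB.left_mem, ?_, ⟨f, h.pQ.right_mem, h.bf.symm⟩,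
        ⟨e, h.pQ.left_mem,
          ((h.BQ c h.pB.left_mem e h.pQ.left_mem).2 (Or.inl ⟨hl, rfl, rfl⟩)).symm⟩⟩
      intro hbc
      rcases h.AB b h.pA.right_mem c h.pB.left_mem hbc with ⟨e, -⟩ | ⟨-, e⟩
      · exact h.ne e.symm
      · exact hcd e
  · rintro Q₀ hQ₀ hconn ⟨u, hu, w, hw, huw, hadj, ⟨q, hq, hqu⟩, ⟨q', hq', hqw⟩⟩
    by_contra hne
    have hef : ¬(e ∈ Q₀ ∧ f ∈ Q₀) := fun h' => hne (h.pQ.eq_of_conn hQ₀ hconn h'.1 h'.2)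
    rcases h.att hu (hQ₀ hq) hqu with ⟨rfl, h1⟩ | ⟨rfl, h1⟩ <;>
      rcases h.att hw (hQ₀ hq') hqw with ⟨rfl, h2⟩ | ⟨rfl, h2⟩
    · rcases h1 with rfl | ⟨-, rfl⟩ <;> rcases h2 with rfl | ⟨-, rfl⟩
      exacts [huw rfl, hadj h.ac, hadj h.ac.symm, huw rfl]
    · exact hef ⟨hq, hq'⟩
    · exact hef ⟨hq', hq⟩
    · rcases h1 with rfl | ⟨-, rfl⟩ <;> rcases h2 with rfl | ⟨-, rfl⟩
      exacts [huw rfl, hadj h.bd, hadj h.bd.symm, huw rfl]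

/-- The apex `b` sees only `f` in `Q`. A proper connected subset that contains `f` misses `e`, and
without a right triangle nothing but `b` is then attached. -/
theorem Tri.clean (h : Tri G l r a b A c d B e f Q) (hr : ¬r) : Clean G (A ∪ B) Q b := by
  have hb : ∀ q ∈ Q, G.Adj q b → q = f := by
    intro q hq hqb
    rcases h.AQ b h.pA.right_mem q hq hqb.symm with ⟨e, -⟩ | ⟨-, e⟩
    · exact absurd e.symm h.ne
    · exact e
  refine ⟨Or.inl h.pA.right_mem, fun q hq q' hq' h1 h2 => ?_, ?_⟩
  · rw [hb q hq h1.symm, hb q' hq' h2.symm]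
  · rintro Q₀ hQ₀ hne hconn ⟨q, hq, hqb⟩ u hu ⟨q', hq', hqu⟩
    obtain rfl := hb q (hQ₀ hq) hqb
    rcases h.att hu (hQ₀ hq') hqu with ⟨rfl, h1⟩ | ⟨rfl, h1⟩
    · exact absurd (h.pQ.eq_of_conn hQ₀ hconn hq' hq) hne
    · exact h1.resolve_right fun h' => hr h'.1

/-- Here `B` is the single vertex `c`, which sees `a`, `b` and `e` on the cycle `A ∪ Q`. This covers
the systems that `Tri.minSpread` leaves out. -/
theorem Tri.isWheel (h : Tri G l r a b A c d B e f Q) (hl : l) (hcd : c = d) :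
    IsWheel G (A ∪ B ∪ Q) := by
  subst hcd
  have hB := h.pB.eq_singleton
  have hce := (h.BQ c h.pB.left_mem e h.pQ.left_mem).2 (Or.inl ⟨hl, rfl, rfl⟩)
  refine ⟨A ∪ Q, c, isCyc_of_paths h.pA h.pQ h.dAQ h.ne h.ae h.bf h.AQ, ?_, ?_, a,
    Or.inl h.pA.left_mem, b, Or.inl h.pA.right_mem, e, Or.inr h.pQ.left_mem, h.ne,
    h.dAQ.ne_of_mem h.pA.left_mem h.pQ.left_mem, h.dAQ.ne_of_mem h.pA.right_mem h.pQ.left_mem,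
    h.ac.symm, h.bd.symm, hce⟩
  · rintro (h' | h')
    · exact Set.disjoint_left.1 h.dAB h' h.pB.left_mem
    · exact Set.disjoint_left.1 h.dBQ h.pB.left_mem h'
  · rw [hB, Set.union_singleton, Set.insert_union]

theorem IsSolidGraph.exists_minSpread (h : IsSolidGraph (G.induce s)) (hv : v ∈ s) :
    (∃ x y z w, s = {w, x, y, z} ∧ G.Adj w x ∧ G.Adj w y ∧ G.Adj w z ∧ G.Adj x y ∧ G.Adj x z ∧
      G.Adj y z) ∨
    ∃ C Q, s = C ∪ Q ∧ MinSpread G C Q ∧ (v ∈ Q ∨ Clean G C Q v) := by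
  rcases h.exists_form hv with h | ⟨l, r, a, b, A, c, d, B, e, f, Q, rfl, h, hvQ⟩
  · exact h.minSpread hv
  · by_cases hlong : ¬G.Adj a b ∨ l ∧ c ≠ d
    · refine Or.inr ⟨_, _, rfl, h.minSpread hlong, hvQ.imp_right ?_⟩
      rintro ⟨hr, rfl⟩
      exact h.clean hr
    · push Not at hlong
      have hl : l := by
        rcases h.shape with h' | h' | h'
        exacts [absurd hlong.1 h'.2.2, h'.1, h'.1]
      exact (h.isWheel hl (hlong.2 hl)).minSpread hv

/-- Inner vertices of an induced path have two neighbours on it, ends at most one. -/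
theorem IndPath.ends_unique (p : IndPath G a b A) (q : IndPath G x y A) :
    x = a ∧ y = b ∨ x = b ∧ y = a := by
  have key : ∀ {x y}, IndPath G x y A → x = a ∨ x = b := by
    intro x y q
    by_contra hx
    push Not at hx
    obtain ⟨u, hu, w, hw, huw, h1, h2⟩ := p.exists_two_neighbors q.left_mem hx.1 hx.2
    exact huw (q.left_unique hu hw h1 h2)
  by_cases hxy : x = y
  · subst hxy
    have h := q.eq_singleton
    have ha : a = x := by simpa [h] using p.left_mem
    have hb : b = x := by simpa [h] using p.right_mem
    simp [ha, hb]
  · rcases key q with rfl | rfl <;> rcases key q.reverse with rfl | rfl <;> simp at hxy ⊢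

/-- The trihedron, stamp or prism formed by two arcs `A`, `B` of a cycle and a path `Q`. -/
theorem tri_of_arcs (pA : IndPath G u w A) (pB : IndPath G u w B)
    (hAB : ∀ x ∈ A, x ∈ B → x = u ∨ x = w)
    (hadj : ∀ x ∈ A, ∀ y ∈ B, G.Adj x y → x = u ∨ x = w ∨ y = u ∨ y = w)
    (hne : u ≠ w) (huw : ¬G.Adj u w) (pQ : IndPath G q q' Q) (hd : Disjoint (A ∪ B) Q)
    (hQ : ∀ z ∈ A ∪ B, ∀ x ∈ Q, G.Adj z x ↔ x = q ∧ (z = u ∨ z = u') ∨ x = q' ∧ (z = w ∨ z = w'))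
    (hu' : u' = u ∨ u' ∈ B ∧ G.Adj u u') (hw' : w' = w ∨ w' ∈ B ∧ G.Adj w w')
    (h : w' = w ∨ u' ≠ u ∧ q ≠ q' ∧ u' ≠ w') :
    IsSolid G (A ∪ B ∪ Q) := by
  obtain ⟨c, pB₁, huc, hc⟩ := pB.trim_left hne
  have hcw : c ≠ w := by rintro rfl; exact huw huc
  obtain ⟨d, pB₂, hwd, hd'⟩ := pB₁.trim_right hcw
  have hdu : ∀ z ∈ B, G.Adj w z → z = d := by
    intro z hz hwz
    refine hd' z ⟨hz, ?_⟩ hwz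
    rintro rfl; exact huw hwz.symm
  have hcu' : u' ≠ u → u' = c := fun h => hc _ (hu'.resolve_left h).1 (hu'.resolve_left h).2
  have hdw' : w' ≠ w → w' = d := fun h => hdu _ (hw'.resolve_left h).1 (hw'.resolve_left h).2
  have huw' : w' ≠ u := by
    rintro rfl
    rcases hw' with e | e
    · exact hne e
    · exact huw e.2.symm
  have hwu' : u' ≠ w := by
    rintro rfl
    rcases hu' with e | e
    · exact hne e.symm
    · exact huw e.2
  have hset : A ∪ B ∪ Q = A ∪ (B \ {u}) \ {w} ∪ Q := by
    have := pA.left_mem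
    have := pA.right_mem
    ext z
    simp only [Set.mem_union, Set.mem_sdiff, Set.mem_singleton_iff]
    grind
  have hA : ∀ z ∈ A, z ∈ A ∪ B := fun z => Or.inl
  have hB : ∀ z ∈ (B \ {u}) \ {w}, z ∈ A ∪ B := fun z hz => Or.inr hz.1.1
  have huA := pA.left_mem
  have hwA := pA.right_mem
  -- `A` keeps the ends `u`, `w` and `B` loses them. There is a triangle at `u` or `w` exactly if
  -- `Q` attaches to a second vertex there, which is then the end of the trimmed `B`.
  refine Or.inr ⟨u' ≠ u, w' ≠ w, u, w, A, c, d, _, q, q', Q, hset, pA, pB₂, pQ, ?_, ?_, ?_, hne,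
    huc, hwd, (hQ u (hA _ huA) q pQ.left_mem).2 (by simp),
    (hQ w (hA _ hwA) q' pQ.right_mem).2 (by simp), ?_, ?_, ?_, ?_⟩
  · rw [Set.disjoint_left]
    rintro z hz ⟨⟨hz', h1⟩, h2⟩
    exact (hAB z hz hz').elim h1 h2
  · exact hd.mono_left hA
  · exact hd.mono_left hB
  · rintro x hx y ⟨⟨hy, h1⟩, h2⟩ hxy
    rcases hadj x hx y hy hxy with rfl | rfl | rfl | rfl
    · exact Or.inl ⟨rfl, hc y hy hxy⟩
    · exact Or.inr ⟨rfl, hdu y hy hxy⟩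
    · exact absurd rfl h1
    · exact absurd rfl h2
  · intro z hz x hx hzx
    have h1 : z = u' → z = u := by
      rintro rfl
      rcases hu' with e | e
      · exact e
      · exact (hAB z hz e.1).resolve_right hwu'
    have h2 : z = w' → z = w := by
      rintro rfl
      rcases hw' with e | e
      · exact e
      · exact (hAB z hz e.1).resolve_left huw'
    have := (hQ z (hA _ hz) x hx).1 hzx
    grind
  · intro z hz x hx
    rw [hQ z (hB _ hz) x hx]
    obtain ⟨⟨-, h1 : z ≠ u⟩, h2 : z ≠ w⟩ := hz
    constructor <;> grind
  · by_cases hr : w' = w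
    · by_cases hl : u' = u
      · exact Or.inl ⟨by simpa using hl, by simpa using hr, huw⟩
      · exact Or.inr (Or.inl ⟨hl, by simpa using hr⟩)
    · obtain ⟨h1, h2, h3⟩ := h.resolve_left hr
      exact Or.inr (Or.inr ⟨h1, hr, by rw [← hcu' h1, ← hdw' hr]; exact h3, h2⟩)

/-- The prism formed by a cycle and a path `Q` if the two edges of the cycle to which `Q`
attaches separate the cycle into arcs in the other way. -/
theorem tri_of_crossing_arcs (pA : IndPath G u w A) (pB : IndPath G u w B)
    (hAB : ∀ x ∈ A, x ∈ B → x = u ∨ x = w)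
    (hadj : ∀ x ∈ A, ∀ y ∈ B, G.Adj x y → x = u ∨ x = w ∨ y = u ∨ y = w)
    (hne : u ≠ w) (huw : ¬G.Adj u w) (pQ : IndPath G q q' Q) (hd : Disjoint (A ∪ B) Q)
    (hQ : ∀ z ∈ A ∪ B, ∀ x ∈ Q, G.Adj z x ↔ x = q ∧ (z = u ∨ z = u') ∨ x = q' ∧ (z = w ∨ z = w'))
    (hu' : u' ∈ B) (huu' : G.Adj u u') (hw' : w' ∈ A) (hww' : G.Adj w w') (hqq' : q ≠ q') :
    IsSolid G (A ∪ B ∪ Q) := by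
  obtain ⟨c, pB', huc, hc⟩ := pB.trim_left hne
  obtain ⟨d, pA', hwd, hd'⟩ := pA.trim_right hne
  obtain rfl := hc u' hu' huu'
  obtain rfl := hd' w' hw' hww'
  have huw' : w' ≠ u := by rintro rfl; exact huw hww'.symm
  have hwu' : u' ≠ w := by rintro rfl; exact huw huu'
  have huA := pA.left_mem
  have hwB := pB.right_mem
  have hu'A : u' ∉ A := fun h' => (hAB _ h' hu').elim huu'.ne' hwu'
  have hw'B : w' ∉ B := fun h' => (hAB _ hw' h').elim huw' hww'.ne'
  have hset : A ∪ B ∪ Q = A \ {w} ∪ B \ {u} ∪ Q := by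
    ext z
    simp only [Set.mem_union, Set.mem_sdiff, Set.mem_singleton_iff]
    grind
  have hA : ∀ z ∈ A \ {w}, z ∈ A ∪ B := fun z hz => Or.inl hz.1
  have hB : ∀ z ∈ B \ {u}, z ∈ A ∪ B := fun z hz => Or.inr hz.1
  -- Each arc gives up one end, so that the triangles are `u, u', q` and `w', w, q'`.
  refine Or.inr ⟨True, True, u, w', _, u', w, _, q, q', Q, hset, pA', pB', pQ, ?_, ?_, ?_, huw'.symm,
    huu', hww'.symm, (hQ u (Or.inl huA) q pQ.left_mem).2 (by simp),
    (hQ w' (Or.inl hw') q' pQ.right_mem).2 (by simp), ?_, ?_, ?_, ?_⟩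
  · rw [Set.disjoint_left]
    rintro z ⟨hz, h1⟩ ⟨hz', h2⟩
    exact (hAB z hz hz').elim h2 h1
  · exact hd.mono_left hA
  · exact hd.mono_left hB
  · rintro x ⟨hx, h1⟩ y ⟨hy, h2⟩ hxy
    rcases hadj x hx y hy hxy with rfl | rfl | rfl | rfl
    · exact Or.inl ⟨rfl, hc y hy hxy⟩
    · exact absurd rfl h1
    · exact absurd rfl h2
    · exact Or.inr ⟨hd' x hx hxy.symm, rfl⟩
  · intro z hz x hx hzx
    have := (hQ z (hA _ hz) x hx).1 hzx
    obtain ⟨hz, h1 : z ≠ w⟩ := hz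
    have : z ≠ u' := by rintro rfl; exact hu'A hz
    grind
  · intro z hz x hx
    rw [hQ z (hB _ hz) x hx]
    obtain ⟨hz, h1 : z ≠ u⟩ := hz
    have : z ≠ w' := by rintro rfl; exact hw'B hz
    grind
  · exact Or.inr (Or.inr ⟨trivial, trivial, hwu', hqq'⟩)

/-- The vertices `u`, `w` cut `C` into two arcs. If `u'` and `w'` lie inside the same arc, that arc
is the one trimmed; if they lie inside different arcs, the arcs are cut crosswise. Arcs are swapped,
and paths reversed when only `w` has a second vertex, because a stamp has its triangle on the left.
-/
theorem isSolid_of_attachments (hC : IsCyc G C) (pQ : IndPath G q q' Q) (hd : Disjoint C Q)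
    (hu : u ∈ C) (hw : w ∈ C) (hne : u ≠ w) (huw : ¬G.Adj u w)
    (hQ : ∀ z ∈ C, ∀ x ∈ Q, G.Adj z x ↔ x = q ∧ (z = u ∨ z = u') ∨ x = q' ∧ (z = w ∨ z = w'))
    (hu' : u' = u ∨ u' ∈ C ∧ G.Adj u u') (hw' : w' = w ∨ w' ∈ C ∧ G.Adj w w')
    (h : u' ≠ u → w' ≠ w → q ≠ q' ∧ u' ≠ w') : IsSolid G (C ∪ Q) := by
  obtain ⟨A, B, pA, pB, rfl, hAB, hadj⟩ := hC.arcs hu hw hne huw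
  have hAB' : ∀ x ∈ B, x ∈ A → x = u ∨ x = w := fun x h1 h2 => hAB x h2 h1
  have hadj' : ∀ x ∈ B, ∀ y ∈ A, G.Adj x y → x = u ∨ x = w ∨ y = u ∨ y = w := by
    intro x hx y hy hxy
    have := hadj y hy x hx hxy.symm
    tauto
  have hd₂ : Disjoint (B ∪ A) Q := by rwa [Set.union_comm]
  have hQ₂ := hQ
  rw [Set.union_comm] at hQ₂
  have hQ' : ∀ z ∈ A ∪ B, ∀ x ∈ Q,
      G.Adj z x ↔ x = q' ∧ (z = w ∨ z = w') ∨ x = q ∧ (z = u ∨ z = u') := by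
    intro z hz x hx
    rw [hQ z hz x hx, or_comm]
  have hQ₂' := hQ'
  rw [Set.union_comm] at hQ₂'
  have hcomm : B ∪ A ∪ Q = A ∪ B ∪ Q := by rw [Set.union_comm B A]
  have sw : ∀ {A B : Set V}, (∀ x ∈ A, x ∈ B → x = u ∨ x = w) →
    ∀ x ∈ A, x ∈ B → x = w ∨ x = u := fun h x h1 h2 => (h x h1 h2).symm
  have sw' : ∀ {A B : Set V}, (∀ x ∈ A, ∀ y ∈ B, G.Adj x y → x = u ∨ x = w ∨ y = u ∨ y = w) →
      ∀ x ∈ A, ∀ y ∈ B, G.Adj x y → x = w ∨ x = u ∨ y = w ∨ y = u := by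
    intro A B h x h1 y h2 h3
    have := h x h1 y h2 h3
    tauto
  have huw2 : ¬G.Adj w u := fun h => huw h.symm
  by_cases hw1 : w' = w
  · rcases hu' with e | ⟨h1 | h1, h2⟩
    · exact tri_of_arcs pA pB hAB hadj hne huw pQ hd hQ (Or.inl e) (Or.inl hw1) (Or.inl hw1)
    · rw [← hcomm]
      exact tri_of_arcs pB pA hAB' hadj' hne huw pQ hd₂ hQ₂ (Or.inr ⟨h1, h2⟩) (Or.inl hw1)
        (Or.inl hw1)
    · exact tri_of_arcs pA pB hAB hadj hne huw pQ hd hQ (Or.inr ⟨h1, h2⟩) (Or.inl hw1)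
        (Or.inl hw1)
  obtain ⟨hwm, hww'⟩ := hw'.resolve_left hw1
  by_cases hu1 : u' = u
  · rcases hwm with h1 | h1
    · rw [← hcomm]
      exact tri_of_arcs pB.reverse pA.reverse (sw hAB') (sw' hadj') hne.symm huw2
        pQ.reverse hd₂ hQ₂' (Or.inr ⟨h1, hww'⟩) (Or.inl hu1) (Or.inl hu1)
    · exact tri_of_arcs pA.reverse pB.reverse (sw hAB) (sw' hadj) hne.symm huw2
        pQ.reverse hd hQ' (Or.inr ⟨h1, hww'⟩) (Or.inl hu1) (Or.inl hu1)
  obtain ⟨hum, huu'⟩ := hu'.resolve_left hu1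
  obtain ⟨hqq, huw'⟩ := h hu1 hw1
  rcases hwm with h1 | h1 <;> rcases hum with h2 | h2
  · rw [← hcomm]
    exact tri_of_arcs pB pA hAB' hadj' hne huw pQ hd₂ hQ₂ (Or.inr ⟨h2, huu'⟩)
      (Or.inr ⟨h1, hww'⟩) (Or.inr ⟨hu1, hqq, huw'⟩)
  · exact tri_of_crossing_arcs pA pB hAB hadj hne huw pQ hd hQ h2 huu' h1 hww' hqq
  · rw [← hcomm]
    exact tri_of_crossing_arcs pB pA hAB' hadj' hne huw pQ hd₂ hQ₂ h2 huu' h1 hww' hqq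
  · exact tri_of_arcs pA pB hAB hadj hne huw pQ hd hQ (Or.inr ⟨h2, huu'⟩)
      (Or.inr ⟨h1, hww'⟩) (Or.inr ⟨hu1, hqq, huw'⟩)

/-- By minimality, `Q` is an induced path between the neighbours of any two nonadjacent attached
vertices, so these neighbours are the two ends of `Q`. A single vertex with three neighbours on `C`
gives a pyramid. So does an attached common neighbour `c` of `u` and `w` if nothing but `u`, `c`,
`w` is attached: the rim is `C - c` together with `Q`. Otherwise only the ends of `Q` attach, each
to one vertex or one edge of `C`. -/
theorem MinSpread.isSolid (h : MinSpread G C Q) : IsSolid G (C ∪ Q) := by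
  obtain ⟨u, hu, w, hw, hne, huw, ⟨q, hq, hqu⟩, ⟨q', hq', hqw⟩⟩ := h.spread
  have hpath : ∀ {u w q q'}, u ∈ C → w ∈ C → u ≠ w → ¬G.Adj u w → q ∈ Q → q' ∈ Q → G.Adj q u →
      G.Adj q' w → IndPath G q q' Q := by
    intro u w q q' hu hw hne huw hq hq' hqu hqw
    obtain ⟨S, hS, p⟩ := h.conn.exists_indPath hq hq'
    rwa [h.min S hS p.conn ⟨u, hu, w, hw, hne, huw, ⟨q, p.left_mem, hqu⟩,
      ⟨q', p.right_mem, hqw⟩⟩] at p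
  have pQ := hpath hu hw hne huw hq hq' hqu hqw
  -- Attached vertices that are neither equal nor adjacent are seen from opposite ends of `Q`.
  have key : ∀ z ∈ C, ∀ z' ∈ C, ∀ x ∈ Q, ∀ y ∈ Q, G.Adj x z → G.Adj y z' →
      (z = z' ∨ G.Adj z z') ∨ x = q ∧ y = q' ∨ x = q' ∧ y = q := by
    intro z hz z' hz' x hx y hy hxz hyz
    by_cases h' : z = z' ∨ G.Adj z z'
    · exact Or.inl h'
    · push Not at h'
      exact Or.inr (pQ.ends_unique (hpath hz hz' h'.1 h'.2 hx hy hxz hyz))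
  have F1 : ∀ z ∈ C, ∀ x ∈ Q, G.Adj x z → x ≠ q → z = w ∨ G.Adj z w := by
    intro z hz x hx hxz hxq
    rcases key z hz w hw x hx q' hq' hxz hqw with h' | h' | h'
    · exact h'
    · exact absurd h'.1 hxq
    · exact absurd (h'.1.trans h'.2) hxq
  have F2 : ∀ z ∈ C, ∀ x ∈ Q, G.Adj x z → x ≠ q' → z = u ∨ G.Adj z u := by
    intro z hz x hx hxz hxq
    rcases key z hz u hu x hx q hq hxz hqu with h' | h' | h'
    · exact h'
    · exact absurd (h'.1.trans h'.2) hxq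
    · exact absurd h'.1 hxq
  by_cases hqq : q = q'
  · subst hqq
    have hQ := pQ.eq_singleton
    by_cases h3 : ∃ z ∈ C, z ≠ u ∧ z ≠ w ∧ G.Adj q z
    · obtain ⟨z, hz, hzu, hzw, hqz⟩ := h3
      refine Or.inl ⟨C, q, h.cyc, fun h' => Set.disjoint_left.1 h.disj h' hq, ?_, u, hu, w, hw, z, hz,
        hne, hzu.symm, hzw.symm, hqu, hqw, hqz⟩
      rw [hQ, Set.union_singleton]
    · refine isSolid_of_attachments (u' := u) (w' := w) h.cyc pQ h.disj hu hw hne huw ?_ (Or.inl rfl)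
        (Or.inl rfl) (fun h => absurd rfl h)
      intro z hz x hx
      obtain rfl : x = q := by simpa [hQ] using hx
      have hux := hqu.symm
      have hwx := hqw.symm
      constructor
      · intro hzx
        by_contra hcon
        exact h3 ⟨z, hz, by tauto, by tauto, hzx.symm⟩
      · rintro (⟨-, rfl | rfl⟩ | ⟨-, rfl | rfl⟩) <;> assumption
  by_cases hW : ∃ c ∈ C, G.Adj c u ∧ G.Adj c w ∧ Att G Q c ∧
      ∀ z ∈ C, Att G Q z → z = u ∨ z = c ∨ z = w
  · obtain ⟨c, hc, hcu, hcw, ⟨x, hx, hxc⟩, hall⟩ := hW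
    obtain ⟨e, f, hce⟩ := h.cyc.cycAt hc
    have p : IndPath G u w (C \ {c}) := by
      have h1 := hce.adj u ⟨hu, hcu.ne'⟩ hcu
      have h2 := hce.adj w ⟨hw, hcw.ne'⟩ hcw
      rcases h1 with rfl | rfl <;> rcases h2 with rfl | rfl
      exacts [absurd rfl hne, hce.path, hce.path.reverse, absurd rfl hne]
    have hcQ : c ∉ Q := Set.disjoint_left.1 h.disj hc
    refine Or.inl ⟨C \ {c} ∪ Q, c, isCyc_of_paths p pQ (h.disj.mono_left Set.sdiff_subset) hne
      hqu.symm hqw.symm ?_, ?_, ?_, u, Or.inl p.left_mem, w, Or.inl p.right_mem, x, Or.inr hx, hne,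
      h.disj.ne_of_mem hu hx, h.disj.ne_of_mem hw hx, hcu, hcw, hxc.symm⟩
    · rintro z ⟨hz, hzc⟩ y hy hzy
      rcases hall z hz ⟨y, hy, hzy.symm⟩ with rfl | rfl | rfl
      · refine Or.inl ⟨rfl, ?_⟩
        by_contra hyq
        exact (F1 z hz y hy hzy.symm hyq).elim hne huw
      · exact absurd rfl hzc
      · refine Or.inr ⟨rfl, ?_⟩
        by_contra hyq
        exact (F2 z hz y hy hzy.symm hyq).elim hne.symm fun h => huw h.symm
    · rintro (h' | h')
      exacts [h'.2 rfl, hcQ h']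
    · rw [← Set.insert_union, Set.insert_sdiff_self_of_mem hc]
  -- a common neighbour of `u` and `w` that also sees a vertex next to `c` cannot exist
  have hW' : ∀ c ∈ C, ∀ x ∈ Q, G.Adj x c → G.Adj c u → G.Adj c w →
      (∀ z ∈ C, ∀ y ∈ Q, G.Adj y z → z = c ∨ G.Adj c z) → False := by
    intro c hc x hx hxc hcu hcw hall
    refine hW ⟨c, hc, hcu, hcw, ⟨x, hx, hxc⟩, ?_⟩
    rintro z hz ⟨y, hy, hyz⟩
    by_contra hcon
    push Not at hcon
    have hcz := (hall z hz y hy hyz).resolve_left hcon.2.1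
    exact h.cyc.no_three_neighbors hc hu hw hz hne hcon.1.symm hcon.2.2.symm hcu hcw hcz
  -- A vertex of `C` seen from the interior of `Q`, or in `hboth` from both ends, is adjacent to `u`
  -- and `w` by `F1` and `F2`, and by `key` every other attached vertex is adjacent to it. This is
  -- what `hW'` excludes.
  have hends : ∀ z ∈ C, ∀ x ∈ Q, G.Adj x z → x = q ∨ x = q' := by
    intro z hz x hx hxz
    by_contra hcon
    push Not at hcon
    have h1 := F1 z hz x hx hxz hcon.1
    have h2 := F2 z hz x hx hxz hcon.2
    have hzu : G.Adj z u := h2.resolve_left (by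
      rintro rfl; exact h1.elim hne huw)
    have hzw : G.Adj z w := h1.resolve_left (by
      rintro rfl; exact huw hzu.symm)
    refine hW' z hz x hx hxz hzu hzw fun z' hz' y hy hyz' => ?_
    rcases key z hz z' hz' x hx y hy hxz hyz' with h' | h' | h'
    · exact h'.imp_left Eq.symm
    · exact absurd h'.1 hcon.1
    · exact absurd h'.1 hcon.2
  have hboth : ∀ z ∈ C, G.Adj q z → G.Adj q' z → False := by
    intro z hz h1 h2
    have h3 := F1 z hz q' hq' h2 (Ne.symm hqq)
    have h4 := F2 z hz q hq h1 hqq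
    have hzu : G.Adj z u := h4.resolve_left (by
      rintro rfl; exact h3.elim hne huw)
    have hzw : G.Adj z w := h3.resolve_left (by
      rintro rfl; exact huw hzu.symm)
    refine hW' z hz q hq h1 hzu hzw fun z' hz' y hy hyz' => ?_
    rcases hends z' hz' y hy hyz' with rfl | rfl
    · rcases key z hz z' hz' y hq y hq h1 hyz' with h' | h' | h'
      · exact h'.imp_left Eq.symm
      · exact absurd h'.2 hqq
      · exact absurd h'.1 hqq
    · rcases key z hz z' hz' y hq' y hq' h2 hyz' with h' | h' | h'
      · exact h'.imp_left Eq.symm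
      · exact absurd h'.1.symm hqq
      · exact absurd h'.2.symm hqq
  -- `C` is not a triangle, so two distinct neighbours of `x` on it are nonadjacent. Hence each end
  -- of `Q` has at most one neighbour on `C` besides `u` or `w`.
  have htri : ∀ x ∈ C, ∀ y ∈ C, ∀ z ∈ C, ∀ t ∈ C, G.Adj x y → G.Adj x z → y ≠ z →
      (y = z ∨ G.Adj y z) → t ≠ x → ¬G.Adj x t → False := by
    intro x hx y hy z hz t ht hxy hxz hyz hyz' htx hxt
    rw [h.cyc.eq_triangle hx hy hz hxy hxz (hyz'.resolve_left hyz)] at ht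
    rcases ht with rfl | rfl | rfl
    exacts [htx rfl, hxt hxy, hxt hxz]
  obtain ⟨u', hu', hqu'⟩ : ∃ u', (u' = u ∨ u' ∈ C ∧ G.Adj u u') ∧
      ∀ z ∈ C, G.Adj q z ↔ z = u ∨ z = u' := by
    by_cases h' : ∃ u' ∈ C, u' ≠ u ∧ G.Adj q u'
    · obtain ⟨u', hu', hne', hqu'⟩ := h'
      have huu' := ((F2 u' hu' q hq hqu' hqq).resolve_left hne').symm
      refine ⟨u', Or.inr ⟨hu', huu'⟩, fun z hz => ⟨fun hqz => ?_, ?_⟩⟩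
      · by_contra hcon
        push Not at hcon
        have huz := ((F2 z hz q hq hqz hqq).resolve_left hcon.1).symm
        refine htri u hu u' hu' z hz w hw huu' huz hcon.2.symm ?_ hne.symm huw
        rcases key u' hu' z hz q hq q hq hqu' hqz with h' | h' | h'
        exacts [h', absurd h'.2 hqq, absurd h'.1 hqq]
      · rintro (rfl | rfl) <;> assumption
    · refine ⟨u, Or.inl rfl, fun z hz => ⟨fun hqz => ?_, ?_⟩⟩
      · by_contra hcon
        exact h' ⟨z, hz, by tauto, hqz⟩
      · rintro (rfl | rfl) <;> assumption
  obtain ⟨w', hw', hqw'⟩ : ∃ w', (w' = w ∨ w' ∈ C ∧ G.Adj w w') ∧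
      ∀ z ∈ C, G.Adj q' z ↔ z = w ∨ z = w' := by
    by_cases h' : ∃ w' ∈ C, w' ≠ w ∧ G.Adj q' w'
    · obtain ⟨w', hw', hne', hqw'⟩ := h'
      have hww' := ((F1 w' hw' q' hq' hqw' (Ne.symm hqq)).resolve_left hne').symm
      refine ⟨w', Or.inr ⟨hw', hww'⟩, fun z hz => ⟨fun hqz => ?_, ?_⟩⟩
      · by_contra hcon
        push Not at hcon
        have hwz := ((F1 z hz q' hq' hqz (Ne.symm hqq)).resolve_left hcon.1).symm
        refine htri w hw w' hw' z hz u hu hww' hwz hcon.2.symm ?_ hne (fun h => huw h.symm)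
        rcases key w' hw' z hz q' hq' q' hq' hqw' hqz with h' | h' | h'
        exacts [h', absurd h'.1.symm hqq, absurd h'.2.symm hqq]
      · rintro (rfl | rfl) <;> assumption
    · refine ⟨w, Or.inl rfl, fun z hz => ⟨fun hqz => ?_, ?_⟩⟩
      · by_contra hcon
        exact h' ⟨z, hz, by tauto, hqz⟩
      · rintro (rfl | rfl) <;> assumption
  refine isSolid_of_attachments (u' := u') (w' := w') h.cyc pQ h.disj hu hw hne huw ?_ hu' hw' ?_
  · intro z hz x hx
    constructor
    · intro hzx
      rcases hends z hz x hx hzx.symm with rfl | rfl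
      · exact Or.inl ⟨rfl, (hqu' z hz).1 hzx.symm⟩
      · exact Or.inr ⟨rfl, (hqw' z hz).1 hzx.symm⟩
    · rintro (⟨rfl, h'⟩ | ⟨rfl, h'⟩)
      · exact ((hqu' z hz).2 h').symm
      · exact ((hqw' z hz).2 h').symm
  · intro h1 h2
    refine ⟨hqq, ?_⟩
    rintro rfl
    have huC := (hu'.resolve_left h1).1
    exact hboth u' huC ((hqu' u' huC).2 (Or.inr rfl)) ((hqw' u' huC).2 (Or.inr rfl))

end Spread

end GraphChar

/-! ### Lifting a solid when a vertex is split into an edge. -/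

namespace GraphChar

/-- The neighbourhood of `v` is the union of those of the adjacent vertices `x` and `y`, so that
`v` arises from contracting `xy`. -/
structure Merges {V : Type*} (G : SimpleGraph V) (v x y : V) : Prop where
  xy : G.Adj x y
  vx : v ≠ x
  vy : v ≠ y
  adj : ∀ b, b ≠ x → b ≠ y → (G.Adj v b ↔ G.Adj x b ∨ G.Adj y b)

section Merges

variable {V : Type*} {G : SimpleGraph V} {a b c u v w x y : V} {C P Q S T : Set V}

theorem Merges.symm (h : Merges G v x y) : Merges G v y x :=
  ⟨h.xy.symm, h.vy, h.vx, fun b h1 h2 => (h.adj b h2 h1).trans or_comm⟩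

open Classical in
/-- The map that merges `x` and `y` to `v`. -/
noncomputable def mergeMap (v x y u : V) : V := if u = x ∨ u = y then v else u

theorem mergeMap_left : mergeMap v x y x = v := if_pos (Or.inl rfl)

theorem mergeMap_right : mergeMap v x y y = v := if_pos (Or.inr rfl)

theorem mergeMap_of_ne (hx : u ≠ x) (hy : u ≠ y) : mergeMap v x y u = u := if_neg (by tauto)

theorem Merges.map_adj (h : Merges G v x y) (hab : G.Adj a b) :
    mergeMap v x y a = mergeMap v x y b ∨ G.Adj (mergeMap v x y a) (mergeMap v x y b) := by
  by_cases ha' : a = x ∨ a = y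
  · by_cases hb' : b = x ∨ b = y
    · left; simp [mergeMap, ha', hb']
    · right
      push Not at hb'
      rw [mergeMap_of_ne hb'.1 hb'.2, mergeMap, if_pos ha', h.adj b hb'.1 hb'.2]
      rcases ha' with rfl | rfl
      exacts [Or.inl hab, Or.inr hab]
  · push Not at ha'
    rw [mergeMap_of_ne ha'.1 ha'.2]
    by_cases hb' : b = x ∨ b = y
    · right
      rw [mergeMap, if_pos hb', G.adj_comm, h.adj a ha'.1 ha'.2]
      rcases hb' with rfl | rfl
      exacts [Or.inl hab.symm, Or.inr hab.symm]
    · push Not at hb'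
      rw [mergeMap_of_ne hb'.1 hb'.2]
      exact Or.inr hab

theorem IsSolid.replace (h : IsSolid G S) (hv : v ∈ S) (hx : x ∉ S)
    (hfull : ∀ b ∈ S, b ≠ v → (G.Adj v b ↔ G.Adj x b)) : IsSolid G (insert x (S \ {v})) := by
  classical
  have hg : ∀ u ∈ S, Function.update id v x u = v → False := by
    intro u hu e
    by_cases huv : u = v
    · subst huv
      rw [Function.update_self] at e
      exact hx (e ▸ hv)
    · rw [Function.update_of_ne huv] at e
      exact huv e
  have himg : Function.update id v x '' S = insert x (S \ {v}) := by
    ext u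
    constructor
    · rintro ⟨w, hw, rfl⟩
      by_cases hwv : w = v
      · subst hwv; simp
      · simp [hw, hwv]
    · rintro (rfl | ⟨hu, huv : u ≠ v⟩)
      · exact ⟨v, hv, by simp⟩
      · exact ⟨u, hu, by simp [Function.update_of_ne huv]⟩
  rw [← himg]
  refine h.relabel ?_ ?_
  · intro u hu w hw e
    by_cases huv : u = v <;> by_cases hwv : w = v
    · rw [huv, hwv]
    · subst huv
      rw [Function.update_self, Function.update_of_ne hwv] at e
      exact absurd (e ▸ hw) hx
    · subst hwv
      rw [Function.update_self, Function.update_of_ne huv] at e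
      exact absurd (e ▸ hu) hx
    · rwa [Function.update_of_ne huv, Function.update_of_ne hwv] at e
  · intro u hu w hw
    by_cases huv : u = v <;> by_cases hwv : w = v
    · simp [huv, hwv]
    · subst huv
      rw [Function.update_self, Function.update_of_ne hwv]
      exact hfull w hw hwv
    · subst hwv
      rw [Function.update_self, Function.update_of_ne huv, G.adj_comm, hfull u hu huv, G.adj_comm]
      rfl
    · rw [Function.update_of_ne huv, Function.update_of_ne hwv]; rfl

theorem Merges.solid_of_full (h : Merges G v x y) (hS : IsSolid G S) (hv : v ∈ S) (hx : x ∉ S)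
    (hy : y ∉ S) (hfull : ∀ b ∈ S, G.Adj v b → G.Adj x b) : IsSolid G (insert x (S \ {v})) := by
  refine hS.replace hv hx fun b hb _ => ⟨hfull b hb, fun h' => ?_⟩
  have h1 : b ≠ x := by rintro rfl; exact hx hb
  have h2 : b ≠ y := by rintro rfl; exact hy hb
  exact (h.adj b h1 h2).2 (Or.inl h')

/-- Since `x` misses `p` and `y` misses `q`, the vertices `x, q, p, y` form an induced 4-cycle. The
vertex `r` sees `p`, `q` and one of `x`, `y`: a pyramid. -/
theorem Merges.solid_of_clique (h : Merges G v x y) {p q r : V} (hp : G.Adj v p) (hq : G.Adj v q)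
    (hr : G.Adj v r) (hpq : G.Adj p q) (hpr : G.Adj p r) (hqr : G.Adj q r) (hpx : p ≠ x)
    (hpy : p ≠ y) (hqx : q ≠ x) (hqy : q ≠ y) (hrx : r ≠ x) (hry : r ≠ y) (hxp : ¬G.Adj x p)
    (hyq : ¬G.Adj y q) : IsSolid G {x, y, p, q, r} := by
  have hyp : G.Adj y p := ((h.adj p hpx hpy).1 hp).resolve_left hxp
  have hxq : G.Adj x q := ((h.adj q hqx hqy).1 hq).resolve_right hyq
  have pair : ∀ {s t : V}, G.Adj s t → IndPath G s t {s, t} := fun hst =>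
    .cons hst (by simpa using hst.ne) (by simp) (.single _)
  have hC : IsCyc G ({q, p} ∪ {x, y}) := by
    refine isCyc_of_paths (pair hpq.symm) (pair h.xy) ?_ hpq.ne' hxq.symm hyp.symm ?_
    · simp [hpx.symm, hpy.symm, hqx.symm, hqy.symm]
    · have h1 : ¬G.Adj q y := fun h => hyq h.symm
      have h2 : ¬G.Adj p x := fun h => hxp h.symm
      rintro u (rfl | rfl) w (rfl | rfl) huw <;> simp_all
  refine Or.inl ⟨_, r, hC, ?_, ?_, ?_⟩
  · simp [hpr.ne', hqr.ne', hrx, hry]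
  · ext u; simp only [Set.mem_insert_iff, Set.mem_union, Set.mem_singleton_iff]; tauto
  · rcases (h.adj r hrx hry).1 hr with h' | h'
    · exact ⟨p, by simp, q, by simp, x, by simp, hpq.ne, hpx, hqx, hpr.symm, hqr.symm, h'.symm⟩
    · exact ⟨p, by simp, q, by simp, y, by simp, hpq.ne, hpy, hqy, hpr.symm, hqr.symm, h'.symm⟩

theorem IsSolid.of_replaced {Q' : Set V} (h : IsSolid G (C ∪ Q')) (hvC : v ∉ C)
    (hQ' : ∀ u, u ∈ Q' ↔ u ∈ Q ∧ u ≠ v ∨ u = x ∧ x ∈ Q' ∨ u = y ∧ y ∈ Q') (hxy : x ∈ Q' ∨ y ∈ Q') :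
    IsSolid G (insert x ((C ∪ Q) \ {v})) ∨ IsSolid G (insert y ((C ∪ Q) \ {v})) ∨
      IsSolid G (insert x (insert y ((C ∪ Q) \ {v}))) := by
  have hCv : ∀ u ∈ C, u ≠ v := fun u hu e => hvC (e ▸ hu)
  have fin : ∀ {T : Set V}, (∀ u, u ∈ C ∪ Q' ↔ u ∈ T) → IsSolid G T := fun e => Set.ext e ▸ h
  by_cases h1 : x ∈ Q' <;> by_cases h2 : y ∈ Q'
  · refine Or.inr (Or.inr (fin fun u => ?_))
    have := hCv u
    simp only [Set.mem_union, Set.mem_insert_iff, Set.mem_sdiff, Set.mem_singleton_iff, hQ' u, h1, h2]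
    tauto
  · refine Or.inl (fin fun u => ?_)
    have := hCv u
    simp only [Set.mem_union, Set.mem_insert_iff, Set.mem_sdiff, Set.mem_singleton_iff, hQ' u, h1, h2]
    tauto
  · refine Or.inr (Or.inl (fin fun u => ?_))
    have := hCv u
    simp only [Set.mem_union, Set.mem_insert_iff, Set.mem_sdiff, Set.mem_singleton_iff, hQ' u, h1, h2]
    tauto
  · exact (hxy.elim h1 h2).elim

/-- Replacing `v` by `x` and `y` leaves `Q` connected and spreading. For a minimal spreading subset,
merging `x` and `y` again gives a connected spreading subset of `Q`, hence `Q` itself; so at most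
one of `x`, `y` was dropped, and nothing else. -/
theorem Merges.solid_of_mem_path [Finite V] (h : Merges G v x y) (hm : MinSpread G C Q)
    (hv : v ∈ Q) (hx : x ∉ C ∪ Q) (hy : y ∉ C ∪ Q) :
    IsSolid G (insert x ((C ∪ Q) \ {v})) ∨ IsSolid G (insert y ((C ∪ Q) \ {v})) ∨
      IsSolid G (insert x (insert y ((C ∪ Q) \ {v}))) := by
  have hxC : x ∉ C := fun h => hx (Or.inl h)
  have hyC : y ∉ C := fun h => hy (Or.inl h)
  have hxQ : x ∉ Q := fun h => hx (Or.inr h)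
  have hyQ : y ∉ Q := fun h => hy (Or.inr h)
  have hvC : v ∉ C := fun h' => Set.disjoint_left.1 hm.disj h' hv
  have hCne : ∀ u ∈ C, u ≠ v ∧ u ≠ x ∧ u ≠ y := fun u hu =>
    ⟨fun e => hvC (e ▸ hu), fun e => hxC (e ▸ hu), fun e => hyC (e ▸ hu)⟩
  have hQne : ∀ u ∈ Q, u ≠ x ∧ u ≠ y := fun u hu =>
    ⟨fun e => hxQ (e ▸ hu), fun e => hyQ (e ▸ hu)⟩
  set Q' : Set V := insert x (insert y (Q \ {v})) with hQ'
  have hxQ' : x ∈ Q' := Or.inl rfl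
  have hyQ' : y ∈ Q' := Or.inr (Or.inl rfl)
  have hmem : ∀ u ∈ Q, u ≠ v → u ∈ Q' := fun u hu huv => Or.inr (Or.inr ⟨hu, huv⟩)
  have hnv : ∀ u ∈ Q', u ≠ v := by
    rintro u (rfl | rfl | hu)
    exacts [h.vx.symm, h.vy.symm, hu.2]
  have hmaps : Set.MapsTo (mergeMap v x y) Q' Q := by
    rintro u (rfl | rfl | hu)
    · rwa [mergeMap_left]
    · rwa [mergeMap_right]
    · rw [mergeMap_of_ne (hQne u hu.1).1 (hQne u hu.1).2]; exact hu.1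
  have hlift : ∀ w, w ≠ x → w ≠ y → G.Adj v w →
      ∃ u' ∈ Q', mergeMap v x y u' = v ∧ G.Adj u' w := by
    intro w h1 h2 hvw
    rcases (h.adj w h1 h2).1 hvw with h' | h'
    · exact ⟨x, hxQ', mergeMap_left, h'⟩
    · exact ⟨y, hyQ', mergeMap_right, h'⟩
  have hconn : Conn G Q' := by
    refine hm.conn.lift hmaps ?_ ?_
    · intro u hu w hw huw
      have hu' := hQne u hu
      have hw' := hQne w hw
      by_cases huv : u = v
      · subst huv
        obtain ⟨u', h1, h2, h3⟩ := hlift w hw'.1 hw'.2 huw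
        exact ⟨u', h1, w, hmem w hw huw.ne', h2, mergeMap_of_ne hw'.1 hw'.2, h3⟩
      by_cases hwv : w = v
      · subst hwv
        obtain ⟨u', h1, h2, h3⟩ := hlift u hu'.1 hu'.2 huw.symm
        exact ⟨u, hmem u hu huv, u', h1, mergeMap_of_ne hu'.1 hu'.2, h2, h3.symm⟩
      · exact ⟨u, hmem u hu huv, w, hmem w hw hwv, mergeMap_of_ne hu'.1 hu'.2,
          mergeMap_of_ne hw'.1 hw'.2, huw⟩
    · have hr := Reach.of_adj hxQ' hyQ' h.xy
      have hval : ∀ u ∈ Q', u = x ∨ u = y ∨ u ≠ x ∧ u ≠ y := fun u _ => by tauto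
      intro u hu w hw e
      rcases hval u hu with rfl | rfl | hu' <;> rcases hval w hw with rfl | rfl | hw'
      · exact .refl
      · exact hr
      · rw [mergeMap_left, mergeMap_of_ne hw'.1 hw'.2] at e
        exact absurd e.symm (hnv w hw)
      · exact hr.symm
      · exact .refl
      · rw [mergeMap_right, mergeMap_of_ne hw'.1 hw'.2] at e
        exact absurd e.symm (hnv w hw)
      · rw [mergeMap_left, mergeMap_of_ne hu'.1 hu'.2] at e
        exact absurd e (hnv u hu)
      · rw [mergeMap_right, mergeMap_of_ne hu'.1 hu'.2] at e
        exact absurd e (hnv u hu)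
      · rw [mergeMap_of_ne hu'.1 hu'.2, mergeMap_of_ne hw'.1 hw'.2] at e
        rw [e]; exact .refl
  have hatt : ∀ u ∈ C, Att G Q u → Att G Q' u := by
    rintro u hu ⟨q, hq, hqu⟩
    by_cases hqv : q = v
    · subst hqv
      obtain ⟨u', h1, -, h3⟩ := hlift u (hCne u hu).2.1 (hCne u hu).2.2 hqu
      exact ⟨u', h1, h3⟩
    · exact ⟨q, hmem q hq hqv, hqu⟩
  have hspread : Spread G C Q' := by
    obtain ⟨u, hu, w, hw, hne, hadj, h1, h2⟩ := hm.spread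
    exact ⟨u, hu, w, hw, hne, hadj, hatt u hu h1, hatt w hw h2⟩
  have hdisj : Disjoint C Q' := by
    rw [Set.disjoint_left]
    rintro u hu (e | e | hu')
    exacts [(hCne u hu).2.1 e, (hCne u hu).2.2 e, Set.disjoint_left.1 hm.disj hu hu'.1]
  obtain ⟨Q'', hsub, hm'⟩ := hspread.exists_min hm.cyc hdisj hconn
  have himg : mergeMap v x y '' Q'' = Q := by
    refine hm.min _ ?_ ?_ ?_
    · rintro _ ⟨u, hu, rfl⟩
      exact hmaps (hsub hu)
    · exact hm'.conn.image fun _ _ _ _ huw => h.map_adj huw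
    · have hatt' : ∀ u ∈ C, Att G Q'' u → Att G (mergeMap v x y '' Q'') u := by
        rintro u hu ⟨q, hq, hqu⟩
        refine ⟨_, ⟨q, hq, rfl⟩, ?_⟩
        have h' := h.map_adj hqu
        have hmu : mergeMap v x y u = u := mergeMap_of_ne (hCne u hu).2.1 (hCne u hu).2.2
        rw [hmu] at h'
        refine h'.resolve_left fun e => ?_
        exact Set.disjoint_left.1 hm.disj hu (e ▸ hmaps (hsub hq))
      obtain ⟨u, hu, w, hw, hne, hadj, h1, h2⟩ := hm'.spread
      exact ⟨u, hu, w, hw, hne, hadj, hatt' u hu h1, hatt' w hw h2⟩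
  have hsup : ∀ u ∈ Q, u ≠ v → u ∈ Q'' := by
    intro u hu huv
    rw [← himg] at hu
    obtain ⟨w, hw, rfl⟩ := hu
    by_cases hw' : w = x ∨ w = y
    · exact absurd (if_pos hw') huv
    · rwa [mergeMap, if_neg hw']
  have hxy : x ∈ Q'' ∨ y ∈ Q'' := by
    have hv' := hv
    rw [← himg] at hv'
    obtain ⟨w, hw, e⟩ := hv'
    by_contra hcon
    push Not at hcon
    have hw' : ¬(w = x ∨ w = y) := by
      rintro (rfl | rfl)
      exacts [hcon.1 hw, hcon.2 hw]
    rw [mergeMap, if_neg hw'] at e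
    exact hnv w (hsub hw) e
  have hsolid := hm'.isSolid
  have hel : ∀ u, u ∈ Q'' ↔ (u ∈ Q ∧ u ≠ v) ∨ (u = x ∧ x ∈ Q'') ∨ (u = y ∧ y ∈ Q'') := by
    intro u
    constructor
    · intro hu
      rcases hsub hu with rfl | rfl | hu'
      · exact Or.inr (Or.inl ⟨rfl, hu⟩)
      · exact Or.inr (Or.inr ⟨rfl, hu⟩)
      · exact Or.inl hu'
    · rintro (⟨h1, h2⟩ | ⟨rfl, h1⟩ | ⟨rfl, h1⟩)
      exacts [hsup u h1 h2, h1, h1]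
  exact hsolid.of_replaced hvC hel hxy

/-- The vertex `x` replaces `v` on the cycle, and `y` joins `Q`, where it sees only `c`. A minimal
spreading subset of `Q + y` turns out to be `Q` or `Q + y`. -/
theorem Merges.solid_of_dominating [Finite V] (h : Merges G v x y) (hm : MinSpread G C Q)
    (hc : Clean G C Q v) (hcyc : CycAt G v a b (C \ {v})) (hx : x ∉ C ∪ Q) (hy : y ∉ C ∪ Q)
    (hxa : G.Adj x a) (hxb : G.Adj x b) (hyab : ¬(G.Adj y a ∧ G.Adj y b))
    (hcQ : c ∈ Q) (hvc : G.Adj v c) (hxc : ¬G.Adj x c) :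
    IsSolid G (insert x ((C ∪ Q) \ {v})) ∨ IsSolid G (insert x (insert y ((C ∪ Q) \ {v}))) := by
  have hne : ∀ u ∈ C ∪ Q, u ≠ x ∧ u ≠ y := fun u hu =>
    ⟨fun e => hx (e ▸ hu), fun e => hy (e ▸ hu)⟩
  have hPC : ∀ u ∈ C \ {v}, u ∈ C ∪ Q := fun u hu => Or.inl hu.1
  have hvx : ∀ u ∈ C ∪ Q, G.Adj x u → G.Adj v u := fun u hu h' =>
    (h.adj u (hne u hu).1 (hne u hu).2).2 (Or.inl h')
  have hvy : ∀ u ∈ C ∪ Q, G.Adj y u → G.Adj v u := fun u hu h' =>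
    (h.adj u (hne u hu).1 (hne u hu).2).2 (Or.inr h')
  have hvQ : v ∉ Q := Set.disjoint_left.1 hm.disj hc.mem
  have hyc : G.Adj y c :=
    ((h.adj c (hne c (Or.inr hcQ)).1 (hne c (Or.inr hcQ)).2).1 hvc).resolve_left hxc
  have hxQ : ∀ q ∈ Q, ¬G.Adj x q := by
    intro q hq hxq
    rw [hc.unique q hq c hcQ (hvx q (Or.inr hq) hxq) hvc] at hxq
    exact hxc hxq
  have hyQ : ∀ q ∈ Q, G.Adj y q → q = c := fun q hq hyq =>
    hc.unique q hq c hcQ (hvy q (Or.inr hq) hyq) hvc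
  have hC' : IsCyc G (insert x (C \ {v})) := by
    refine CycAt.isCyc (a := a) (b := b) ⟨hcyc.path, hcyc.ne, ?_, hxa, hxb, ?_⟩
    · exact fun h' => (hne x (hPC x h')).1 rfl
    · exact fun u hu h' => hcyc.adj u hu (hvx u (hPC u hu) h')
  have hconn : Conn G (insert y Q) := hm.conn.insert_adj hcQ hyc
  have hdisj : Disjoint (insert x (C \ {v})) (insert y Q) := by
    rw [Set.disjoint_left]
    rintro u (rfl | hu) (e | hu')
    · exact h.xy.ne e
    · exact (hne u (Or.inr hu')).1 rfl
    · exact (hne u (hPC u hu)).2 e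
    · exact Set.disjoint_left.1 hm.disj hu.1 hu'
  have hspread : Spread G (insert x (C \ {v})) (insert y Q) := by
    have hxatt : Att G (insert y Q) x := ⟨y, Or.inl rfl, h.xy.symm⟩
    have key : ∀ w ∈ C, w ≠ v → ¬G.Adj v w → Att G Q w →
        Spread G (insert x (C \ {v})) (insert y Q) := fun w hw hwv hadj h2 =>
      ⟨x, Or.inl rfl, w, Or.inr ⟨hw, hwv⟩, (hne w (Or.inl hw)).1.symm,
        fun h' => hadj (hvx w (Or.inl hw) h'), hxatt, h2.mono (Set.subset_insert _ _)⟩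
    obtain ⟨u, hu, w, hw, huw, hadj, h1, h2⟩ := hm.spread
    by_cases huv : u = v
    · subst huv
      exact key w hw huw.symm hadj h2
    by_cases hwv : w = v
    · subst hwv
      exact key u hu huw (fun h' => hadj h'.symm) h1
    · exact ⟨u, Or.inr ⟨hu, huv⟩, w, Or.inr ⟨hw, hwv⟩, huw, hadj,
        h1.mono (Set.subset_insert _ _), h2.mono (Set.subset_insert _ _)⟩
  obtain ⟨Q', hsub, hm'⟩ := hspread.exists_min hC' hdisj hconn
  have hsolid := hm'.isSolid
  have hQv : ∀ u ∈ Q, u ≠ v := fun u hu e => hvQ (e ▸ hu)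
  by_cases hyQ' : y ∈ Q'
  · by_cases hfull : Q' \ {y} = Q
    · right
      convert hsolid using 1
      ext u
      have h1 : u ∈ Q' \ {y} ↔ u ∈ Q := by rw [hfull]
      have h2 := hQv u
      have h3 : u = y → u ∈ Q' := fun e => e ▸ hyQ'
      simp only [Set.mem_union, Set.mem_insert_iff, Set.mem_sdiff, Set.mem_singleton_iff] at h1 ⊢
      tauto
    -- If `Q'` contains `y` but not all of `Q`, then everything attached to it is seen by `y`, hence
    -- is `x` or one of `a`, `b`, but not both of these; such vertices are pairwise adjacent.
    · exfalso
      have hQ0 : Q' \ {y} ⊆ Q := fun u hu => (hsub hu.1).resolve_left hu.2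
      have hatt : ∀ u ∈ insert x (C \ {v}), Att G Q' u → G.Adj y u := by
        rintro u hu ⟨q, hq, hqu⟩
        by_cases hqy : q = y
        · rwa [← hqy]
        have hqQ : q ∈ Q := hQ0 ⟨hq, hqy⟩
        obtain ⟨c', hc', hyc'⟩ := hm'.conn.exists_adj hyQ' hq (Ne.symm hqy)
        obtain rfl : c' = c := hyQ c' (hQ0 ⟨hc', hyc'.ne'⟩) hyc'
        -- Folding `y` onto its only neighbour in `Q` preserves connectedness.
        have hconn0 : Conn G (Q' \ {y}) := by
          classical
          have := hm'.conn.image (H := G) (f := Function.update id y c') (by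
            intro s hs t ht hst
            by_cases hsy : s = y <;> by_cases hty : t = y
            · left; rw [hsy, hty]
            · subst hsy
              left
              rw [Function.update_self, Function.update_of_ne hty]
              exact (hyQ t (hQ0 ⟨ht, hty⟩) hst).symm
            · subst hty
              left
              rw [Function.update_self, Function.update_of_ne hsy]
              exact hyQ s (hQ0 ⟨hs, hsy⟩) hst.symm
            · right
              rwa [Function.update_of_ne hsy, Function.update_of_ne hty])
          convert this using 1
          ext t
          constructor
          · rintro ⟨ht, hty : t ≠ y⟩
            exact ⟨t, ht, Function.update_of_ne hty _ _⟩
          · rintro ⟨s, hs, rfl⟩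
            by_cases hsy : s = y
            · subst hsy
              rw [Function.update_self]
              exact ⟨hc', hyc'.ne'⟩
            · rw [Function.update_of_ne hsy]
              exact ⟨hs, hsy⟩
        rcases hu with rfl | hu
        · exact absurd hqu.symm (hxQ q hqQ)
        · exact absurd (hc.att _ hQ0 hfull hconn0 ⟨c', ⟨hc', hyc'.ne'⟩, hvc.symm⟩ u hu.1
            ⟨q, ⟨hq, hqy⟩, hqu⟩) hu.2
      have hya : ∀ u ∈ insert x (C \ {v}), Att G Q' u → u = x ∨ u = a ∨ u = b := by
        rintro u hu h'
        have hyu := hatt u hu h'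
        rcases hu with rfl | hu
        · exact Or.inl rfl
        · exact Or.inr (hcyc.adj u hu (hvy u (hPC u hu) hyu))
      obtain ⟨u, hu, w, hw, huw, hadj, h1, h2⟩ := hm'.spread
      have e1 := hya u hu h1
      have e2 := hya w hw h2
      have k1 := hatt u hu h1
      have k2 := hatt w hw h2
      have hxa' := hxa.symm
      have hxb' := hxb.symm
      rcases e1 with rfl | rfl | rfl <;> rcases e2 with rfl | rfl | rfl <;>
        first
        | exact huw rfl
        | exact hadj ‹_›
        | exact hyab ⟨k1, k2⟩
        | exact hyab ⟨k2, k1⟩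
  · left
    have hQ'Q : Q' ⊆ Q := fun u hu => (hsub hu).resolve_left fun e => hyQ' (e ▸ hu)
    -- No vertex of `Q` sees `x`, so `Q'` already spreads on the old cycle and minimality of `Q`
    -- applies.
    have hQ' : Q' = Q := by
      refine hm.min Q' hQ'Q hm'.conn ?_
      have hP : ∀ u ∈ insert x (C \ {v}), Att G Q' u → u ∈ C := by
        rintro u (rfl | hu) ⟨q, hq, hqu⟩
        · exact absurd hqu.symm (hxQ q (hQ'Q hq))
        · exact hu.1
      obtain ⟨u, hu, w, hw, huw, hadj, h1, h2⟩ := hm'.spread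
      exact ⟨u, hP u hu h1, w, hP w hw h2, huw, hadj, h1, h2⟩
    rw [hQ'] at hsolid
    convert hsolid using 1
    ext u
    have h2 := hQv u
    simp only [Set.mem_union, Set.mem_insert_iff, Set.mem_sdiff, Set.mem_singleton_iff]
    tauto

/-- The edge `xy` replaces `v` on the cycle, and `Q` stays minimal: a proper connected subset
attached to `v` attaches to nothing but `x` and `y`, which are adjacent, and one not attached to `v`
attaches as before. -/
theorem Merges.solid_of_separating (h : Merges G v x y) (hm : MinSpread G C Q)
    (hc : Clean G C Q v) (hcyc : CycAt G v a b (C \ {v})) (hx : x ∉ C ∪ Q) (hy : y ∉ C ∪ Q)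
    (hxa : G.Adj x a) (hyb : G.Adj y b) (hxb : ¬G.Adj x b) (hya : ¬G.Adj y a) :
    IsSolid G (insert x (insert y ((C ∪ Q) \ {v}))) := by
  have hne : ∀ u ∈ C ∪ Q, u ≠ x ∧ u ≠ y := fun u hu =>
    ⟨fun e => hx (e ▸ hu), fun e => hy (e ▸ hu)⟩
  have hPC : ∀ u ∈ C \ {v}, u ∈ C ∪ Q := fun u hu => Or.inl hu.1
  have hvx : ∀ u ∈ C ∪ Q, G.Adj x u → G.Adj v u := fun u hu h' =>
    (h.adj u (hne u hu).1 (hne u hu).2).2 (Or.inl h')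
  have hvy : ∀ u ∈ C ∪ Q, G.Adj y u → G.Adj v u := fun u hu h' =>
    (h.adj u (hne u hu).1 (hne u hu).2).2 (Or.inr h')
  have hvQ : v ∉ Q := Set.disjoint_left.1 hm.disj hc.mem
  have hxP : x ∉ C \ {v} := fun h' => (hne x (hPC x h')).1 rfl
  have hyP : y ∉ C \ {v} := fun h' => (hne y (hPC y h')).2 rfl
  have hbC := hcyc.path.right_mem
  have p : IndPath G x b (insert x (C \ {v})) := by
    refine .cons hxa hxP (fun u hu hxu => ?_) hcyc.path
    refine (hcyc.adj u hu (hvx u (hPC u hu) hxu)).resolve_right ?_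
    rintro rfl; exact hxb hxu
  have hC' : IsCyc G (insert y (insert x (C \ {v}))) := by
    refine CycAt.isCyc (a := x) (b := b) ⟨p, (hne b (hPC b hbC)).1.symm, ?_, h.xy.symm, hyb, ?_⟩
    · rintro (e | h')
      exacts [h.xy.ne e.symm, hyP h']
    · rintro u (rfl | hu) hyu
      · exact Or.inl rfl
      · refine Or.inr ((hcyc.adj u hu (hvy u (hPC u hu) hyu)).resolve_left ?_)
        rintro rfl; exact hya hyu
  have hm' : MinSpread G (insert y (insert x (C \ {v}))) Q := by
    refine ⟨hC', ?_, hm.conn, ?_, ?_⟩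
    · rw [Set.disjoint_left]
      rintro u (rfl | rfl | hu) hu'
      exacts [hy (Or.inr hu'), hx (Or.inr hu'), Set.disjoint_left.1 hm.disj hu.1 hu']
    · have key : ∀ w ∈ C, w ≠ v → ¬G.Adj v w → Att G Q v → Att G Q w →
          Spread G (insert y (insert x (C \ {v}))) Q := by
        rintro w hw hwv hadj ⟨q, hq, hqv⟩ h2
        have hq' := hne q (Or.inr hq)
        rcases (h.adj q hq'.1 hq'.2).1 hqv.symm with h' | h'
        · exact ⟨x, by simp, w, Or.inr (Or.inr ⟨hw, hwv⟩), (hne w (Or.inl hw)).1.symm,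
            fun e => hadj (hvx w (Or.inl hw) e), ⟨q, hq, h'.symm⟩, h2⟩
        · exact ⟨y, by simp, w, Or.inr (Or.inr ⟨hw, hwv⟩), (hne w (Or.inl hw)).2.symm,
            fun e => hadj (hvy w (Or.inl hw) e), ⟨q, hq, h'.symm⟩, h2⟩
      obtain ⟨u, hu, w, hw, huw, hadj, h1, h2⟩ := hm.spread
      by_cases huv : u = v
      · subst huv
        exact key w hw huw.symm hadj h1 h2
      by_cases hwv : w = v
      · subst hwv
        exact key u hu huw (fun h' => hadj h'.symm) h2 h1
      · exact ⟨u, Or.inr (Or.inr ⟨hu, huv⟩), w, Or.inr (Or.inr ⟨hw, hwv⟩), huw, hadj, h1, h2⟩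
    · rintro Q₀ hQ₀ hconn ⟨u, hu, w, hw, huw, hadj, h1, h2⟩
      by_contra hcon
      by_cases hatt : Att G Q₀ v
      · have key : ∀ u ∈ insert y (insert x (C \ {v})), Att G Q₀ u → u = x ∨ u = y := by
          rintro u (rfl | rfl | hu) h'
          · exact Or.inr rfl
          · exact Or.inl rfl
          · exact absurd (hc.att Q₀ hQ₀ hcon hconn hatt u hu.1 h') hu.2
        rcases key u hu h1 with rfl | rfl <;> rcases key w hw h2 with rfl | rfl
        exacts [huw rfl, hadj h.xy, hadj h.xy.symm, huw rfl]
      · have key : ∀ u ∈ insert y (insert x (C \ {v})), Att G Q₀ u → u ∈ C := by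
          rintro u (rfl | rfl | hu) ⟨q, hq, hqu⟩
          · exact absurd ⟨q, hq, (hvy q (Or.inr (hQ₀ hq)) hqu.symm).symm⟩ hatt
          · exact absurd ⟨q, hq, (hvx q (Or.inr (hQ₀ hq)) hqu.symm).symm⟩ hatt
          · exact hu.1
        exact hcon (hm.min Q₀ hQ₀ hconn ⟨u, key u hu h1, w, key w hw h2, huw, hadj, h1, h2⟩)
  convert hm'.isSolid using 1
  ext u
  have h2 : u ∈ Q → u ≠ v := fun hu e => hvQ (e ▸ hu)
  simp only [Set.mem_union, Set.mem_insert_iff, Set.mem_sdiff, Set.mem_singleton_iff]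
  tauto

/-- A solid in the contracted graph comes from a solid in the original graph. -/
theorem Merges.exists_solid [Finite V] (h : Merges G v x y) (hS : IsSolid G S) (hv : v ∈ S)
    (hx : x ∉ S) (hy : y ∉ S) :
    IsSolid G (insert x (S \ {v})) ∨ IsSolid G (insert y (S \ {v})) ∨
      IsSolid G (insert x (insert y (S \ {v}))) := by
  by_cases hfx : ∀ b ∈ S, G.Adj v b → G.Adj x b
  · exact Or.inl (h.solid_of_full hS hv hx hy hfx)
  by_cases hfy : ∀ b ∈ S, G.Adj v b → G.Adj y b
  · exact Or.inr (Or.inl (h.symm.solid_of_full hS hv hy hx hfy))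
  push Not at hfx hfy
  have hne : ∀ u ∈ S, u ≠ x ∧ u ≠ y := fun u hu => ⟨fun e => hx (e ▸ hu), fun e => hy (e ▸ hu)⟩
  rcases (isSolidGraph_induce_iff.2 hS).exists_minSpread hv with
    ⟨k₁, k₂, k₃, k₀, hK, h01, h02, h03, h12, h13, h23⟩ | ⟨C, Q, rfl, hm, hvQ | hc⟩
  · obtain ⟨p, hp, hvp, hxp⟩ := hfx
    obtain ⟨q, hq, hvq, hyq⟩ := hfy
    have hxq := ((h.adj q (hne q hq).1 (hne q hq).2).1 hvq).resolve_right hyq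
    have hpq : p ≠ q := by rintro rfl; exact hxp hxq
    have hclique : ∀ s ∈ S, ∀ t ∈ S, s ≠ t → G.Adj s t := by
      have h01' := h01.symm
      have h02' := h02.symm
      have h03' := h03.symm
      have h12' := h12.symm
      have h13' := h13.symm
      have h23' := h23.symm
      rw [hK]
      rintro s (rfl | rfl | rfl | rfl) t (rfl | rfl | rfl | rfl) hst <;>
        first
        | exact absurd rfl hst
        | assumption
    obtain ⟨r, hr, hrv, hrp, hrq, hSr⟩ : ∃ r ∈ S, r ≠ v ∧ r ≠ p ∧ r ≠ q ∧
        ∀ t ∈ S, t = v ∨ t = p ∨ t = q ∨ t = r := by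
      have n01 := h01.ne
      have n02 := h02.ne
      have n03 := h03.ne
      have n12 := h12.ne
      have n13 := h13.ne
      have n23 := h23.ne
      have n1 := hvp.ne
      have n2 := hvq.ne
      have e : ∀ t, t ∈ S ↔ t = k₀ ∨ t = k₁ ∨ t = k₂ ∨ t = k₃ := by intro t; simp [hK]
      have ev := (e v).1 hv
      have ep := (e p).1 hp
      have eq := (e q).1 hq
      clear hK hclique hne
      by_contra hcon
      push Not at hcon
      have c0 := hcon k₀ ((e _).2 (by simp))
      have c1 := hcon k₁ ((e _).2 (by simp))
      have c2 := hcon k₂ ((e _).2 (by simp))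
      have c3 := hcon k₃ ((e _).2 (by simp))
      grind
    refine Or.inr (Or.inr ?_)
    convert h.solid_of_clique hvp hvq (hclique v hv r hr hrv.symm) (hclique p hp q hq hpq)
      (hclique p hp r hr hrp.symm) (hclique q hq r hr hrq.symm) (hne p hp).1 (hne p hp).2
      (hne q hq).1 (hne q hq).2 (hne r hr).1 (hne r hr).2 hxp hyq using 1
    ext t
    simp only [Set.mem_insert_iff, Set.mem_sdiff, Set.mem_singleton_iff]
    constructor
    · rintro (h' | h' | ⟨h1, h2⟩)
      · exact Or.inl h'
      · exact Or.inr (Or.inl h')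
      · exact Or.inr (Or.inr ((hSr t h1).resolve_left h2))
    · rintro (h' | h' | rfl | rfl | rfl)
      · exact Or.inl h'
      · exact Or.inr (Or.inl h')
      · exact Or.inr (Or.inr ⟨hp, hvp.ne'⟩)
      · exact Or.inr (Or.inr ⟨hq, hvq.ne'⟩)
      · exact Or.inr (Or.inr ⟨hr, hrv⟩)
  · exact h.solid_of_mem_path hm hvQ hx hy
  · obtain ⟨a, b, hcyc⟩ := hm.cyc.cycAt hc.mem
    have haS : a ∈ C ∪ Q := Or.inl hcyc.path.left_mem.1
    have hbS : b ∈ C ∪ Q := Or.inl hcyc.path.right_mem.1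
    have ha := (h.adj a (hne a haS).1 (hne a haS).2).1 hcyc.left
    have hb := (h.adj b (hne b hbS).1 (hne b hbS).2).1 hcyc.right
    -- a neighbour of `v` that is missed by a vertex dominating `a` and `b` lies in `Q`
    have hmiss : ∀ {z c}, G.Adj z a → G.Adj z b → c ∈ C ∪ Q → G.Adj v c → ¬G.Adj z c → c ∈ Q := by
      intro z c hza hzb hcS hvc hzc
      refine hcS.resolve_left fun hcC => ?_
      rcases hcyc.adj c ⟨hcC, hvc.ne'⟩ hvc with rfl | rfl
      exacts [hzc hza, hzc hzb]
    obtain ⟨p, hp, hvp, hxp⟩ := hfx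
    obtain ⟨q, hq, hvq, hyq⟩ := hfy
    -- If both `x` and `y` saw `a` and `b`, both would miss the one neighbour of `v` in `Q`, which
    -- must see `x` or `y`.
    have hnot : G.Adj x a → G.Adj x b → G.Adj y a → G.Adj y b → False := by
      intro h1 h2 h3 h4
      have hpQ := hmiss h1 h2 hp hvp hxp
      have hqQ := hmiss h3 h4 hq hvq hyq
      obtain rfl := hc.unique p hpQ q hqQ hvp hvq
      exact ((h.adj p (hne p hp).1 (hne p hp).2).1 hvp).elim hxp hyq
    by_cases hx2 : G.Adj x a ∧ G.Adj x b
    · have hpQ := hmiss hx2.1 hx2.2 hp hvp hxp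
      rcases h.solid_of_dominating hm hc hcyc hx hy hx2.1 hx2.2
        (fun h' => hnot hx2.1 hx2.2 h'.1 h'.2) hpQ hvp hxp with h' | h'
      exacts [Or.inl h', Or.inr (Or.inr h')]
    by_cases hy2 : G.Adj y a ∧ G.Adj y b
    · have hqQ := hmiss hy2.1 hy2.2 hq hvq hyq
      rcases h.symm.solid_of_dominating hm hc hcyc hy hx hy2.1 hy2.2 hx2 hqQ hvq hyq with h' | h'
      · exact Or.inr (Or.inl h')
      · rw [Set.insert_comm] at h'
        exact Or.inr (Or.inr h')
    refine Or.inr (Or.inr ?_)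
    by_cases hxa : G.Adj x a
    · exact h.solid_of_separating hm hc hcyc hx hy hxa (by tauto) (by tauto) (by tauto)
    · exact h.solid_of_separating hm hc hcyc.symm hx hy (by tauto) (by tauto) hxa (by tauto)

end Merges

end GraphChar

/-! ### Cycles created by splitting a vertex. -/

namespace GraphChar

section Fibre

variable {V W : Type*} {G : SimpleGraph V} {H : SimpleGraph W} {a b u w v x y : V}
  {A C P S : Set V}

/-- Closing a path by a further vertex yields minimum degree two, whatever other neighbours that
vertex has. By `IndPath.no_core` such a set lies in no induced path. -/
theorem IndPath.core (p : IndPath G a b S) (hab : a ≠ b) (hw : w ∉ S) (ha : G.Adj w a)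
    (hb : G.Adj w b) :
    ∀ t ∈ insert w S, ∃ u ∈ insert w S, ∃ u' ∈ insert w S, u ≠ u' ∧ G.Adj t u ∧ G.Adj t u' := by
  rintro t (rfl | ht)
  · exact ⟨a, Or.inr p.left_mem, b, Or.inr p.right_mem, hab, ha, hb⟩
  by_cases hta : t = a
  · subst hta
    obtain ⟨c, q, hc, -⟩ := p.trim_left hab
    refine ⟨w, Or.inl rfl, c, Or.inr q.left_mem.1, ?_, ha.symm, hc⟩
    rintro rfl; exact hw q.left_mem.1
  by_cases htb : t = b
  · subst htb
    obtain ⟨c, q, hc, -⟩ := p.trim_right hab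
    refine ⟨w, Or.inl rfl, c, Or.inr q.right_mem.1, ?_, hb.symm, hc⟩
    rintro rfl; exact hw q.right_mem.1
  obtain ⟨u, hu, u', hu', hne, h1, h2⟩ := p.exists_two_neighbors ht hta htb
  exact ⟨u, Or.inr hu, u', Or.inr hu', hne, h1, h2⟩

/-- A solid graph with a vertex removed is never a path. -/
theorem not_isSolid_insert (p : IndPath G a b P) : ¬IsSolid G (insert v P) := by
  intro h
  have hP : ∀ {T : Set V}, T ⊆ insert v P → v ∉ T → T ⊆ P := fun hT hvT t ht =>
    (hT ht).resolve_left fun e => hvT (e ▸ ht)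
  rcases (isSolidGraph_induce_iff.2 h).exists_form (Set.mem_insert v P) with
    ⟨C, w, hC, hw, hs, x, hx, y, hy, z, hz, hxy, hxz, hyz, h1, h2, h3⟩ |
    ⟨l, r, a', b', A, c, d, B, e, f, Q, hs, h, hvQ⟩
  · by_cases hvw : v = w
    · subst hvw
      exact hC.not_subset_path p (hP (hs ▸ Set.subset_insert _ _) hw)
    have hvC : v ∈ C := by
      have : v ∈ insert w C := hs ▸ Set.mem_insert v P
      exact this.resolve_left hvw
    obtain ⟨a', b', hcyc⟩ := hC.cycAt hvC
    -- If `v` is on the rim, the hub has two other neighbours on it; the rim path between them that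
    -- avoids `v`, with the hub, is a core.
    obtain ⟨s, hs', t, ht', hst, hws, hwt⟩ : ∃ s ∈ C \ {v}, ∃ t ∈ C \ {v}, s ≠ t ∧ G.Adj w s ∧
        G.Adj w t := by
      by_cases hxv : x = v
      · exact ⟨y, ⟨hy, fun e => hxy (hxv.trans e.symm)⟩, z, ⟨hz, fun e => hxz (hxv.trans e.symm)⟩,
          hyz, h2, h3⟩
      by_cases hyv : y = v
      · exact ⟨x, ⟨hx, hxv⟩, z, ⟨hz, fun e => hyz (hyv.trans e.symm)⟩, hxz, h1, h3⟩
      · exact ⟨x, ⟨hx, hxv⟩, y, ⟨hy, hyv⟩, hxy, h1, h2⟩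
    obtain ⟨S, hS, q⟩ := hcyc.path.conn.exists_indPath hs' ht'
    refine p.no_core (T := insert w S) (hP ?_ ?_) ⟨w, Or.inl rfl⟩
      (q.core hst (fun h' => hw (hS h').1) hws hwt)
    · rw [hs]
      exact Set.insert_subset_insert fun t ht => (hS ht).1
    · rintro (e | h')
      exacts [hvw e, (hS h').2 rfl]
  · have hA : A ⊆ insert v P := by rw [hs]; intro t ht; simp [ht]
    have hB : B ⊆ insert v P := by rw [hs]; intro t ht; simp [ht]
    have hQ : Q ⊆ insert v P := by rw [hs]; intro t ht; simp [ht]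
    rcases hvQ with hvQ | ⟨hr, rfl⟩
    -- The cycle `A ∪ B` survives the removal of a vertex of `Q`.
    · refine h.isCyc.not_subset_path p (hP (Set.union_subset hA hB) ?_)
      rintro (h' | h')
      exacts [Set.disjoint_left.1 h.dAQ h' hvQ, Set.disjoint_left.1 h.dBQ h' hvQ]
    have haP : a' ∈ P := (hA h.pA.left_mem).resolve_left h.ne
    have hcP : c ∈ P := (hB h.pB.left_mem).resolve_left
      (h.dAB.ne_of_mem h.pA.right_mem h.pB.left_mem).symm
    have heP : e ∈ P := (hQ h.pQ.left_mem).resolve_left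
      (h.dAQ.ne_of_mem h.pA.right_mem h.pQ.left_mem).symm
    -- If `v` is the right apex, either the left triangle survives or the left apex keeps three
    -- neighbours.
    by_cases hl : l
    · have hce := (h.BQ c h.pB.left_mem e h.pQ.left_mem).2 (Or.inl ⟨hl, rfl, rfl⟩)
      refine (isCyc_triangle h.ac h.ae hce).not_subset_path p ?_
      rintro t (rfl | rfl | rfl) <;> assumption
    · have hab : ¬G.Adj a' v := (h.shape.resolve_right (by simp [hl])).2.2
      obtain ⟨a₁, q, ha₁, -⟩ := h.pA.trim_left h.ne
      have ha₁P : a₁ ∈ P := (hA q.left_mem.1).resolve_left fun e => hab (e ▸ ha₁)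
      exact p.no_three_neighbors haP ha₁P hcP heP (h.dAB.ne_of_mem q.left_mem.1 h.pB.left_mem)
        (h.dAQ.ne_of_mem q.left_mem.1 h.pQ.left_mem) (h.dBQ.ne_of_mem h.pB.left_mem h.pQ.left_mem)
        ha₁ h.ac h.ae

/-- `A` is a path with one end seen by `x` and one by `y`, and each of `x`, `y` sees nothing else in
`A`. Hence neither closes `A` alone, while `v` does, unless the two ends coincide and the cycle is a
triangle. -/
theorem Merges.of_isCyc_both (h : Merges G v x y) (hv : v ∉ A) (hx : x ∉ A) (hy : y ∉ A)
    (hC : IsCyc G (insert x (insert y A))) :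
    ¬IsCyc G (insert x A) ∧ ¬IsCyc G (insert y A) ∧ ¬IsSolid G (insert v A) ∧
      (IsCyc G (insert v A) ∨ ∃ p, A = {p} ∧ G.Adj x p ∧ G.Adj y p) := by
  have hxA : x ∉ insert y A := by
    rintro (e | h')
    exacts [h.xy.ne e, hx h']
  obtain ⟨f, hcyc⟩ : ∃ f, CycAt G x y f (insert y A) := by
    obtain ⟨e, f, hcyc⟩ := hC.cycAt (Set.mem_insert x _)
    rw [Set.insert_sdiff_self_of_notMem hxA] at hcyc
    rcases hcyc.adj y (Or.inl rfl) h.xy with rfl | rfl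
    exacts [⟨_, hcyc⟩, ⟨_, hcyc.symm⟩]
  obtain ⟨c, p, hyc, hc⟩ := hcyc.path.trim_left hcyc.ne
  rw [Set.insert_sdiff_self_of_notMem hy] at p
  have hx' : ∀ u ∈ A, G.Adj x u → u = f := fun u hu hxu =>
    (hcyc.adj u (Or.inr hu) hxu).resolve_left fun e => hy (e ▸ hu)
  have hy' : ∀ u ∈ A, G.Adj y u → u = c := fun u hu hyu => hc u (Or.inr hu) hyu
  have hnot : ∀ {z t}, (∀ u ∈ A, G.Adj z u → u = t) → ¬IsCyc G (insert z A) := by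
    intro z t hz hcy
    obtain ⟨u, hu, w, hw, huw, h1, h2⟩ := hcy.exists_two_neighbors (Set.mem_insert z A)
    exact huw ((hz u (hu.resolve_left h1.ne') h1).trans (hz w (hw.resolve_left h2.ne') h2).symm)
  refine ⟨hnot hx', hnot hy', not_isSolid_insert p, ?_⟩
  by_cases hcf : c = f
  · subst hcf
    exact Or.inr ⟨c, p.eq_singleton, hcyc.right, hyc⟩
  · have hne : ∀ u ∈ A, u ≠ x ∧ u ≠ y := fun u hu => ⟨fun e => hx (e ▸ hu), fun e => hy (e ▸ hu)⟩
    have hva : ∀ u ∈ A, (G.Adj v u ↔ G.Adj x u ∨ G.Adj y u) := fun u hu =>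
      h.adj u (hne u hu).1 (hne u hu).2
    exact Or.inl (CycAt.isCyc (a := c) (b := f) ⟨p, hcf, hv, (hva c p.left_mem).2 (Or.inr hyc),
      (hva f p.right_mem).2 (Or.inl hcyc.right), fun u hu hvu =>
      ((hva u hu).1 hvu).symm.imp (hy' u hu) (hx' u hu)⟩)

theorem Merges.isCyc_of_neighbors (h : Merges G v x y) (hv : v ∉ A) (hx : x ∉ A) (hy : y ∉ A)
    (hcyc : CycAt G x a b A) (hsub : ∀ u ∈ A, G.Adj y u → u = a ∨ u = b) :
    IsCyc G (insert v A) := by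
  have hva : ∀ u ∈ A, (G.Adj v u ↔ G.Adj x u ∨ G.Adj y u) := fun u hu =>
    h.adj u (fun e => hx (e ▸ hu)) (fun e => hy (e ▸ hu))
  exact CycAt.isCyc ⟨hcyc.path, hcyc.ne, hv, (hva a hcyc.path.left_mem).2 (Or.inl hcyc.left),
    (hva b hcyc.path.right_mem).2 (Or.inl hcyc.right), fun u hu hvu =>
    ((hva u hu).1 hvu).elim (hcyc.adj u hu) (hsub u hu)⟩

/-- `A` is a path with ends `a`, `b`. If `y` sees no other vertex of `A`, then `v` closes `A` to a
cycle. Otherwise `y` sees `x` and a vertex of `A` not adjacent to `x`, so it spreads on the cycle `A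
+ x`. -/
theorem Merges.of_isCyc_left (h : Merges G v x y) (hv : v ∉ A) (hx : x ∉ A) (hy : y ∉ A)
    (hC : IsCyc G (insert x A)) :
    ¬IsSolid G (insert v A) ∧ (IsCyc G (insert v A) ∨ IsSolid G (insert x (insert y A))) := by
  obtain ⟨a, b, hcyc⟩ := hC.cycAt (Set.mem_insert x _)
  rw [Set.insert_sdiff_self_of_notMem hx] at hcyc
  refine ⟨not_isSolid_insert hcyc.path, ?_⟩
  by_cases hsub : ∀ u ∈ A, G.Adj y u → u = a ∨ u = b
  · exact Or.inl (h.isCyc_of_neighbors hv hx hy hcyc hsub)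
  · push Not at hsub
    obtain ⟨u, hu, hyu, hua, hub⟩ := hsub
    right
    have hyC : y ∉ insert x A := by
      rintro (e | h')
      exacts [h.xy.ne e.symm, hy h']
    have := (minSpread_singleton hC hyC ⟨x, Or.inl rfl, u, Or.inr hu, fun e => hx (e ▸ hu), fun h' =>
      (hcyc.adj u hu h').elim hua hub, ⟨y, rfl, h.xy.symm⟩, ⟨y, rfl, hyu⟩⟩).isSolid
    rwa [Set.union_singleton, Set.insert_comm] at this

/-- An inner vertex of the path `A` has two neighbours there, so on the cycle `A + y` it cannot also
see `y`. Thus `y` sees exactly the ends of `A`, and with `x` it has three neighbours on `A + x`. -/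
theorem Merges.of_isCyc_left_right (h : Merges G v x y) (hv : v ∉ A) (hx : x ∉ A) (hy : y ∉ A)
    (hC : IsCyc G (insert x A)) (hC' : IsCyc G (insert y A)) :
    IsCyc G (insert v A) ∧ IsSolid G (insert x (insert y A)) := by
  obtain ⟨a, b, hcyc⟩ := hC.cycAt (Set.mem_insert x _)
  rw [Set.insert_sdiff_self_of_notMem hx] at hcyc
  have hsub : ∀ u ∈ A, G.Adj y u → u = a ∨ u = b := by
    intro u hu hyu
    by_contra hcon
    push Not at hcon
    obtain ⟨s, hs, t, ht, hst, h1, h2⟩ := hcyc.path.exists_two_neighbors hu hcon.1 hcon.2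
    exact hC'.no_three_neighbors (Or.inr hu) (Or.inr hs) (Or.inr ht) (Or.inl rfl) hst
      (fun e => hy (e ▸ hs)) (fun e => hy (e ▸ ht)) h1 h2 hyu.symm
  refine ⟨h.isCyc_of_neighbors hv hx hy hcyc hsub, ?_⟩
  have hyC : y ∉ insert x A := by
    rintro (e | h')
    exacts [h.xy.ne e.symm, hy h']
  have hyab : G.Adj y a ∧ G.Adj y b := by
    obtain ⟨s, hs, t, ht, hst, h1, h2⟩ := hC'.exists_two_neighbors (Set.mem_insert y A)
    have e1 := hsub s (hs.resolve_left h1.ne') h1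
    have e2 := hsub t (ht.resolve_left h2.ne') h2
    rcases e1 with rfl | rfl <;> rcases e2 with rfl | rfl
    exacts [absurd rfl hst, ⟨h1, h2⟩, ⟨h2, h1⟩, absurd rfl hst]
  rw [Set.insert_comm]
  exact Or.inl ⟨insert x A, y, hC, hyC, rfl, x, Or.inl rfl, a, Or.inr hcyc.path.left_mem, b,
    Or.inr hcyc.path.right_mem, hcyc.left.ne, hcyc.right.ne, hcyc.ne, h.xy.symm, hyab.1, hyab.2⟩

theorem isSolid_image_iff {f : V → W} (hf : Function.Injective f)
    (hG : ∀ a b, G.Adj a b ↔ H.Adj (f a) (f b)) : IsSolid H (f '' S) ↔ IsSolid G S := by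
  refine ⟨fun h => ?_, fun h => h.relabel hf.injOn fun a _ b _ => hG a b⟩
  obtain ⟨_, v, -, -⟩ := h.nonempty
  have : Nonempty V := ⟨v⟩
  have hinv := Function.leftInverse_invFun hf
  have := h.relabel (H := G) (g := Function.invFun f) (by
    rintro _ ⟨a, -, rfl⟩ _ ⟨b, -, rfl⟩ e
    rw [hinv a, hinv b] at e; rw [e]) (by
    rintro _ ⟨a, -, rfl⟩ _ ⟨b, -, rfl⟩
    rw [hinv a, hinv b, hG])
  rwa [← Set.image_comp, hinv.id, Set.image_id] at this

theorem IsCyc.nonempty (h : IsCyc G C) : C.Nonempty := by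
  obtain ⟨v, -, -, -, rfl, -⟩ := h
  exact ⟨v, Or.inl rfl⟩

theorem isCyc_image_iff {f : V → W} (hf : Function.Injective f)
    (hG : ∀ a b, G.Adj a b ↔ H.Adj (f a) (f b)) : IsCyc H (f '' S) ↔ IsCyc G S := by
  refine ⟨fun h => ?_, fun h => h.relabel hf.injOn fun a _ b _ => hG a b⟩
  obtain ⟨_, v, -, -⟩ := h.nonempty
  have : Nonempty V := ⟨v⟩
  have hinv := Function.leftInverse_invFun hf
  have := h.relabel (H := G) (f := Function.invFun f) (by
    rintro _ ⟨a, -, rfl⟩ _ ⟨b, -, rfl⟩ e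
    rw [hinv a, hinv b] at e; rw [e]) (by
    rintro _ ⟨a, -, rfl⟩ _ ⟨b, -, rfl⟩
    rw [hinv a, hinv b, hG])
  rwa [← Set.image_comp, hinv.id, Set.image_id] at this

/-! ### The joint graph and the fibres of the contraction map. -/

/-- The graph that contains both `G` and `G / xy`, the contracted vertex being `none`. -/
def jointGraph {V : Type*} (G : SimpleGraph V) (x y : V) : SimpleGraph (Option V) where
  Adj
    | some a, some b => G.Adj a b
    | some a, none => (a ≠ x ∧ a ≠ y) ∧ (G.Adj x a ∨ G.Adj y a)
    | none, some b => (b ≠ x ∧ b ≠ y) ∧ (G.Adj x b ∨ G.Adj y b)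
    | none, none => False
  symm := ⟨by
    rintro (_ | a) (_ | b) h
    · exact h
    · exact h
    · exact h
    · exact G.adj_symm h⟩
  loopless := ⟨by
    rintro (_ | a) h
    · exact h
    · exact G.irrefl h⟩

theorem jointGraph_merges (h : G.Adj x y) : Merges (jointGraph G x y) none (some x) (some y) := by
  refine ⟨h, by simp, by simp, ?_⟩
  rintro (_ | b) h1 h2
  · simp [jointGraph]
  · have h1' : b ≠ x := fun e => h1 (e ▸ rfl)
    have h2' : b ≠ y := fun e => h2 (e ▸ rfl)
    simp [jointGraph, h1', h2']

/-- The embedding of `G / xy` into the joint graph. -/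
def jointMap {V : Type*} {x y : V} : ContractVert x y → Option V := Option.map Subtype.val

theorem jointMap_injective : Function.Injective (jointMap (x := x) (y := y)) :=
  Option.map_injective Subtype.val_injective

theorem contract_adj_iff (a b : ContractVert x y) :
    (contract G x y).Adj a b ↔ (jointGraph G x y).Adj (jointMap a) (jointMap b) := by
  rcases a with _ | ⟨a, ha⟩ <;> rcases b with _ | ⟨b, hb⟩
  · exact Iff.rfl
  · exact (and_iff_right hb).symm
  · exact (and_iff_right ha).symm
  · exact Iff.rfl

/-- The old vertices in a set of vertices of `G / xy`. -/
def oldVerts {V : Type*} {x y : V} (Z : Set (ContractVert x y)) : Set V :=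
  {w | ∃ h : w ≠ x ∧ w ≠ y, some ⟨w, h⟩ ∈ Z}

theorem contractMap_left : contractMap x y x = none := dif_neg (by simp)

theorem contractMap_right : contractMap x y y = none := dif_neg (by simp)

theorem contractMap_of_ne (h : w ≠ x ∧ w ≠ y) : contractMap x y w = some ⟨w, h⟩ := dif_pos h

theorem contractMap_eq_none_iff : contractMap x y w = none ↔ w = x ∨ w = y := by
  by_cases h : w ≠ x ∧ w ≠ y
  · rw [contractMap_of_ne h]; simp; tauto
  · have : w = x ∨ w = y := by tauto
    rcases this with rfl | rfl
    · simp [contractMap_left]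
    · simp [contractMap_right]

theorem image_contractMap_eq_iff {T : Set V} {Z : Set (ContractVert x y)} :
    contractMap x y '' T = Z ↔
      (∀ w, w ≠ x → w ≠ y → (w ∈ T ↔ w ∈ oldVerts Z)) ∧ ((x ∈ T ∨ y ∈ T) ↔ none ∈ Z) := by
  have hsome : ∀ w (h : w ≠ x ∧ w ≠ y), some ⟨w, h⟩ ∈ contractMap x y '' T ↔ w ∈ T := by
    intro w h
    constructor
    · rintro ⟨t, ht, e⟩
      by_cases h' : t ≠ x ∧ t ≠ y
      · rw [contractMap_of_ne h'] at e
        obtain rfl : t = w := congrArg Subtype.val (Option.some_injective _ e)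
        exact ht
      · rw [contractMap_eq_none_iff.2 (by tauto)] at e
        cases e
    · exact fun hw => ⟨w, hw, contractMap_of_ne h⟩
  have hnone : none ∈ contractMap x y '' T ↔ x ∈ T ∨ y ∈ T := by
    constructor
    · rintro ⟨t, ht, e⟩
      rcases contractMap_eq_none_iff.1 e with rfl | rfl
      exacts [Or.inl ht, Or.inr ht]
    · rintro (h | h)
      exacts [⟨x, h, contractMap_left⟩, ⟨y, h, contractMap_right⟩]
  constructor
  · rintro rfl
    refine ⟨fun w h1 h2 => ?_, hnone.symm⟩
    rw [← hsome w ⟨h1, h2⟩]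
    exact ⟨fun h => ⟨⟨h1, h2⟩, h⟩, fun ⟨_, h⟩ => h⟩
  · rintro ⟨h1, h2⟩
    ext (_ | ⟨w, hw⟩)
    · rw [hnone, h2]
    · rw [hsome w hw, h1 w hw.1 hw.2]
      exact ⟨fun ⟨_, h⟩ => h, fun h => ⟨hw, h⟩⟩

theorem left_notMem_oldVerts {Z : Set (ContractVert x y)} : x ∉ oldVerts Z := fun h => h.1.1 rfl

theorem right_notMem_oldVerts {Z : Set (ContractVert x y)} : y ∉ oldVerts Z := fun h => h.1.2 rfl

theorem image_contractMap_of_none_mem {T : Set V} {Z : Set (ContractVert x y)} (hZ : none ∈ Z) :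
    contractMap x y '' T = Z ↔ T = insert x (oldVerts Z) ∨ T = insert y (oldVerts Z) ∨
      T = insert x (insert y (oldVerts Z)) := by
  have hx := left_notMem_oldVerts (Z := Z)
  have hy := right_notMem_oldVerts (Z := Z)
  rw [image_contractMap_eq_iff]
  constructor
  · rintro ⟨h1, h2⟩
    have hxy := h2.2 hZ
    have key : ∀ {T' : Set V}, (x ∈ T ↔ x ∈ T') → (y ∈ T ↔ y ∈ T') →
        (∀ w, w ≠ x → w ≠ y → (w ∈ oldVerts Z ↔ w ∈ T')) → T = T' := by
      intro T' k1 k2 k3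
      ext w
      by_cases hwx : w = x
      · rw [hwx, k1]
      by_cases hwy : w = y
      · rw [hwy, k2]
      · rw [h1 w hwx hwy, k3 w hwx hwy]
    by_cases hxT : x ∈ T <;> by_cases hyT : y ∈ T
    · exact Or.inr (Or.inr (key (by simp [hxT]) (by simp [hyT]) fun w h1 h2 => by simp [h1, h2]))
    · refine Or.inl (key (by simp [hxT]) ?_ fun w h1 h2 => by simp [h1])
      have hyx : y ≠ x := fun e => hyT (e ▸ hxT)
      simp [hyT, hyx, hy]
    · refine Or.inr (Or.inl (key ?_ (by simp [hyT]) fun w h1 h2 => by simp [h2]))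
      have hyx : x ≠ y := fun e => hxT (e ▸ hyT)
      simp [hxT, hyx, hx]
    · exact absurd hxy (by tauto)
  · rintro (rfl | rfl | rfl)
    · exact ⟨fun w h1 h2 => by simp [h1], by simp [hZ]⟩
    · exact ⟨fun w h1 h2 => by simp [h2], by simp [hZ]⟩
    · exact ⟨fun w h1 h2 => by simp [h1, h2], by simp [hZ]⟩

theorem image_contractMap_of_none_notMem {T : Set V} {Z : Set (ContractVert x y)}
    (hZ : none ∉ Z) : contractMap x y '' T = Z ↔ T = oldVerts Z := by
  have hx := left_notMem_oldVerts (Z := Z)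
  have hy := right_notMem_oldVerts (Z := Z)
  rw [image_contractMap_eq_iff]
  constructor
  · rintro ⟨h1, h2⟩
    have h3 : ¬(x ∈ T ∨ y ∈ T) := fun h => hZ (h2.1 h)
    ext w
    by_cases hwx : w = x
    · subst hwx; simp only [hx, iff_false]; tauto
    by_cases hwy : w = y
    · subst hwy; simp only [hy, iff_false]; tauto
    · exact h1 w hwx hwy
  · rintro rfl
    exact ⟨fun _ _ _ => Iff.rfl, by simp [hx, hy, hZ]⟩

theorem image_jointMap_of_none_mem {Z : Set (ContractVert x y)} (hZ : none ∈ Z) :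
    jointMap '' Z = insert none (some '' oldVerts Z) := by
  ext (_ | w)
  · simp only [Set.mem_insert_iff, true_or, iff_true]
    exact ⟨none, hZ, rfl⟩
  · constructor
    · rintro ⟨_ | ⟨t, ht⟩, h1, h2⟩
      · cases h2
      · exact Or.inr ⟨t, ⟨ht, h1⟩, h2⟩
    · rintro (h | ⟨t, ⟨ht, h1⟩, h2⟩)
      · cases h
      · exact ⟨_, h1, h2⟩

theorem image_jointMap_of_none_notMem {Z : Set (ContractVert x y)} (hZ : none ∉ Z) :
    jointMap '' Z = some '' oldVerts Z := by
  ext w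
  constructor
  · rintro ⟨_ | ⟨t, ht⟩, h1, rfl⟩
    · exact absurd h1 hZ
    · exact ⟨t, ⟨ht, h1⟩, rfl⟩
  · rintro ⟨t, ⟨ht, h1⟩, rfl⟩
    exact ⟨_, h1, rfl⟩

theorem isSolid_contract_iff {Z : Set (ContractVert x y)} :
    IsSolid (contract G x y) Z ↔ IsSolid (jointGraph G x y) (jointMap '' Z) :=
  (isSolid_image_iff jointMap_injective contract_adj_iff).symm

theorem isCyc_contract_iff {Z : Set (ContractVert x y)} :
    IsCyc (contract G x y) Z ↔ IsCyc (jointGraph G x y) (jointMap '' Z) :=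
  (isCyc_image_iff jointMap_injective contract_adj_iff).symm

theorem isSolid_some_iff : IsSolid (jointGraph G x y) (some '' S) ↔ IsSolid G S :=
  isSolid_image_iff (Option.some_injective V) fun _ _ => Iff.rfl

theorem isCyc_some_iff : IsCyc (jointGraph G x y) (some '' S) ↔ IsCyc G S :=
  isCyc_image_iff (Option.some_injective V) fun _ _ => Iff.rfl

theorem mem_solids : S ∈ solids G ↔ IsSolid G S := isSolidGraph_induce_iff

theorem mem_inducedCycles : S ∈ inducedCycles G ↔ IsCyc G S := isCycleGraph_induce_iff

/-- In the joint graph this is `Merges.exists_solid` if `none ∈ Z`; otherwise `Z` consists of old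
vertices and lifts unchanged. -/
theorem exists_solid_fibre [Finite V] (hxy : G.Adj x y) {Z : Set (ContractVert x y)}
    (hZ : Z ∈ solids (contract G x y)) : ∃ T ∈ solids G, contractMap x y '' T = Z := by
  rw [mem_solids, isSolid_contract_iff] at hZ
  by_cases hn : none ∈ Z
  · rw [image_jointMap_of_none_mem hn] at hZ
    have h := (jointGraph_merges hxy).exists_solid hZ (Set.mem_insert _ _)
      (by simp [left_notMem_oldVerts]) (by simp [right_notMem_oldVerts])
    rw [Set.insert_sdiff_self_of_notMem (by simp), ← Set.image_insert_eq, ← Set.image_insert_eq,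
      ← Set.image_insert_eq, isSolid_some_iff, isSolid_some_iff, isSolid_some_iff] at h
    simp only [image_contractMap_of_none_mem hn, mem_solids]
    rcases h with h | h | h
    exacts [⟨_, h, by simp⟩, ⟨_, h, by simp⟩, ⟨_, h, by simp⟩]
  · rw [image_jointMap_of_none_notMem hn, isSolid_some_iff] at hZ
    exact ⟨_, mem_solids.2 hZ, (image_contractMap_of_none_notMem hn).2 rfl⟩

end Fibre

end GraphChar

/-! ### Counting solids, cycles, edges and vertices. -/

namespace GraphChar

section Count

open Classical in
theorem ncard_add_ncard_le {α β : Type*} [Finite α] [Finite β] (f : α → β) {C S : Set α}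
    {C' S' T' : Set β}
    (h : ∀ z, (C ∩ f ⁻¹' {z}).ncard + (if z ∈ S' then 1 else 0) ≤
      (S ∩ f ⁻¹' {z}).ncard + (if z ∈ C' then 1 else 0) + (if z ∈ T' then 1 else 0)) :
    C.ncard + S'.ncard ≤ S.ncard + C'.ncard + T'.ncard := by
  have := Fintype.ofFinite α
  have := Fintype.ofFinite β
  have h1 : ∀ D : Set α, D.ncard = ∑ z, (D ∩ f ⁻¹' {z}).ncard := by
    intro D
    rw [Set.ncard_eq_toFinset_card', Finset.card_eq_sum_card_fiberwise (f := f) (t := Finset.univ)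
      (fun _ _ => Finset.mem_coe.2 (Finset.mem_univ _))]
    refine Finset.sum_congr rfl fun z _ => ?_
    rw [Set.ncard_eq_toFinset_card']
    congr 1
    ext a; simp
  have h2 : ∀ D : Set β, D.ncard = ∑ z, if z ∈ D then 1 else 0 := by
    intro D
    rw [Set.ncard_eq_toFinset_card', ← Finset.sum_filter, Finset.sum_const, smul_eq_mul, mul_one]
    congr 1
    ext a; simp
  rw [h1 C, h1 S, h2 S', h2 C', h2 T', ← Finset.sum_add_distrib, ← Finset.sum_add_distrib,
    ← Finset.sum_add_distrib]
  exact Finset.sum_le_sum fun z _ => h z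

variable {V : Type*} {G : SimpleGraph V} {x y : V}

/-- The edges of `G / xy` that arise from triangles containing `xy`, as sets of vertices. -/
def triangleEdges {V : Type*} (G : SimpleGraph V) (x y : V) : Set (Set (ContractVert x y)) :=
  {Z | ∃ p, ∃ h : p ≠ x ∧ p ≠ y, G.Adj x p ∧ G.Adj y p ∧ Z = {none, some ⟨p, h⟩}}

theorem mem_triangleEdges {Z : Set (ContractVert x y)} {p : V} (hZ : none ∈ Z)
    (hp : oldVerts Z = {p}) (hxp : G.Adj x p) (hyp : G.Adj y p) : Z ∈ triangleEdges G x y := by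
  refine ⟨p, ⟨hxp.ne', hyp.ne'⟩, hxp, hyp, ?_⟩
  ext (_ | ⟨w, hw⟩)
  · simp [hZ]
  · have : w ∈ oldVerts Z ↔ w = p := by rw [hp]; rfl
    rw [Set.mem_insert_iff, Set.mem_singleton_iff, Option.some_inj, Subtype.mk.injEq, ← this]
    simp only [reduceCtorEq, false_or]
    exact ⟨fun h => ⟨hw, h⟩, fun ⟨_, h⟩ => h⟩

open Classical in
-- If the fibre contains a cycle and `none ∈ Z`, then `A` is a path and `Z` is not a solid. A cycle
-- `A + x + y` is the only one and is paid for by the cycle `Z` or by a triangle edge. A single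
-- cycle `A + x` or `A + y` is paid for by the cycle `Z` or the solid `A + x + y`, and if both
-- occur, both payments are available.
theorem fibre_count [Finite V] (hxy : G.Adj x y) (Z : Set (ContractVert x y)) :
    (inducedCycles G ∩ (contractMap x y '' ·) ⁻¹' {Z}).ncard +
      (if Z ∈ solids (contract G x y) then 1 else 0) ≤
    (solids G ∩ (contractMap x y '' ·) ⁻¹' {Z}).ncard +
      (if Z ∈ inducedCycles (contract G x y) then 1 else 0) +
      (if Z ∈ triangleEdges G x y then 1 else 0) := by
  have hpos : ∀ T ∈ solids G, contractMap x y '' T = Z →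
      1 ≤ (solids G ∩ (contractMap x y '' ·) ⁻¹' {Z}).ncard := fun T h1 h2 =>
    (Set.ncard_pos).2 ⟨T, h1, h2⟩
  have hle1 : ∀ T, inducedCycles G ∩ (contractMap x y '' ·) ⁻¹' {Z} ⊆ {T} →
      (inducedCycles G ∩ (contractMap x y '' ·) ⁻¹' {Z}).ncard ≤ 1 := fun T h =>
    (Set.ncard_le_ncard h).trans (Set.ncard_singleton T).le
  have hS : (if Z ∈ solids (contract G x y) then 1 else 0) ≤
      (solids G ∩ (contractMap x y '' ·) ⁻¹' {Z}).ncard := by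
    split_ifs with h
    · obtain ⟨T, h1, h2⟩ := exists_solid_fibre hxy h
      exact hpos T h1 h2
    · exact Nat.zero_le _
  by_cases hn : none ∈ Z
  · have hmg := jointGraph_merges hxy
    have hfib : ∀ T, contractMap x y '' T = Z ↔ _ := fun T => image_contractMap_of_none_mem hn
    set A := oldVerts Z with hA
    have hv : (none : Option V) ∉ some '' A := by simp
    have hx : some x ∉ some '' A := by simp [hA, left_notMem_oldVerts]
    have hy : some y ∉ some '' A := by simp [hA, right_notMem_oldVerts]
    have hsol : Z ∈ solids (contract G x y) ↔
        IsSolid (jointGraph G x y) (insert none (some '' A)) := by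
      rw [mem_solids, isSolid_contract_iff, image_jointMap_of_none_mem hn]
    have hcyc : Z ∈ inducedCycles (contract G x y) ↔
        IsCyc (jointGraph G x y) (insert none (some '' A)) := by
      rw [mem_inducedCycles, isCyc_contract_iff, image_jointMap_of_none_mem hn]
    have tr : ∀ S : Set V, S ∈ inducedCycles G ↔ IsCyc (jointGraph G x y) (some '' S) := fun S => by
      rw [mem_inducedCycles, isCyc_some_iff]
    have tr' : ∀ S : Set V, S ∈ solids G ↔ IsSolid (jointGraph G x y) (some '' S) := fun S => by
      rw [mem_solids, isSolid_some_iff]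
    have c1 : insert x A ∈ inducedCycles G ↔
        IsCyc (jointGraph G x y) (insert (some x) (some '' A)) := by
      rw [tr, Set.image_insert_eq]
    have c2 : insert y A ∈ inducedCycles G ↔
        IsCyc (jointGraph G x y) (insert (some y) (some '' A)) := by
      rw [tr, Set.image_insert_eq]
    have c3 : insert x (insert y A) ∈ inducedCycles G ↔
        IsCyc (jointGraph G x y) (insert (some x) (insert (some y) (some '' A))) := by
      rw [tr, Set.image_insert_eq, Set.image_insert_eq]
    have s3 : insert x (insert y A) ∈ solids G ↔
        IsSolid (jointGraph G x y) (insert (some x) (insert (some y) (some '' A))) := by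
      rw [tr', Set.image_insert_eq, Set.image_insert_eq]
    by_cases h3 : insert x (insert y A) ∈ inducedCycles G
    · obtain ⟨k1, k2, k3, k4⟩ := hmg.of_isCyc_both hv hx hy (c3.1 h3)
      rw [← c1] at k1
      rw [← c2] at k2
      rw [← hsol] at k3
      have := hle1 (insert x (insert y A)) (by
        rintro T ⟨hT, hTZ⟩
        rcases (hfib T).1 hTZ with rfl | rfl | rfl
        exacts [absurd hT k1, absurd hT k2, rfl])
      rw [if_neg k3]
      rcases k4 with k4 | ⟨p, hp, hxp, hyp⟩
      · rw [← hcyc] at k4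
        rw [if_pos k4]; omega
      · obtain ⟨q, hq, rfl⟩ : p ∈ some '' A := hp ▸ rfl
        have hAq : A = {q} := by
          rw [← Set.image_singleton] at hp
          exact Set.image_injective.2 (Option.some_injective V) hp
        rw [if_pos (mem_triangleEdges hn hAq hxp hyp)]; omega
    by_cases h1 : insert x A ∈ inducedCycles G
    · obtain ⟨k1, k2⟩ := hmg.of_isCyc_left hv hx hy (c1.1 h1)
      rw [← hsol] at k1
      rw [← hcyc, ← s3] at k2
      rw [if_neg k1]
      by_cases h2 : insert y A ∈ inducedCycles G
      · obtain ⟨k3, k4⟩ := hmg.of_isCyc_left_right hv hx hy (c1.1 h1) (c2.1 h2)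
        rw [← hcyc] at k3
        rw [← s3] at k4
        have h4 := hpos _ k4 ((hfib _).2 (Or.inr (Or.inr rfl)))
        have : (inducedCycles G ∩ (contractMap x y '' ·) ⁻¹' {Z}).ncard ≤ 2 := by
          refine (Set.ncard_le_ncard (t := {insert x A, insert y A}) ?_).trans
            ((Set.ncard_insert_le _ _).trans (by rw [Set.ncard_singleton]))
          rintro T ⟨hT, hTZ⟩
          rcases (hfib T).1 hTZ with rfl | rfl | rfl
          exacts [Or.inl rfl, Or.inr rfl, absurd hT h3]
        rw [if_pos k3]; omega
      · have := hle1 (insert x A) (by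
          rintro T ⟨hT, hTZ⟩
          rcases (hfib T).1 hTZ with rfl | rfl | rfl
          exacts [rfl, absurd hT h2, absurd hT h3])
        rcases k2 with k2 | k2
        · rw [if_pos k2]; omega
        · have := hpos _ k2 ((hfib _).2 (Or.inr (Or.inr rfl)))
          omega
    by_cases h2 : insert y A ∈ inducedCycles G
    · obtain ⟨k1, k2⟩ := hmg.symm.of_isCyc_left hv hy hx (c2.1 h2)
      rw [← hsol] at k1
      rw [Set.insert_comm (some y), ← hcyc, ← s3] at k2
      rw [if_neg k1]
      have := hle1 (insert y A) (by
        rintro T ⟨hT, hTZ⟩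
        rcases (hfib T).1 hTZ with rfl | rfl | rfl
        exacts [absurd hT h1, rfl, absurd hT h3])
      rcases k2 with k2 | k2
      · rw [if_pos k2]; omega
      · have := hpos _ k2 ((hfib _).2 (Or.inr (Or.inr rfl)))
        omega
    · have : inducedCycles G ∩ (contractMap x y '' ·) ⁻¹' {Z} = ∅ := by
        rw [Set.eq_empty_iff_forall_notMem]
        rintro T ⟨hT, hTZ⟩
        rcases (hfib T).1 hTZ with rfl | rfl | rfl
        exacts [h1 hT, h2 hT, h3 hT]
      rw [this, Set.ncard_empty]
      omega
  · have hC : (inducedCycles G ∩ (contractMap x y '' ·) ⁻¹' {Z}).ncard ≤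
        if Z ∈ inducedCycles (contract G x y) then 1 else 0 := by
      split_ifs with h
      · exact hle1 (oldVerts Z) fun T hT => (image_contractMap_of_none_notMem hn).1 hT.2
      · rw [Nat.le_zero, Set.ncard_eq_zero, Set.eq_empty_iff_forall_notMem]
        rintro T ⟨hT, hTZ⟩
        obtain rfl := (image_contractMap_of_none_notMem hn).1 hTZ
        refine h ?_
        rwa [mem_inducedCycles, isCyc_contract_iff, image_jointMap_of_none_notMem hn,
          isCyc_some_iff, ← mem_inducedCycles]
    omega

/-- The contraction loses `xy` and, for each common neighbour `p`, one of the edges `xp`, `yp`. `F`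
collects `xy` and the edges `yp`; the remaining edges still cover all edges of `G / xy`. -/
theorem edge_count [Finite V] (hxy : G.Adj x y) :
    (contract G x y).edgeSet.ncard + 1 + (triangleEdges G x y).ncard ≤ G.edgeSet.ncard := by
  set N : Set V := {p | G.Adj x p ∧ G.Adj y p} with hN
  have hT : (triangleEdges G x y).ncard ≤ N.ncard := by
    refine (Set.ncard_le_ncard (t := (fun p => ({none, contractMap x y p} : Set _)) '' N) ?_).trans
      (Set.ncard_image_le)
    rintro Z ⟨p, hp, h1, h2, rfl⟩
    exact ⟨p, ⟨h1, h2⟩, by rw [← contractMap_of_ne hp]⟩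
  set F : Set (Sym2 V) := insert s(x, y) ((fun p => s(y, p)) '' N) with hF
  have hFcard : F.ncard = N.ncard + 1 := by
    rw [hF, Set.ncard_insert_of_notMem, Set.ncard_image_of_injective]
    · intro p q h
      exact Sym2.congr_right.1 h
    · rintro ⟨p, hp, e⟩
      rcases Sym2.eq_iff.1 e with ⟨rfl, -⟩ | ⟨-, rfl⟩
      · exact G.irrefl hxy
      · exact G.irrefl hp.1
  have hFE : F ⊆ G.edgeSet := by
    rintro e (rfl | ⟨p, hp, rfl⟩)
    exacts [hxy, hp.2]
  have hle : (contract G x y).edgeSet.ncard ≤ (G.edgeSet \ F).ncard := by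
    refine (Set.ncard_le_ncard (t := Sym2.map (contractMap x y) '' (G.edgeSet \ F)) ?_).trans
      Set.ncard_image_le
    have hmix : ∀ b (hb : b ≠ x ∧ b ≠ y), G.Adj x b ∨ G.Adj y b →
        s(none, some ⟨b, hb⟩) ∈ Sym2.map (contractMap x y) '' (G.edgeSet \ F) := by
      intro b hb h
      by_cases hxb : G.Adj x b
      · refine ⟨s(x, b), ⟨hxb, ?_⟩, by
          rw [Sym2.map_mk, contractMap_left, contractMap_of_ne hb]⟩
        rintro (e | ⟨p, hp, e⟩)
        · rcases Sym2.eq_iff.1 e with ⟨-, e⟩ | ⟨-, e⟩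
          exacts [hb.2 e, hb.1 e]
        · rcases Sym2.eq_iff.1 e with ⟨e, -⟩ | ⟨e, -⟩
          exacts [hxy.ne' e, hb.2 e.symm]
      · refine ⟨s(y, b), ⟨h.resolve_left hxb, ?_⟩, by
          rw [Sym2.map_mk, contractMap_right, contractMap_of_ne hb]⟩
        rintro (e | ⟨p, hp, e⟩)
        · rcases Sym2.eq_iff.1 e with ⟨-, e⟩ | ⟨-, e⟩
          exacts [hb.2 e, hb.1 e]
        · rcases Sym2.eq_iff.1 e with ⟨-, rfl⟩ | ⟨e, -⟩
          exacts [hxb hp.1, hb.2 e.symm]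
    intro e
    induction e using Sym2.ind with
    | _ a b =>
      intro h
      rcases a with _ | ⟨a, ha⟩ <;> rcases b with _ | ⟨b, hb⟩
      · exact h.elim
      · exact hmix b hb h
      · rw [Sym2.eq_swap]; exact hmix a ha h
      · refine ⟨s(a, b), ⟨h, ?_⟩, by
          rw [Sym2.map_mk, contractMap_of_ne ha, contractMap_of_ne hb]⟩
        rintro (e | ⟨p, hp, e⟩)
        · rcases Sym2.eq_iff.1 e with ⟨e, -⟩ | ⟨e, -⟩
          exacts [ha.1 e, ha.2 e]
        · rcases Sym2.eq_iff.1 e with ⟨e, -⟩ | ⟨e, -⟩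
          exacts [ha.2 e.symm, hb.2 e.symm]
  have := Set.ncard_sdiff_add_ncard_of_subset hFE
  omega

theorem card_contractVert [Finite V] (hxy : x ≠ y) :
    Nat.card (ContractVert x y) + 1 = Nat.card V := by
  have h1 : Nat.card (ContractVert x y) = ({x, y}ᶜ : Set V).ncard + 1 := by
    rw [Finite.card_option, ← Nat.card_coe_set_eq]
    congr 1
    refine Nat.card_congr (Equiv.subtypeEquivRight fun w => ?_)
    simp
  have := Set.ncard_add_ncard_compl ({x, y} : Set V)
  rw [Set.ncard_pair hxy] at this
  omega

/-- The triangle edges cancel between the fibre count and the edge count, and the loss of the edge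
`xy` cancels the loss of a vertex. -/
theorem beth3_contract_le [Finite V] (hxy : G.Adj x y) : beth3 (contract G x y) ≤ beth3 G := by
  have h1 := ncard_add_ncard_le (contractMap x y '' ·) (fibre_count hxy)
  have h2 := edge_count hxy
  have h3 := card_contractVert hxy.ne
  unfold beth3
  omega

/-- Any choice of one solid in each fibre is injective, since its image under the contraction
recovers the given solid. -/
theorem exists_injection [Finite V] (hxy : G.Adj x y) :
    ∃ Ψ : Set (ContractVert x y) → Set V,
      Set.MapsTo Ψ (solids (contract G x y)) (solids G) ∧
      Set.InjOn Ψ (solids (contract G x y)) ∧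
      ∀ S ∈ solids (contract G x y), contractMap x y '' (Ψ S) = S := by
  choose! Ψ h1 h2 using fun S (hS : S ∈ solids (contract G x y)) => exists_solid_fibre hxy hS
  exact ⟨Ψ, h1, fun S hS T hT e => by rw [← h2 S hS, e, h2 T hT], h2⟩

end Count

end GraphChar

/-! ### Complete minors and the Hadwiger number. -/

namespace GraphChar

/-- Pairwise adjacent disjoint connected branch sets of a complete minor on `t` vertices. -/
structure IsModel {V : Type*} (G : SimpleGraph V) {t : ℕ} (B : Fin t → Set V) : Prop where
  nonempty : ∀ i, (B i).Nonempty
  eq_of_mem : ∀ i j u, u ∈ B i → u ∈ B j → i = j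
  conn : ∀ i, Conn G (B i)
  adj : ∀ i j, i ≠ j → ∃ u ∈ B i, ∃ w ∈ B j, G.Adj u w

section Minor

universe u

variable {V W : Type*} {G : SimpleGraph V} {H : SimpleGraph W} {x y u w : V} {t : ℕ}

theorem contractMap_eq_iff : contractMap x y u = contractMap x y w ↔
    u = w ∨ (u = x ∨ u = y) ∧ (w = x ∨ w = y) := by
  by_cases hu : u ≠ x ∧ u ≠ y
  · by_cases hw : w ≠ x ∧ w ≠ y
    · rw [contractMap_of_ne hu, contractMap_of_ne hw, Option.some_inj, Subtype.mk.injEq]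
      tauto
    · rw [contractMap_eq_none_iff.2 (by tauto : w = x ∨ w = y), contractMap_eq_none_iff]
      constructor
      · tauto
      · rintro (rfl | h)
        · tauto
        · exact h.1
  · have hu' : u = x ∨ u = y := by tauto
    rw [contractMap_eq_none_iff.2 hu', eq_comm, contractMap_eq_none_iff]
    constructor
    · tauto
    · rintro (rfl | h)
      · exact hu'
      · exact h.2

theorem contractMap_adj (h : G.Adj u w) : contractMap x y u = contractMap x y w ∨
    (contract G x y).Adj (contractMap x y u) (contractMap x y w) := by
  by_cases hu : u ≠ x ∧ u ≠ y
  · by_cases hw : w ≠ x ∧ w ≠ y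
    · rw [contractMap_of_ne hu, contractMap_of_ne hw]; exact Or.inr h
    · have hw' : w = x ∨ w = y := by tauto
      rw [contractMap_eq_none_iff.2 hw', contractMap_of_ne hu]
      right
      rcases hw' with rfl | rfl
      exacts [Or.inl h.symm, Or.inr h.symm]
  · have hu' : u = x ∨ u = y := by tauto
    rw [contractMap_eq_none_iff.2 hu']
    by_cases hw : w ≠ x ∧ w ≠ y
    · rw [contractMap_of_ne hw]
      right
      rcases hu' with rfl | rfl
      exacts [Or.inl h, Or.inr h]
    · exact Or.inl (contractMap_eq_none_iff.2 (by tauto)).symm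

theorem exists_adj_of_contract_adj {a b : ContractVert x y} (h : (contract G x y).Adj a b) :
    ∃ u w, contractMap x y u = a ∧ contractMap x y w = b ∧ G.Adj u w := by
  rcases a with _ | ⟨a, ha⟩ <;> rcases b with _ | ⟨b, hb⟩
  · exact h.elim
  · rcases h with h | h
    exacts [⟨x, b, contractMap_left, contractMap_of_ne hb, h⟩,
      ⟨y, b, contractMap_right, contractMap_of_ne hb, h⟩]
  · rcases h with h | h
    exacts [⟨a, x, contractMap_of_ne ha, contractMap_left, h.symm⟩,
      ⟨a, y, contractMap_of_ne ha, contractMap_right, h.symm⟩]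
  · exact ⟨a, b, contractMap_of_ne ha, contractMap_of_ne hb, h⟩

theorem contractMap_surjective : Function.Surjective (contractMap x y) := by
  rintro (_ | ⟨a, ha⟩)
  exacts [⟨x, contractMap_left⟩, ⟨a, contractMap_of_ne ha⟩]

theorem IsModel.of_contract {B : Fin t → Set (ContractVert x y)} (hxy : G.Adj x y)
    (h : IsModel (contract G x y) B) : IsModel G fun i => contractMap x y ⁻¹' B i := by
  refine ⟨fun i => (h.nonempty i).preimage contractMap_surjective,
    fun i j u => h.eq_of_mem i j _, fun i => ?_, fun i j hij => ?_⟩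
  · refine (h.conn i).lift (f := contractMap x y) (fun u hu => hu) ?_ ?_
    · intro a ha b hb hab
      obtain ⟨u, w, rfl, rfl, huw⟩ := exists_adj_of_contract_adj hab
      exact ⟨u, ha, w, hb, rfl, rfl, huw⟩
    · intro u hu w hw e
      rcases contractMap_eq_iff.1 e with rfl | ⟨rfl | rfl, rfl | rfl⟩
      exacts [.refl, .refl, .of_adj hu hw hxy, .of_adj hu hw hxy.symm, .refl]
  · obtain ⟨a, ha, b, hb, hab⟩ := h.adj i j hij
    obtain ⟨u, w, rfl, rfl, huw⟩ := exists_adj_of_contract_adj hab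
    exact ⟨u, ha, w, hb, huw⟩

/-- The hypothesis `hxy` admits an edge inside a branch set or with an end outside all of them;
contracting it identifies no two branch sets. -/
theorem IsModel.contract {B : Fin t → Set V} (h : IsModel G B)
    (hxy : ∀ i j, x ∈ B i → y ∈ B j → i = j) :
    IsModel (GraphChar.contract G x y) fun i => contractMap x y '' B i := by
  have hdis : ∀ i j, ∀ u ∈ B i, ∀ w ∈ B j, contractMap x y u = contractMap x y w → i = j := by
    intro i j u hu w hw e
    rcases contractMap_eq_iff.1 e with rfl | ⟨rfl | rfl, rfl | rfl⟩
    exacts [h.eq_of_mem i j _ hu hw, h.eq_of_mem i j _ hu hw, hxy i j hu hw, (hxy j i hw hu).symm,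
      h.eq_of_mem i j _ hu hw]
  refine ⟨fun i => (h.nonempty i).image _, ?_, fun i => (h.conn i).image fun u _ w _ huw =>
    contractMap_adj huw, fun i j hij => ?_⟩
  · rintro i j _ ⟨u, hu, rfl⟩ ⟨w, hw, e⟩
    exact hdis i j u hu w hw e.symm
  · obtain ⟨u, hu, w, hw, huw⟩ := h.adj i j hij
    exact ⟨_, ⟨u, hu, rfl⟩, _, ⟨w, hw, rfl⟩, (contractMap_adj huw).resolve_left fun e =>
      hij (hdis i j u hu w hw e)⟩

theorem ContractsTo.exists_model {V : Type u} {G : SimpleGraph V}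
    (h : ContractsTo (⊤ : SimpleGraph (Fin t)) G) : ∃ B : Fin t → Set V, IsModel G B := by
  induction h with
  | iso φ =>
    refine ⟨fun i => {φ.symm i}, fun i => Set.singleton_nonempty _, ?_, fun i => conn_singleton _,
      fun i j hij => ⟨_, rfl, _, rfl, φ.symm.map_adj_iff.2 hij⟩⟩
    rintro i j u rfl e
    exact φ.symm.injective e
  | step hxy _ ih =>
    obtain ⟨B, hB⟩ := ih
    exact ⟨_, hB.of_contract hxy⟩

theorem IsMinor.exists_model (h : IsMinor (⊤ : SimpleGraph (Fin t)) G) :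
    ∃ B : Fin t → Set V, IsModel G B := by
  obtain ⟨G', h⟩ := h
  obtain ⟨B, hB⟩ := h.exists_model
  refine ⟨fun i => Subtype.val '' B i, fun i => (hB.nonempty i).image _, ?_, fun i =>
    (hB.conn i).image fun u _ w _ huw => Or.inr (G'.adj_sub huw), fun i j hij => ?_⟩
  · rintro i j _ ⟨u, hu, rfl⟩ ⟨w, hw, e⟩
    exact hB.eq_of_mem i j u hu (Subtype.val_injective e ▸ hw)
  · obtain ⟨u, hu, w, hw, huw⟩ := hB.adj i j hij
    exact ⟨_, ⟨u, hu, rfl⟩, _, ⟨w, hw, rfl⟩, G'.adj_sub huw⟩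

theorem IsModel.le_card [Finite V] {B : Fin t → Set V} (h : IsModel G B) : t ≤ Nat.card V := by
  choose f hf using h.nonempty
  have hinj : Function.Injective f := fun i j e => h.eq_of_mem i j _ (hf i) (e ▸ hf j)
  simpa using Nat.card_le_card_of_injective f hinj

theorem isMinor_top_hadwigerNumber [Finite V] (G : SimpleGraph V) :
    IsMinor (⊤ : SimpleGraph (Fin (hadwigerNumber G))) G := by
  have : sSup {t : ℕ | IsMinor (⊤ : SimpleGraph (Fin t)) G} ∈
      {t : ℕ | IsMinor (⊤ : SimpleGraph (Fin t)) G} := by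
    -- The value 0 occurs through the empty subgraph, and the number of vertices is an upper bound,
    -- so the supremum is attained.
    refine Nat.sSup_mem ⟨0, ⊥, .iso ⟨⟨fun v => v.2.elim, fun i => i.elim0, fun v => v.2.elim,
      fun i => i.elim0⟩, fun {v} => v.2.elim⟩⟩ ⟨Nat.card V, fun t ht => ?_⟩
    obtain ⟨B, hB⟩ := IsMinor.exists_model ht
    exact hB.le_card
  exact this

theorem one_le_hadwigerNumber [Finite V] [Nonempty V] (G : SimpleGraph V) :
    1 ≤ hadwigerNumber G := by
  refine le_csSup ⟨Nat.card V, fun t ht => ?_⟩ ?_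
  · obtain ⟨B, hB⟩ := IsMinor.exists_model ht
    exact hB.le_card
  · obtain ⟨v⟩ := ‹Nonempty V›
    have : Unique (G.singletonSubgraph v).verts :=
      ⟨⟨⟨v, rfl⟩⟩, fun w => Subtype.ext w.2⟩
    refine ⟨G.singletonSubgraph v, .iso ⟨Equiv.ofUnique _ _, ?_⟩⟩
    intro a b
    rw [Subsingleton.elim a b]
    simp

theorem beth3_congr (φ : G ≃g H) : beth3 G = beth3 H := by
  have hadj : ∀ a b, G.Adj a b ↔ H.Adj (φ a) (φ b) := fun a b => φ.map_adj_iff.symm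
  have himg : ∀ S : Set W, φ '' (φ.symm '' S) = S := by
    intro S
    rw [← Set.image_comp]; simp
  have hinj : Function.Injective (fun S : Set V => φ '' S) := Set.image_injective.2 φ.injective
  have h1 : solids H = (fun S : Set V => φ '' S) '' solids G := by
    ext S
    constructor
    · intro hS
      refine ⟨φ.symm '' S, ?_, himg S⟩
      rw [mem_solids, ← isSolid_image_iff φ.injective hadj, himg, ← mem_solids]
      exact hS
    · rintro ⟨T, hT, rfl⟩
      exact mem_solids.2 ((isSolid_image_iff φ.injective hadj).2 (mem_solids.1 hT))
  have h2 : inducedCycles H = (fun S : Set V => φ '' S) '' inducedCycles G := by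
    ext S
    constructor
    · intro hS
      refine ⟨φ.symm '' S, ?_, himg S⟩
      rw [mem_inducedCycles, ← isCyc_image_iff φ.injective hadj, himg, ← mem_inducedCycles]
      exact hS
    · rintro ⟨T, hT, rfl⟩
      exact mem_inducedCycles.2 ((isCyc_image_iff φ.injective hadj).2 (mem_inducedCycles.1 hT))
  have h3 : G.edgeSet.ncard = H.edgeSet.ncard := by
    rw [← Nat.card_coe_set_eq, ← Nat.card_coe_set_eq]
    exact Nat.card_congr φ.mapEdgeSet
  unfold beth3
  rw [h1, h2, Set.ncard_image_of_injective _ hinj, Set.ncard_image_of_injective _ hinj, h3,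
    Nat.card_congr φ.toEquiv]

/-- By `hB` no edge lies inside a branch set, so the connected branch sets are single vertices.
Every edge has both ends covered, so in a connected graph with at least one branch set no vertex is
left over. -/
theorem IsModel.nonempty_iso {B : Fin t → Set V} (h : IsModel G B) (ht : 1 ≤ t)
    (hG : Conn G Set.univ) (hB : ∀ x y, G.Adj x y → ∃ i j, x ∈ B i ∧ y ∈ B j ∧ i ≠ j) :
    Nonempty ((⊤ : SimpleGraph (Fin t)) ≃g G) := by
  have hsing : ∀ i, ∀ u ∈ B i, ∀ w ∈ B i, u = w := by
    intro i u hu w hw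
    by_contra hne
    obtain ⟨c, hc, huc⟩ := (h.conn i).exists_adj hu hw hne
    obtain ⟨j, k, hj, hk, hjk⟩ := hB u c huc
    exact hjk ((h.eq_of_mem j i u hj hu).trans (h.eq_of_mem i k c hc hk))
  have hcov : ∀ v, ∃ i, v ∈ B i := by
    intro v
    obtain ⟨b, hb⟩ := h.nonempty ⟨0, ht⟩
    by_cases hvb : v = b
    · exact ⟨_, hvb ▸ hb⟩
    · obtain ⟨c, -, hc⟩ := hG.exists_adj (Set.mem_univ v) (Set.mem_univ b) hvb
      obtain ⟨i, j, hi, -⟩ := hB v c hc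
      exact ⟨i, hi⟩
  choose f hf using h.nonempty
  have hbij : Function.Bijective f := by
    refine ⟨fun i j e => h.eq_of_mem i j _ (hf i) (e ▸ hf j), fun v => ?_⟩
    obtain ⟨i, hi⟩ := hcov v
    exact ⟨i, hsing i _ (hf i) v hi⟩
  refine ⟨⟨Equiv.ofBijective f hbij, fun {i j} => ⟨fun hij => ?_, fun hij => ?_⟩⟩⟩
  · rintro rfl
    exact G.irrefl hij
  · obtain ⟨u, hu, w, hw, huw⟩ := h.adj i j hij
    change G.Adj (f i) (f j)
    rwa [hsing i _ (hf i) u hu, hsing j _ (hf j) w hw]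

/-- Contract edges that do not join two different branch sets, by induction on the number of
vertices. Connectedness lets vertices outside the branch sets be absorbed instead of deleted, so
only contractions are needed. -/
theorem IsModel.beth3_le {V : Type u} [Finite V] {G : SimpleGraph V} {B : Fin t → Set V}
    (h : IsModel G B) (ht : 1 ≤ t) (hG : Conn G Set.univ) :
    beth3 (⊤ : SimpleGraph (Fin t)) ≤ beth3 G := by
  induction hn : Nat.card V generalizing V with
  | zero =>
    have := h.le_card
    omega
  | succ n ih =>
    by_cases hB : ∀ x y, G.Adj x y → ∃ i j, x ∈ B i ∧ y ∈ B j ∧ i ≠ j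
    · obtain ⟨φ⟩ := h.nonempty_iso ht hG hB
      exact (beth3_congr φ).le
    · push Not at hB
      obtain ⟨x, y, hxy, hij⟩ := hB
      have hcard := card_contractVert hxy.ne
      refine (ih (h.contract hij) ?_ (by omega)).trans (beth3_contract_le hxy)
      have := hG.image (f := contractMap x y) fun _ _ _ _ huw => contractMap_adj huw
      rwa [Set.image_univ, contractMap_surjective.range_eq] at this

theorem conn_univ (h : G.Preconnected) : Conn G Set.univ := by
  rintro a - b -
  obtain ⟨p⟩ := h a b
  induction p with
  | nil => exact .refl
  | cons hab _ ih => exact (Reach.of_adj (Set.mem_univ _) (Set.mem_univ _) hab).trans ih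

theorem ncard_sets_of_card (t k : ℕ) :
    {s : Set (Fin t) | ∃ F : Finset (Fin t), F.card = k ∧ s = F}.ncard = t.choose k := by
  have : {s : Set (Fin t) | ∃ F : Finset (Fin t), F.card = k ∧ s = F} =
      (fun F : Finset (Fin t) => (F : Set (Fin t))) ''
        (Finset.powersetCard k Finset.univ : Finset (Finset (Fin t))) := by
    ext s
    constructor
    · rintro ⟨F, hF, rfl⟩
      exact ⟨F, by simp [Finset.mem_powersetCard, hF], rfl⟩
    · rintro ⟨F, hF, rfl⟩
      exact ⟨F, (Finset.mem_powersetCard.1 hF).2, rfl⟩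
  rw [this, Set.ncard_image_of_injective _ Finset.coe_injective, Set.ncard_coe_finset,
    Finset.card_powersetCard, Finset.card_univ, Fintype.card_fin]

/-- Every four vertices form a pyramid and every induced cycle is a triangle; bounds in these two
directions suffice. -/
theorem le_beth3_top (t : ℕ) :
    (t.choose 4 : ℤ) - t.choose 3 + t.choose 2 - t ≤ beth3 (⊤ : SimpleGraph (Fin t)) := by
  have h4 : t.choose 4 ≤ (solids (⊤ : SimpleGraph (Fin t))).ncard := by
    rw [← ncard_sets_of_card t 4]
    refine Set.ncard_le_ncard ?_
    rintro _ ⟨F, hF, rfl⟩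
    obtain ⟨d, F', hd, rfl, hF'⟩ := Finset.card_eq_succ.1 hF
    obtain ⟨a, b, c, hab, hac, hbc, rfl⟩ := Finset.card_eq_three.1 hF'
    have hda : d ≠ a ∧ d ≠ b ∧ d ≠ c := by simpa using hd
    rw [mem_solids]
    refine Or.inl ⟨{a, b, c}, d, isCyc_triangle hab hac hbc, by simpa using hd, by simp, a, by simp,
      b, by simp, c, by simp, hab, hac, hbc, hda.1, hda.2.1, hda.2.2⟩
  have h3 : (inducedCycles (⊤ : SimpleGraph (Fin t))).ncard ≤ t.choose 3 := by
    rw [← ncard_sets_of_card t 3]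
    refine Set.ncard_le_ncard ?_
    intro C hC
    obtain ⟨v, a, b, S, rfl, h⟩ := mem_inducedCycles.1 hC
    refine ⟨{v, a, b}, Finset.card_eq_three.2 ⟨v, a, b, h.left.ne, h.right.ne, h.ne, rfl⟩, ?_⟩
    -- Distinct vertices are adjacent here, so the path closed by `v` is a single edge.
    rw [h.path.eq_pair h.ne]; simp
  have h2 : (⊤ : SimpleGraph (Fin t)).edgeSet.ncard = t.choose 2 := by
    classical
    have := SimpleGraph.card_edgeFinset_top_eq_card_choose_two (V := Fin t)
    rw [Fintype.card_fin] at this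
    rw [← this, ← SimpleGraph.coe_edgeFinset, Set.ncard_coe_finset]
  unfold beth3
  rw [Nat.card_eq_fintype_card, Fintype.card_fin, h2]
  omega

end Minor

end GraphChar

theorem theorem4p2p1 {V : Type*} [Finite V] (G : SimpleGraph V) :
    (∀ x y : V, G.Adj x y →
      (∃ Ψ : Set (GraphChar.ContractVert x y) → Set V,
        Set.MapsTo Ψ (GraphChar.solids (GraphChar.contract G x y)) (GraphChar.solids G) ∧
        Set.InjOn Ψ (GraphChar.solids (GraphChar.contract G x y)) ∧
        ∀ S ∈ GraphChar.solids (GraphChar.contract G x y),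
          GraphChar.contractMap x y '' (Ψ S) = S) ∧
      GraphChar.beth3 (GraphChar.contract G x y) ≤ GraphChar.beth3 G) ∧
    (G.Connected →
      GraphChar.beth3 (⊤ : SimpleGraph (Fin (GraphChar.hadwigerNumber G))) ≤
          GraphChar.beth3 G ∧
      ((GraphChar.hadwigerNumber G).choose 4 : ℤ) - (GraphChar.hadwigerNumber G).choose 3
          + (GraphChar.hadwigerNumber G).choose 2 - (GraphChar.hadwigerNumber G) ≤
        GraphChar.beth3 G) := by
  refine ⟨fun x y hxy => ⟨GraphChar.exists_injection hxy, GraphChar.beth3_contract_le hxy⟩,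
    fun hG => ?_⟩
  have := hG.nonempty
  obtain ⟨B, hB⟩ := (GraphChar.isMinor_top_hadwigerNumber G).exists_model
  have hle := hB.beth3_le (GraphChar.one_le_hadwigerNumber G) (GraphChar.conn_univ hG.preconnected)
  exact ⟨hle, (GraphChar.le_beth3_top _).trans hle⟩
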